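/- **Moments formula.** Let $T$ be a locally compact Polish space and $\sigma$ a non-atomic Radon measure on its Borel $\sigma$-algebra. Let $A\subset T^2$ be a Borel set that is symmetric, contains the diagonal and satisfies $\sigma^{\otimes 2}(A)=0$, and let $Q:T^2\setminus A\to\{z\in\mathbb C:|z|=1\}$ be measurable and Hermitian, i.e. $Q(s,t)=\overline{Q(t,s)}$. Fix $\lambda\in\mathbb R$. *Fock space.* For $1\le j<n$ let $(\Psi_jf)(t_1,\dots,t_n)=Q(t_j,t_{j+1})f(t_1,\dots,t_{j+1},t_j,\dots,t_n)$ on $L^2(T^n\to\mathbb C,\sigma^{\otimes n})$. Let $\mathcal H_{\mathbb C}^{\circledast n}$ be the closed subspace of $Q$-symmetric functions ($\Psi_jf=f$ for all $j$), with $\mathcal H_{\mathbb C}^{\circledast 0}=\mathbb C$, and let $P_n$ be the orthogonal projection of $L^2(T^n\to\mathbb C,\sigma^{\otimes n})$ onto it. Let $\mathcal F_{\rm fin}$ be the space of finite sequences $F=(f^{(0)},f^{(1)},\dots)$ with $f^{(n)}\in\mathcal H_{\mathbb C}^{\circledast n}$, with inner product $(F,G)=\sum_n n!\,(f^{(n)},g^{(n)})$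 and vacuum $\Omega=(1,0,0,\dots)$. Convergence in $\mathcal F_{\rm fin}$ means uniform finiteness of the non-zero components together with $L^2$-convergence of each component. *Field.* For $h\in L^2(T\to\mathbb C,\sigma)$ let $a^+(h)f^{(n)}=P_{n+1}(h\otimes f^{(n)})$ and let $a^-(h)$ be the adjoint of $a^+(h)$, restricted to $\mathcal F_{\rm fin}$. For $f\in B_0(T)$ (real-valued bounded measurable functions with compact support) let $(a^0(f)g^{(n)})(t_1,\dots,t_n)=(f(t_1)+\dots+f(t_n))g^{(n)}(t_1,\dots,t_n)$ and $$\langle f,\omega\rangle=a^+(f)+\lambda a^0(f)+a^-(f).$$ *Monomials.* Let $n\ge 0$ be an integer and let $B_0(T^n\to\mathbb C)$ be the space of complex-valued bounded measurable functions on $T^n$ with compact support. There is a unique linear map $f^{(n)}\mapsto\langle f^{(n)},\omega^{\otimes n}\rangle$ from $B_0(T^n\to\mathbb C)$ to the continuous linear operators on $\mathcal F_{\rm fin}$ such that $\langle f_1\otimes\dots\otimes f_n,\omega^{\otimes n}\rangle=\langle f_1,\omega\rangle\cdots\langle f_n,\omega\rangle$ for all $f_1,\dots,f_n\in B_0(T)$,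 and such that $\langle g_k,\omega^{\otimes n}\rangle F\to\langle g,\omega^{\otimes n}\rangle F$ for every $F\in\mathcal F_{\rm fin}$ whenever $g_k,g\in B_0(T^n\to\mathbb C)$, the $g_k$ are uniformly bounded and supported in a common compact set, and $g_k\to g$ pointwise. Let $\tau(p)=(p\,\Omega,\Omega)$ be the vacuum state. *Formula.* For every $f^{(n)}\in B_0(T^n\to\mathbb C)$, $$\tau(\langle f^{(n)},\omega^{\otimes n}\rangle)=\sum_{\mathcal V\in\mathcal P^{(n)}_{\ge2}}\int_{T^n}f^{(n)}(t_1,\dots,t_n)\,Q(\mathcal V;t_1,\dots,t_n)\prod_{B\in\mathcal V}\lambda^{|B|-2}\,\delta(dt_B),$$ all the integrals being absolutely convergent. Here $\mathcal P^{(n)}_{\ge2}$ is the set of partitions of $\{1,\dots,n\}$ all of whose blocks have at least two elements; for $B=\{i_1,\dots,i_k\}$, $\delta(dt_B)=\delta(dt_{i_1}\times\dots\times dt_{i_k})$ is the measure on $T^k$ with $\int g\,d\delta=\int_Tg(s,\dots,s)\,\sigma(ds)$; $\lambda^0=1$, also for $\lambda=0$; and $$Q(\mathcal V;t_1,\dots,t_n)=\prod_{\substack{B_1,B_2\in\mathcal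 V\\ \min B_1<\min B_2<\max B_1<\max B_2}}Q(t_{\min B_2},t_{\max B_1}),$$ which is defined almost everywhere with respect to $\prod_{B\in\mathcal V}\delta(dt_B)$. -/

import Mathlib

open MeasureTheory Filter Topology
open scoped ENNReal ComplexConjugate

namespace QField

section TestFunctions

/-- `B0 𝕜 X`: the space of bounded measurable `𝕜`-valued functions on `X` with compact support. -/
def B0 (𝕜 X : Type*) [RCLike 𝕜] [TopologicalSpace X] [MeasurableSpace X] :
    Submodule 𝕜 (X → 𝕜) where
  carrier := {f | Measurable f ∧ (∃ C : ℝ, ∀ x, ‖f x‖ ≤ C) ∧ HasCompactSupport f}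
  zero_mem' := ⟨measurable_const, ⟨0, fun x => by simp⟩, HasCompactSupport.zero⟩
  add_mem' := by
    rintro f g ⟨hf, ⟨C, hC⟩, hfs⟩ ⟨hg, ⟨D, hD⟩, hgs⟩
    exact ⟨hf.add hg, ⟨C + D, fun x => (norm_add_le _ _).trans (add_le_add (hC x) (hD x))⟩,
      hfs.add hgs⟩
  smul_mem' := by
    rintro c f ⟨hf, ⟨C, hC⟩, hfs⟩
    refine ⟨hf.const_smul c, ⟨‖c‖ * C, fun x => ?_⟩, ?_⟩
    · simpa [norm_mul] using mul_le_mul_of_nonneg_left (hC x) (norm_nonneg c)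
    · exact hfs.mono fun x hx => by
        simp only [Function.mem_support, Pi.smul_apply] at hx ⊢
        intro h0
        exact hx (by simp [h0])

variable {T : Type*} [TopologicalSpace T] [MeasurableSpace T]

/-- The tensor product `(f₁ ⊗ ⋯ ⊗ fₙ)(t₁, …, tₙ) = f₁(t₁) ⋯ fₙ(tₙ)` of real test functions, as a
complex-valued test function on `Tⁿ`. -/
def tensorB0 [T2Space T] {n : ℕ} (f : Fin n → B0 ℝ T) : B0 ℂ (Fin n → T) :=
  ⟨fun t => ∏ i, (((f i).1 (t i) : ℝ) : ℂ), by
    refine ⟨?_, ?_, ?_⟩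
    · exact Finset.measurable_prod _ fun i _ =>
        Complex.measurable_ofReal.comp ((f i).2.1.comp (measurable_pi_apply i))
    · choose C hC using fun i => (f i).2.2.1
      refine ⟨∏ i, C i, fun t => ?_⟩
      rw [norm_prod]
      refine Finset.prod_le_prod (fun i _ => norm_nonneg _) fun i _ => ?_
      simpa using hC i (t i)
    · refine HasCompactSupport.intro
        (isCompact_univ_pi fun i => (f i).2.2.2.isCompact) fun t ht => ?_
      simp only [Set.mem_univ_pi, not_forall] at ht
      obtain ⟨i, hi⟩ := ht
      exact Finset.prod_eq_zero (Finset.mem_univ i) (by simp [image_eq_zero_of_notMem_tsupport hi])⟩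

end TestFunctions

section Kernel

variable {T : Type*} [MeasurableSpace T]

/-- The function `Q` fixing the statistics: a measurable Hermitian function with values in the unit
circle, defined on the complement of a symmetric `σ ⊗ σ`-null set `A` which contains the
diagonal. -/
structure Kernel (σ : Measure T) where
  A : Set (T × T)
  measurableSet_A : MeasurableSet A
  symm_A : ∀ s t, (s, t) ∈ A → (t, s) ∈ A
  diag_A : ∀ t, (t, t) ∈ A
  null_A : (σ.prod σ) A = 0
  toFun : {p : T × T // p ∉ A} → ℂ
  measurable_toFun : Measurable toFun
  norm_toFun : ∀ p, ‖toFun p‖ = 1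
  hermitian : ∀ s t (h : (s, t) ∉ A) (h' : (t, s) ∉ A),
    toFun ⟨(s, t), h⟩ = conj (toFun ⟨(t, s), h'⟩)

variable {σ : Measure T}

open Classical in
/-- `Q(s, t)`, extended by the value `1` to the null set `A`. -/
noncomputable def Kernel.val (Q : Kernel σ) (s t : T) : ℂ :=
  if h : (s, t) ∈ Q.A then 1 else Q.toFun ⟨(s, t), h⟩

theorem Kernel.norm_val (Q : Kernel σ) (s t : T) : ‖Q.val s t‖ = 1 := by
  unfold Kernel.val
  split_ifs with h
  · simp
  · exact Q.norm_toFun _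

theorem Kernel.measurable_val (Q : Kernel σ) : Measurable fun p : T × T => Q.val p.1 p.2 := by
  classical
  exact Measurable.dite (s := Q.A) (f := fun _ => (1 : ℂ)) (g := fun p => Q.toFun p)
    measurable_const Q.measurable_toFun Q.measurableSet_A

theorem measurable_val_eval (Q : Kernel σ) {ι : Type*} (i j : ι) :
    Measurable fun t : ι → T => Q.val (t i) (t j) := by
  have h : Measurable fun t : ι → T => (t i, t j) :=
    (measurable_pi_apply i).prodMk (measurable_pi_apply j)
  exact Q.measurable_val.comp h

end Kernel

section Operators

/-- Multiplication by an essentially bounded function, as a bounded operator on `L²`. -/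
noncomputable def mulOp {X : Type*} [MeasurableSpace X] {μ : Measure X} (φ : X → ℂ)
    (hφ : MemLp φ ∞ μ) : Lp ℂ 2 μ →L[ℂ] Lp ℂ 2 μ :=
  (ContinuousLinearMap.mul ℂ ℂ).holderL μ ∞ 2 2 (hφ.toLp φ)

theorem coeFn_mulOp {X : Type*} [MeasurableSpace X] {μ : Measure X} (φ : X → ℂ)
    (hφ : MemLp φ ∞ μ) (f : Lp ℂ 2 μ) : mulOp φ hφ f =ᵐ[μ] fun x => φ x * f x := by
  filter_upwards [(ContinuousLinearMap.mul ℂ ℂ).coeFn_holder (r := 2) (hφ.toLp φ) f,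
    hφ.coeFn_toLp] with x h1 h2
  change ((ContinuousLinearMap.mul ℂ ℂ).holder 2 (hφ.toLp φ) f) x = _
  rw [h1, h2]
  rfl

/-- A bounded measurable function is essentially bounded. -/
theorem memLp_top {X : Type*} [MeasurableSpace X] {μ : Measure X} {φ : X → ℂ}
    (hm : Measurable φ) (hb : ∃ C : ℝ, ∀ x, ‖φ x‖ ≤ C) : MemLp φ ∞ μ := by
  obtain ⟨C, hC⟩ := hb
  exact memLp_top_of_bound hm.aestronglyMeasurable C (ae_of_all _ hC)

theorem eLpNorm_tensor {X Y : Type*} [MeasurableSpace X] [MeasurableSpace Y] {μ : Measure X}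
    {ν : Measure Y} [SigmaFinite μ] [SigmaFinite ν] {f : X → ℂ} {g : Y → ℂ}
    (hf : AEStronglyMeasurable f μ) (hg : AEStronglyMeasurable g ν) :
    eLpNorm (fun p : X × Y => f p.1 * g p.2) 2 (μ.prod ν) = eLpNorm f 2 μ * eLpNorm g 2 ν := by
  have h2 : (2 : ℝ≥0∞) ≠ 0 := by norm_num
  have h2' : (2 : ℝ≥0∞) ≠ ∞ := by norm_num
  simp only [eLpNorm_eq_lintegral_rpow_enorm_toReal h2 h2', enorm_mul]
  rw [← ENNReal.mul_rpow_of_nonneg _ _ (by positivity)]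
  congr 1
  rw [← lintegral_prod_mul (hf.enorm.pow_const _) (hg.enorm.pow_const _)]
  refine lintegral_congr fun p => ?_
  rw [ENNReal.mul_rpow_of_nonneg _ _ (by positivity)]

variable {T : Type*} [MeasurableSpace T]

theorem memLp_sum_eval [TopologicalSpace T] {σ : Measure T} (f : B0 ℝ T) (n : ℕ) :
    MemLp (fun t : Fin n → T => ∑ i, ((f.1 (t i) : ℝ) : ℂ)) ∞ (Measure.pi fun _ => σ) := by
  obtain ⟨C, hC⟩ := f.2.2.1
  refine memLp_top ?_ ⟨∑ _i : Fin n, C, fun t => ?_⟩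
  · exact Finset.measurable_sum _ fun i _ =>
      Complex.measurable_ofReal.comp (f.2.1.comp (measurable_pi_apply i))
  · exact (norm_sum_le _ _).trans (Finset.sum_le_sum fun i _ => by simpa using hC (t i))

theorem memLp_two [TopologicalSpace T] [OpensMeasurableSpace T] {σ : Measure T}
    [IsFiniteMeasureOnCompacts σ] (f : B0 ℝ T) :
    MemLp (fun t => ((f.1 t : ℝ) : ℂ)) 2 σ := by
  obtain ⟨C, hC⟩ := f.2.2.1
  have hK := f.2.2.2
  have hfin : IsFiniteMeasure (σ.restrict (tsupport f.1)) :=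
    ⟨by simpa using hK.isCompact.measure_lt_top⟩
  have h1 : MemLp (fun t => ((f.1 t : ℝ) : ℂ)) 2 (σ.restrict (tsupport f.1)) :=
    MemLp.of_bound (Complex.measurable_ofReal.comp f.2.1).aestronglyMeasurable C
      (ae_of_all _ fun t => by simpa using hC t)
  rw [← memLp_indicator_iff_restrict (isClosed_tsupport _).measurableSet] at h1
  convert h1 using 1
  funext t
  by_cases ht : t ∈ tsupport f.1
  · simp [ht]
  · simp [ht, image_eq_zero_of_notMem_tsupport ht]

theorem memLp_one_pt {σ : Measure T} :
    MemLp (fun _ : Fin 0 → T => (1 : ℂ)) 2 (Measure.pi fun _ => σ) := by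
  rw [Measure.pi_of_empty]
  exact memLp_const 1

/-- `ℋ_ℂ^{⊗n} = L²(Tⁿ → ℂ, σ^{⊗n})`. -/
abbrev L2n (σ : Measure T) (n : ℕ) : Type _ := Lp ℂ 2 (Measure.pi fun _ : Fin n => σ)

variable (σ : Measure T) [SigmaFinite σ]

theorem measurePreserving_headTail (n : ℕ) : MeasurePreserving
    (fun t : Fin (n + 1) → T => (t 0, fun i : Fin n => t i.succ))
    (Measure.pi fun _ => σ) (σ.prod (Measure.pi fun _ => σ)) :=
  measurePreserving_piFinSuccAbove (fun _ : Fin (n + 1) => σ) 0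

theorem eLpNorm_tensorFun {n : ℕ} (h : Lp ℂ 2 σ) (f : L2n σ n) :
    AEStronglyMeasurable (fun t : Fin (n + 1) → T => h (t 0) * f (fun i => t i.succ))
      (Measure.pi fun _ => σ) ∧
    eLpNorm (fun t : Fin (n + 1) → T => h (t 0) * f (fun i => t i.succ)) 2
      (Measure.pi fun _ => σ) = eLpNorm h 2 σ * eLpNorm f 2 (Measure.pi fun _ => σ) := by
  have hF : AEStronglyMeasurable (fun p : T × (Fin n → T) => h p.1 * f p.2)
      (σ.prod (Measure.pi fun _ => σ)) :=
    (Lp.aestronglyMeasurable h).comp_fst.mul (Lp.aestronglyMeasurable f).comp_snd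
  have h1 := hF.comp_measurePreserving (measurePreserving_headTail σ n)
  have h2 := eLpNorm_comp_measurePreserving (p := 2) hF (measurePreserving_headTail σ n)
  rw [eLpNorm_tensor (Lp.aestronglyMeasurable h) (Lp.aestronglyMeasurable f)] at h2
  exact ⟨h1, h2⟩

theorem memLp_tensorFun {n : ℕ} (h : Lp ℂ 2 σ) (f : L2n σ n) :
    MemLp (fun t : Fin (n + 1) → T => h (t 0) * f (fun i => t i.succ)) 2
      (Measure.pi fun _ => σ) := by
  refine ⟨(eLpNorm_tensorFun σ h f).1, ?_⟩
  rw [(eLpNorm_tensorFun σ h f).2]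
  exact ENNReal.mul_lt_top (Lp.memLp h).2 (Lp.memLp f).2

theorem quasi_tail (n : ℕ) : Measure.QuasiMeasurePreserving
    (fun (t : Fin (n + 1) → T) (i : Fin n) => t i.succ)
    (Measure.pi fun _ => σ) (Measure.pi fun _ => σ) :=
  Measure.quasiMeasurePreserving_snd.comp
    (measurePreserving_headTail σ n).quasiMeasurePreserving

/-- The operator `f ↦ h ⊗ f`, where `(h ⊗ f)(t₁, …, tₙ₊₁) = h(t₁) f(t₂, …, tₙ₊₁)`. -/
noncomputable def tensorLeft (h : Lp ℂ 2 σ) (n : ℕ) : L2n σ n →L[ℂ] L2n σ (n + 1) :=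
  LinearMap.mkContinuous
    { toFun := fun f => (memLp_tensorFun σ h f).toLp _
      map_add' := fun f g => by
        rw [← MemLp.toLp_add]
        refine MemLp.toLp_congr _ _ ?_
        filter_upwards [(quasi_tail σ n).ae_eq_comp (Lp.coeFn_add f g)] with t ht
        simp only [Function.comp_apply, Pi.add_apply] at ht ⊢
        rw [ht, mul_add]
      map_smul' := fun c f => by
        rw [RingHom.id_apply, ← MemLp.toLp_const_smul]
        refine MemLp.toLp_congr _ _ ?_
        filter_upwards [(quasi_tail σ n).ae_eq_comp (Lp.coeFn_smul c f)] with t ht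
        simp only [Function.comp_apply, Pi.smul_apply, smul_eq_mul] at ht ⊢
        rw [ht]
        ring }
    ‖h‖ fun f => by
      change ‖(memLp_tensorFun σ h f).toLp _‖ ≤ _
      rw [Lp.norm_toLp, (eLpNorm_tensorFun σ h f).2, ENNReal.toReal_mul]
      exact le_of_eq rfl

theorem measurePreserving_perm {n : ℕ} (e : Equiv.Perm (Fin n)) :
    MeasurePreserving (fun (t : Fin n → T) i => t (e i))
      (Measure.pi fun _ => σ) (Measure.pi fun _ => σ) := by
  have h := measurePreserving_piCongrLeft (fun _ : Fin n => σ) e.symm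
  convert h using 1
  funext t i
  rw [MeasurableEquiv.coe_piCongrLeft]
  have := Equiv.piCongrLeft_apply_apply (P := fun _ : Fin n => T) e.symm t (e i)
  simpa using this.symm

variable {σ} (Q : Kernel σ)

/-- `(Ψⱼ f)(t₁, …, tₙ) = Q(tⱼ, tⱼ₊₁) f(t₁, …, tⱼ₊₁, tⱼ, …, tₙ)` on `L²(Tⁿ)`
(the indices are zero-based). -/
noncomputable def Psi {n : ℕ} (j : ℕ) (hj : j + 1 < n) : L2n σ n →L[ℂ] L2n σ n :=
  (mulOp (fun t : Fin n → T => Q.val (t ⟨j, by omega⟩) (t ⟨j + 1, hj⟩))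
    (memLp_top (measurable_val_eval Q _ _) ⟨1, fun t => (Q.norm_val _ _).le⟩)).comp
  (Lp.compMeasurePreservingₗᵢ ℂ
    (fun (t : Fin n → T) i => t (Equiv.swap ⟨j, by omega⟩ ⟨j + 1, hj⟩ i))
    (measurePreserving_perm σ _)).toContinuousLinearMap

/-- `ℋ_ℂ^{⊛n}`: the closed subspace of all `Q`-symmetric functions in `L²(Tⁿ → ℂ, σ^{⊗n})`,
i.e. of those `f` with `Ψⱼ f = f` for all `j = 1, …, n - 1`. -/
noncomputable def Hsym (n : ℕ) : Submodule ℂ (L2n σ n) :=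
  ⨅ (j : ℕ) (hj : j + 1 < n),
    LinearMap.eqLocus (Psi Q j hj : L2n σ n →ₗ[ℂ] L2n σ n) LinearMap.id

theorem isClosed_Hsym (n : ℕ) : IsClosed (Hsym Q n : Set (L2n σ n)) := by
  simp only [Hsym, Submodule.coe_iInf]
  refine isClosed_iInter fun j => isClosed_iInter fun hj => ?_
  exact isClosed_eq (Psi Q j hj).continuous continuous_id

instance (n : ℕ) : CompleteSpace (Hsym Q n) := (isClosed_Hsym Q n).completeSpace_coe

/-- The `Q`-symmetrization `Pₙ`: the orthogonal projection of `ℋ_ℂ^{⊗n}` onto `ℋ_ℂ^{⊛n}`. -/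
noncomputable def P (n : ℕ) : L2n σ n →L[ℂ] Hsym Q n := (Hsym Q n).orthogonalProjectionOnto

/-- `ℱ_fin^Q(ℋ)`: the finite sequences `(f⁽⁰⁾, f⁽¹⁾, …, 0, 0, …)` with `f⁽ⁿ⁾ ∈ ℋ_ℂ^{⊛n}`. -/
abbrev FockFin : Type _ := DirectSum ℕ fun n => Hsym Q n

/-- The inner product `(F, G) = ∑ₙ n! (f⁽ⁿ⁾, g⁽ⁿ⁾)` of the `Q`-Fock space, linear in `F`. -/
noncomputable def fockInner (F G : FockFin Q) : ℂ :=
  ∑ᶠ n : ℕ, (n.factorial : ℂ) * inner ℂ (G n) (F n)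

/-- Convergence in `ℱ_fin^Q(ℋ)`: uniform finiteness of the non-zero components, and convergence
of each component in `ℋ_ℂ^{⊛n}`. -/
def FockTendsto (u : ℕ → FockFin Q) (F : FockFin Q) : Prop :=
  (∃ N : ℕ, ∀ k m, N < m → u k m = 0) ∧ ∀ m, Tendsto (fun k => u k m) atTop (𝓝 (F m))

/-- Continuity of a linear operator on `ℱ_fin^Q(ℋ)`. -/
def IsContinuousOp (L : Module.End ℂ (FockFin Q)) : Prop :=
  ∀ (u : ℕ → FockFin Q) (F : FockFin Q), FockTendsto Q u F →
    FockTendsto Q (fun k => L (u k)) (L F)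

/-- The vacuum, `Ω = (1, 0, 0, …)`; here `L²(T⁰)` consists of the functions on a point. -/
noncomputable def vacuum : FockFin Q :=
  DirectSum.of (fun n => Hsym Q n) 0
    (⟨memLp_one_pt.toLp (fun _ : Fin 0 → T => (1 : ℂ)), by simp [Hsym]⟩ : Hsym Q 0)

/-- The vacuum state `τ(p) = (pΩ, Ω)`. -/
noncomputable def vacuumState (p : Module.End ℂ (FockFin Q)) : ℂ :=
  fockInner Q (p (vacuum Q)) (vacuum Q)

/-- `f⁽ⁿ⁾ ↦ h ⊛ f⁽ⁿ⁾ = Pₙ₊₁ (h ⊗ f⁽ⁿ⁾)`. -/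
noncomputable def creationComp (h : Lp ℂ 2 σ) (n : ℕ) : Hsym Q n →L[ℂ] Hsym Q (n + 1) :=
  ((P Q (n + 1)).comp (tensorLeft σ h n)).comp (Hsym Q n).subtypeL

/-- The creation operator `a⁺(h)`. -/
noncomputable def creation (h : Lp ℂ 2 σ) : Module.End ℂ (FockFin Q) :=
  DirectSum.toModule ℂ ℕ (FockFin Q) fun n =>
    (DirectSum.lof ℂ ℕ (fun n => Hsym Q n) (n + 1)).comp
      (creationComp Q h n : Hsym Q n →ₗ[ℂ] Hsym Q (n + 1))

/-- The annihilation operator `a⁻(h)`, the adjoint of `a⁺(h)` for the inner product of the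
`Q`-Fock space. Because of the weights `n!`, its restriction to `ℋ_ℂ^{⊛(n+1)}` is `n + 1` times
the adjoint of `h ⊛ · : ℋ_ℂ^{⊛n} → ℋ_ℂ^{⊛(n+1)}` for the unweighted inner products. -/
noncomputable def annihilation (h : Lp ℂ 2 σ) : Module.End ℂ (FockFin Q) :=
  DirectSum.toModule ℂ ℕ (FockFin Q) fun
    | 0 => 0
    | n + 1 => (DirectSum.lof ℂ ℕ (fun n => Hsym Q n) n).comp
        (((n + 1 : ℕ) : ℂ) • (ContinuousLinearMap.adjoint (creationComp Q h n) :
          Hsym Q (n + 1) →ₗ[ℂ] Hsym Q n))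

variable [TopologicalSpace T]

/-- The neutral operator `a⁰(f)`, the differential second quantization of the multiplication by
`f`: it maps `g⁽ⁿ⁾` to `Pₙ [(f(t₁) + ⋯ + f(tₙ)) g⁽ⁿ⁾(t₁, …, tₙ)]` (where `Pₙ` acts trivially,
as its argument is already `Q`-symmetric). -/
noncomputable def neutral (f : B0 ℝ T) : Module.End ℂ (FockFin Q) :=
  DirectSum.toModule ℂ ℕ (FockFin Q) fun n =>
    (DirectSum.lof ℂ ℕ (fun n => Hsym Q n) n).comp
      ((((P Q n).comp (mulOp _ (memLp_sum_eval f n))).comp (Hsym Q n).subtypeL) :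
        Hsym Q n →ₗ[ℂ] Hsym Q n)

variable [OpensMeasurableSpace T] [IsFiniteMeasureOnCompacts σ]

/-- The operator `⟨f, ω⟩ = a⁺(f) + λ a⁰(f) + a⁻(f)`. -/
noncomputable def field (lam : ℝ) (f : B0 ℝ T) : Module.End ℂ (FockFin Q) :=
  creation Q ((memLp_two f).toLp _) + (lam : ℂ) • neutral Q f +
    annihilation Q ((memLp_two f).toLp _)

/-- `W : f⁽ⁿ⁾ ↦ ⟨f⁽ⁿ⁾, ω^{⊗n}⟩` is the extension by linearity and continuity of the map
`f₁ ⊗ ⋯ ⊗ fₙ ↦ ⟨f₁, ω⟩ ⋯ ⟨fₙ, ω⟩` to all bounded measurable functions with compact support on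
`Tⁿ`: its values are continuous operators on `ℱ_fin^Q(ℋ)`, and it is continuous for bounded
pointwise convergence of functions which are supported in a common compact set. -/
structure IsMonomialMap [T2Space T] (lam : ℝ) (n : ℕ)
    (W : B0 ℂ (Fin n → T) →ₗ[ℂ] Module.End ℂ (FockFin Q)) : Prop where
  continuousOp : ∀ f, IsContinuousOp Q (W f)
  tensor : ∀ f : Fin n → B0 ℝ T,
    W (tensorB0 f) = (List.ofFn fun i => field Q lam (f i)).prod
  continuous : ∀ (g : ℕ → B0 ℂ (Fin n → T)) (f : B0 ℂ (Fin n → T)),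
    (∃ K : Set (Fin n → T), IsCompact K ∧ ∀ k, Function.support (g k).1 ⊆ K) →
    (∃ C : ℝ, ∀ k t, ‖(g k).1 t‖ ≤ C) →
    (∀ t, Tendsto (fun k => (g k).1 t) atTop (𝓝 (f.1 t))) →
    ∀ F : FockFin Q, FockTendsto Q (fun k => W (g k) F) (W f F)

end Operators

section Partitions

variable {n : ℕ}

/-- The minimal element of a block of a partition of `{1, …, n}`. -/
def blockMin (V : Finpartition (Finset.univ : Finset (Fin n))) (B : V.parts) : Fin n :=
  B.1.min' (V.nonempty_of_mem_parts B.2)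

/-- The maximal element of a block of a partition of `{1, …, n}`. -/
def blockMax (V : Finpartition (Finset.univ : Finset (Fin n))) (B : V.parts) : Fin n :=
  B.1.max' (V.nonempty_of_mem_parts B.2)

/-- The block which contains `i`. -/
def blockOf (V : Finpartition (Finset.univ : Finset (Fin n))) (i : Fin n) : V.parts :=
  ⟨V.part i, V.part_mem.2 (Finset.mem_univ i)⟩

/-- `𝒫_{≥2}^{(n)}`: the partitions of `{1, …, n}` all of whose blocks have at least two
elements. -/
def partitionsGeTwo (n : ℕ) : Finset (Finpartition (Finset.univ : Finset (Fin n))) :=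
  Finset.univ.filter fun V => ∀ B ∈ V.parts, 2 ≤ B.card

variable {T : Type*} [MeasurableSpace T] {σ : Measure T}

/-- `Q(𝒱; t₁, …, tₙ)`: the product of `Q(t_{min B₂}, t_{max B₁})` over the pairs of blocks with
`min B₁ < min B₂ < max B₁ < max B₂`. -/
noncomputable def crossingWeight (Q : Kernel σ)
    (V : Finpartition (Finset.univ : Finset (Fin n))) (t : Fin n → T) : ℂ :=
  ∏ p : V.parts × V.parts with
      blockMin V p.1 < blockMin V p.2 ∧ blockMin V p.2 < blockMax V p.1 ∧
        blockMax V p.1 < blockMax V p.2,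
    Q.val (t (blockMin V p.2)) (t (blockMax V p.1))

variable (σ)

/-- The measure `∏_{B ∈ 𝒱} δ(dt_B)` on `Tⁿ`, where `δ(dt_B)` is the image of `σ` on the diagonal of
`T^B`: the variables `tᵢ`, `i ∈ B`, are all equal to one variable `s_B`, and the variables `s_B`,
`B ∈ 𝒱`, are integrated against `σ(ds_B)`. -/
noncomputable def blockDelta (V : Finpartition (Finset.univ : Finset (Fin n))) :
    Measure (Fin n → T) :=
  (Measure.pi fun _ : V.parts => σ).map fun s i => s (blockOf V i)

end Partitions

end QField

/-! The field is lifted to functions without symmetry. All three parts of `field` are compatible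
with the projections `P`. For creation, `P (h ⊗ P f) = P (h ⊗ f)`, because the adjoint of `h ⊗ ·`
preserves Q-symmetry (`P_tensorLeft_P`). Multiplication by `f(t₁) + ⋯ + f(tₙ)` preserves it as well
(`P_mulOp_P`). Annihilation of `P g` is the symmetrization of `∑ᵢ ∫ (∏_{l<i} Q(u, s_l)) h(u) g(…, u,
…) σ(du)` (`adjoint_creationComp_P`). This is dual to the identity that, for Q-symmetric `y`, `(n+1)
P (h ⊗ y)` is the sum over `k` of `h ⊗ y` with the variable of `h` moved to position `k`
(`smul_P_tensorLeft`). So a field applied to the symmetrization of `γ` is the symmetrization of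
`step` applied to `f(u) γ` (`symmetrize_step`).

The operator `step` does not need a product `f(u) γ`: it acts on any family of graded functions
indexed by the field variable. Hence `f(t₁, …, tₙ) F` can be sent through `n` steps, the last
variable first (`iter`), and the symmetrized result defines `⟨f, ω^{⊗n}⟩ F`. The iterates are
dominated by those of a positive operator `absStep`, which Cauchy–Schwarz bounds on L² because the
variables range over a set of finite measure. Square integrability, linearity and continuity follow
by dominated convergence. Uniqueness is a monotone class argument starting from products.

The moment formula is a recursion over states with `n` fields still to act and `m` Fock variables
present. The vacuum component at the end is a sum over partitions of all `n + m` variables into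
blocks of size at least two, in which the Fock variables lie in different blocks (`mom`,
`iter_zero_eq_sum_mom`). Consider the field variable `a` at position `n`, next to act, and a
partition in which only the variables beyond `a` must be separated. - If `a` shares no block with a
Fock variable, it becomes a Fock variable itself: creation. - If `a` shares a block with the Fock
variable `b`, which keeps another partner when `a` is deleted, then `a` is neither the minimum nor
the maximum of that block. No crossing changes, and one factor `λ` is gained: the neutral part. - If
`{a, b}` is a block, it is integrated out. It crosses exactly the blocks of the Fock variables in
front of `b`, which yields the factors `Q(u, s_l)` of annihilation.

This is `mom_succ`. Starting from the vacuum, with `m = 0`, gives the formula. -/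

namespace QField

/-! ### Creation and neutral operators commute with Q-symmetrization. -/

section Symmetrization

variable {T : Type*} [MeasurableSpace T] {σ : Measure T}

/-- Valid on `A` too, as `A` is symmetric and the filling value 1 is real. The relations between the
operators `Ψⱼ` thereby become pointwise identities. -/
theorem Kernel.val_conj (Q : Kernel σ) (s t : T) : conj (Q.val s t) = Q.val t s := by
  unfold Kernel.val
  by_cases h : (s, t) ∈ Q.A
  · simp [h, Q.symm_A _ _ h]
  · have h' : (t, s) ∉ Q.A := fun h' => h (Q.symm_A _ _ h')
    simp only [h, h', dite_false]
    exact (Q.hermitian t s h' h).symm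

theorem Kernel.val_mul_val (Q : Kernel σ) (s t : T) : Q.val s t * Q.val t s = 1 := by
  rw [← Q.val_conj s t, Complex.mul_conj, Complex.normSq_eq_norm_sq, Q.norm_val]
  simp

variable [SigmaFinite σ] (Q : Kernel σ)

/-- The action of `Ψⱼ` on functions. -/
noncomputable def psiFun {n : ℕ} (j : ℕ) (hj : j + 1 < n) (φ : (Fin n → T) → ℂ) :
    (Fin n → T) → ℂ := fun t =>
  Q.val (t ⟨j, by omega⟩) (t ⟨j + 1, hj⟩) *
    φ (fun i => t (Equiv.swap ⟨j, by omega⟩ ⟨j + 1, hj⟩ i))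

theorem coeFn_Psi {n : ℕ} (j : ℕ) (hj : j + 1 < n) (f : L2n σ n) :
    Psi Q j hj f =ᵐ[Measure.pi fun _ => σ] psiFun Q j hj f := by
  refine (coeFn_mulOp _ _ _).trans ?_
  have h := Lp.coeFn_compMeasurePreserving f
    (measurePreserving_perm σ (Equiv.swap (⟨j, by omega⟩ : Fin n) ⟨j + 1, hj⟩))
  filter_upwards [h] with t ht
  simp only [psiFun]
  congr 1

theorem psiFun_congr {n : ℕ} (j : ℕ) (hj : j + 1 < n) {φ ψ : (Fin n → T) → ℂ}
    (h : φ =ᵐ[Measure.pi fun _ => σ] ψ) :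
    psiFun Q j hj φ =ᵐ[Measure.pi fun _ => σ] psiFun Q j hj ψ := by
  filter_upwards [(measurePreserving_perm σ
    (Equiv.swap (⟨j, by omega⟩ : Fin n) ⟨j + 1, hj⟩)).quasiMeasurePreserving.ae_eq_comp h] with t ht
  simp only [Function.comp_apply] at ht
  simp only [psiFun, ht]

theorem Psi_toLp {n : ℕ} (j : ℕ) (hj : j + 1 < n) {φ : (Fin n → T) → ℂ}
    (hφ : MemLp φ 2 (Measure.pi fun _ => σ)) :
    Psi Q j hj (hφ.toLp φ) =ᵐ[Measure.pi fun _ => σ] psiFun Q j hj φ :=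
  (coeFn_Psi Q j hj _).trans (psiFun_congr Q j hj hφ.coeFn_toLp)

omit [SigmaFinite σ] in
theorem psiFun_psiFun {n : ℕ} (j : ℕ) (hj : j + 1 < n) (φ : (Fin n → T) → ℂ) :
    psiFun Q j hj (psiFun Q j hj φ) = φ := by
  funext t
  simp only [psiFun, Equiv.swap_apply_left, Equiv.swap_apply_right, Equiv.swap_apply_self]
  rw [← mul_assoc, Q.val_mul_val, one_mul]

theorem Psi_Psi {n : ℕ} (j : ℕ) (hj : j + 1 < n) (f : L2n σ n) :
    Psi Q j hj (Psi Q j hj f) = f := by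
  refine Lp.ext ((coeFn_Psi Q j hj _).trans ?_)
  exact (psiFun_congr Q j hj (coeFn_Psi Q j hj f)).trans (by rw [psiFun_psiFun])

theorem norm_Psi {n : ℕ} (j : ℕ) (hj : j + 1 < n) (f : L2n σ n) :
    ‖Psi Q j hj f‖ = ‖f‖ := by
  have h := norm_map (Lp.compMeasurePreservingₗᵢ (E := ℂ) (p := 2) ℂ _
    (measurePreserving_perm σ (Equiv.swap (⟨j, by omega⟩ : Fin n) ⟨j + 1, hj⟩))) f
  rw [← h, Lp.norm_def, Lp.norm_def]
  congr 1
  refine eLpNorm_congr_norm_ae ?_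
  filter_upwards [coeFn_mulOp (fun t : Fin n → T => Q.val (t ⟨j, by omega⟩) (t ⟨j + 1, hj⟩))
    (memLp_top (measurable_val_eval Q _ _) ⟨1, fun t => (Q.norm_val _ _).le⟩)
    (Lp.compMeasurePreservingₗᵢ (E := ℂ) (p := 2) ℂ _
      (measurePreserving_perm σ (Equiv.swap (⟨j, by omega⟩ : Fin n) ⟨j + 1, hj⟩)) f)] with t ht
  erw [ht]
  rw [norm_mul, Q.norm_val, one_mul]

theorem inner_Psi_Psi {n : ℕ} (j : ℕ) (hj : j + 1 < n) (f g : L2n σ n) :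
    inner ℂ (Psi Q j hj f) (Psi Q j hj g) = inner ℂ f g :=
  (LinearMap.norm_map_iff_inner_map_map (𝕜 := ℂ) (Psi Q j hj)).1 (norm_Psi Q j hj) f g

/-- An isometric involution is self-adjoint. -/
theorem inner_Psi_left {n : ℕ} (j : ℕ) (hj : j + 1 < n) (f g : L2n σ n) :
    inner ℂ (Psi Q j hj f) g = inner ℂ f (Psi Q j hj g) := by
  rw [← inner_Psi_Psi Q j hj, Psi_Psi]

theorem mem_Hsym {n : ℕ} {f : L2n σ n} :
    f ∈ Hsym Q n ↔ ∀ (j : ℕ) (hj : j + 1 < n), Psi Q j hj f = f := by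
  simp [Hsym]

theorem inner_P_left {n : ℕ} (f : L2n σ n) {z : L2n σ n} (hz : z ∈ Hsym Q n) :
    inner ℂ (P Q n f : L2n σ n) z = inner ℂ f z := by
  have h := Submodule.inner_orthogonalProjectionOnto_eq_of_mem_right (K := Hsym Q n) ⟨z, hz⟩ f
  rw [← h]; rfl

/-- The working characterization of `P`: projections are computed by testing against Q-symmetric
vectors only. -/
theorem P_eq_of_inner {n : ℕ} {f : L2n σ n} {y : Hsym Q n}
    (h : ∀ z ∈ Hsym Q n, inner ℂ (y : L2n σ n) z = inner ℂ f z) : P Q n f = y := by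
  refine ext_inner_right ℂ fun z => ?_
  rw [Submodule.coe_inner, Submodule.coe_inner, inner_P_left Q f z.2, h _ z.2]

theorem P_of_mem {n : ℕ} (y : Hsym Q n) : P Q n (y : L2n σ n) = y :=
  P_eq_of_inner Q fun _ _ => rfl

variable (σ) in
theorem coeFn_tensorLeft {n : ℕ} (h : Lp ℂ 2 σ) (f : L2n σ n) :
    tensorLeft σ h n f =ᵐ[Measure.pi fun _ => σ] fun t => h (t 0) * f (fun i => t i.succ) :=
  (memLp_tensorFun σ h f).coeFn_toLp

theorem Psi_succ_tensorLeft {n : ℕ} (j : ℕ) (hj : j + 1 < n) (h : Lp ℂ 2 σ) (f : L2n σ n) :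
    Psi Q (j + 1) (Nat.succ_lt_succ hj) (tensorLeft σ h n f) =
      tensorLeft σ h n (Psi Q j hj f) := by
  refine Lp.ext ?_
  refine (coeFn_Psi Q _ _ _).trans ((psiFun_congr Q _ _ (coeFn_tensorLeft σ h f)).trans ?_)
  refine EventuallyEq.trans ?_ (coeFn_tensorLeft σ h _).symm
  filter_upwards [(quasi_tail σ n).ae_eq_comp (coeFn_Psi Q j hj f)] with t ht
  simp only [Function.comp_apply, psiFun] at ht ⊢
  rw [ht]
  have h0 : Equiv.swap (⟨j + 1, by omega⟩ : Fin (n + 1)) ⟨j + 1 + 1, by omega⟩ 0 = 0 :=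
    Equiv.swap_apply_of_ne_of_ne (by simp [Fin.ext_iff]) (by simp [Fin.ext_iff])
  have hs : ∀ i : Fin n, Equiv.swap (⟨j + 1, by omega⟩ : Fin (n + 1)) ⟨j + 1 + 1, by omega⟩ i.succ
      = (Equiv.swap (⟨j, by omega⟩ : Fin n) ⟨j + 1, hj⟩ i).succ := fun i =>
    ((Fin.succ_injective n).swap_apply (⟨j, by omega⟩ : Fin n) ⟨j + 1, hj⟩ i)
  simp only [h0, hs]
  simp only [Fin.succ_mk]
  ring

/-- Tensoring with `h` on the left shifts the variables by one, so it intertwines `Ψⱼ` with `Ψⱼ₊₁`.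
Taking adjoints of self-adjoint operators reverses the relation. -/
theorem adjoint_tensorLeft_mem {n : ℕ} (h : Lp ℂ 2 σ) {z : L2n σ (n + 1)}
    (hz : z ∈ Hsym Q (n + 1)) :
    ContinuousLinearMap.adjoint (tensorLeft σ h n) z ∈ Hsym Q n := by
  rw [mem_Hsym] at hz ⊢
  intro j hj
  refine ext_inner_right ℂ fun v => ?_
  rw [inner_Psi_left, ContinuousLinearMap.adjoint_inner_left,
    ContinuousLinearMap.adjoint_inner_left, ← Psi_succ_tensorLeft, ← inner_Psi_left,
    hz]

/-- Against a Q-symmetric `z`, both sides pair `f` with the adjoint image of `z`, which is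
Q-symmetric, so the inner projection is invisible. -/
theorem P_tensorLeft_P {n : ℕ} (h : Lp ℂ 2 σ) (f : L2n σ n) :
    P Q (n + 1) (tensorLeft σ h n (P Q n f : L2n σ n)) = P Q (n + 1) (tensorLeft σ h n f) := by
  refine P_eq_of_inner Q fun z hz => ?_
  rw [inner_P_left Q _ hz, ← ContinuousLinearMap.adjoint_inner_right,
    ← ContinuousLinearMap.adjoint_inner_right,
    inner_P_left Q _ (adjoint_tensorLeft_mem Q h hz)]

theorem creationComp_P {n : ℕ} (h : Lp ℂ 2 σ) (f : L2n σ n) :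
    creationComp Q h n (P Q n f) = P Q (n + 1) (tensorLeft σ h n f) :=
  P_tensorLeft_P Q h f

section Neutral

variable [TopologicalSpace T]

theorem inner_mulOp_ofReal {X : Type*} [MeasurableSpace X] {μ : Measure X} (φ : X → ℂ)
    (hφ : MemLp φ ∞ μ) (hr : ∀ x, conj (φ x) = φ x) (f g : Lp ℂ 2 μ) :
    inner ℂ (mulOp φ hφ f) g = inner ℂ f (mulOp φ hφ g) := by
  rw [L2.inner_def, L2.inner_def]
  refine integral_congr_ae ?_
  filter_upwards [coeFn_mulOp φ hφ f, coeFn_mulOp φ hφ g] with x hf hg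
  simp only [RCLike.inner_apply, hf, hg, map_mul, hr]
  ring

/-- The multiplier is invariant under permutations of the variables and therefore commutes with
every `Ψⱼ`. -/
theorem mulOp_sum_mem {n : ℕ} (f : B0 ℝ T) {z : L2n σ n} (hz : z ∈ Hsym Q n) :
    mulOp _ (memLp_sum_eval f n) z ∈ Hsym Q n := by
  rw [mem_Hsym] at hz ⊢
  intro j hj
  refine Lp.ext ?_
  refine (coeFn_Psi Q _ _ _).trans ((psiFun_congr Q _ _ (coeFn_mulOp _ _ _)).trans ?_)
  refine EventuallyEq.trans ?_ (coeFn_mulOp _ _ _).symm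
  filter_upwards [(coeFn_Psi Q j hj z).symm.trans (by rw [hz])] with t ht
  rw [← ht]
  simp only [psiFun]
  rw [Equiv.sum_comp (Equiv.swap (⟨j, by omega⟩ : Fin n) ⟨j + 1, hj⟩)
    (fun i => ((f.1 (t i) : ℝ) : ℂ))]
  ring

theorem P_mulOp_P {n : ℕ} (f : B0 ℝ T) (g : L2n σ n) :
    P Q n (mulOp _ (memLp_sum_eval f n) (P Q n g : L2n σ n)) =
      P Q n (mulOp _ (memLp_sum_eval f n) g) := by
  refine P_eq_of_inner Q fun z hz => ?_
  have hr : ∀ t : Fin n → T, conj (∑ i, ((f.1 (t i) : ℝ) : ℂ)) = ∑ i, ((f.1 (t i) : ℝ) : ℂ) := by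
    intro t; simp
  rw [inner_P_left Q _ hz, inner_mulOp_ofReal _ _ hr, inner_mulOp_ofReal _ _ hr,
    inner_P_left Q _ (mulOp_sum_mem Q f hz)]

end Neutral

end Symmetrization

/-! ### Annihilation as a sum of weighted integrals. -/

section Annihilation

variable {T : Type*} [MeasurableSpace T] {σ : Measure T}

/-- The weight `∏_{l < i} Q(u, s_l)` picked up by a variable `u` in moving from position `i` to
the front of the variables `s`. -/
noncomputable def annWeight (Q : Kernel σ) {m : ℕ} (i : Fin (m + 1)) (u : T) (s : Fin m → T) : ℂ :=
  ∏ l : Fin m with l.castSucc < i, Q.val u (s l)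

theorem norm_annWeight (Q : Kernel σ) {m : ℕ} (i : Fin (m + 1)) (u : T) (s : Fin m → T) :
    ‖annWeight Q i u s‖ = 1 := by
  simp [annWeight, norm_prod, Q.norm_val]

theorem enorm_annWeight (Q : Kernel σ) {m : ℕ} (i : Fin (m + 1)) (u : T) (s : Fin m → T) :
    ‖annWeight Q i u s‖ₑ = 1 := by
  rw [← ofReal_norm, norm_annWeight, ENNReal.ofReal_one]

theorem measurable_annWeight (Q : Kernel σ) {m : ℕ} (i : Fin (m + 1)) :
    Measurable fun p : T × (Fin m → T) => annWeight Q i p.1 p.2 := by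
  refine Finset.measurable_prod _ fun l _ => ?_
  exact Q.measurable_val.comp
    (measurable_fst.prodMk ((measurable_pi_apply l).comp measurable_snd))

/-- The product `h ⊗ y` with the variable of `h` moved to position `k`. -/
noncomputable def insertedTensor (Q : Kernel σ) {n : ℕ} (h : T → ℂ) (y : (Fin n → T) → ℂ)
    (k : Fin (n + 1)) (t : Fin (n + 1) → T) : ℂ :=
  conj (annWeight Q k (t k) (k.removeNth t)) * (h (t k) * y (k.removeNth t))

/-- An adjacent transposition which avoids `k` is an adjacent transposition of the remaining
positions, and both of its points lie on the same side of `k`. The last clause keeps `annWeight`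
unchanged. -/
theorem swap_succAbove_of_ne {n : ℕ} {j : ℕ} (hj : j + 1 < n + 1) (k : Fin (n + 1))
    (h1 : k.val ≠ j) (h2 : k.val ≠ j + 1) :
    ∃ (j' : ℕ) (hj' : j' + 1 < n),
      k.succAbove ⟨j', by omega⟩ = ⟨j, by omega⟩ ∧ k.succAbove ⟨j' + 1, hj'⟩ = ⟨j + 1, hj⟩ ∧
      (∀ i : Fin n, Equiv.swap (⟨j, by omega⟩ : Fin (n + 1)) ⟨j + 1, hj⟩ (k.succAbove i) =
        k.succAbove (Equiv.swap (⟨j', by omega⟩ : Fin n) ⟨j' + 1, hj'⟩ i)) ∧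
      ∀ i : Fin n, (Equiv.swap (⟨j', by omega⟩ : Fin n) ⟨j' + 1, hj'⟩ i).castSucc < k ↔
        i.castSucc < k := by
  have key : ∀ (j' : ℕ) (hj' : j' + 1 < n),
      k.succAbove ⟨j', by omega⟩ = ⟨j, by omega⟩ → k.succAbove ⟨j' + 1, hj'⟩ = ⟨j + 1, hj⟩ →
      (∀ i : Fin n, Equiv.swap (⟨j, by omega⟩ : Fin (n + 1)) ⟨j + 1, hj⟩ (k.succAbove i) =
        k.succAbove (Equiv.swap (⟨j', by omega⟩ : Fin n) ⟨j' + 1, hj'⟩ i)) := by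
    intro j' hj' e1 e2 i
    rw [← e1, ← e2]
    exact (Fin.succAbove_right_injective (p := k)).swap_apply _ _ _
  have hk := k.isLt
  rcases lt_or_gt_of_ne h1 with h | h
  · have e1 : k.succAbove ⟨j - 1, by omega⟩ = ⟨j, by omega⟩ := by
      rw [Fin.succAbove_of_le_castSucc _ _ (by simp [Fin.le_def]; omega)]
      simp [Fin.ext_iff]; omega
    have e2 : k.succAbove ⟨j - 1 + 1, by omega⟩ = ⟨j + 1, hj⟩ := by
      rw [Fin.succAbove_of_le_castSucc _ _ (by simp [Fin.le_def]; omega)]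
      simp [Fin.ext_iff]; omega
    refine ⟨j - 1, by omega, e1, e2, key _ _ e1 e2, fun i => ?_⟩
    rw [Equiv.swap_apply_def]
    split_ifs with ha hb
    · simp [Fin.lt_def, ha]; omega
    · simp [Fin.lt_def, hb]; omega
    · rfl
  · have e1 : k.succAbove ⟨j, by omega⟩ = ⟨j, by omega⟩ := by
      rw [Fin.succAbove_of_castSucc_lt _ _ (by simp [Fin.lt_def]; omega)]
      simp
    have e2 : k.succAbove ⟨j + 1, by omega⟩ = ⟨j + 1, hj⟩ := by
      rw [Fin.succAbove_of_castSucc_lt _ _ (by simp [Fin.lt_def]; omega)]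
      simp
    refine ⟨j, by omega, e1, e2, key _ _ e1 e2, fun i => ?_⟩
    rw [Equiv.swap_apply_def]
    split_ifs with ha hb
    · simp [Fin.lt_def, ha]; omega
    · simp [Fin.lt_def, hb]; omega
    · rfl

theorem swap_succAbove_left {n : ℕ} {j : ℕ} (hj : j + 1 < n + 1) (i : Fin n) :
    Equiv.swap (⟨j, by omega⟩ : Fin (n + 1)) ⟨j + 1, hj⟩
      ((⟨j, by omega⟩ : Fin (n + 1)).succAbove i) =
      (⟨j + 1, hj⟩ : Fin (n + 1)).succAbove i := by
  rw [Equiv.swap_apply_def, Fin.succAbove, Fin.succAbove]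
  simp only [Fin.lt_def, Fin.val_castSucc]
  split_ifs <;> simp_all [Fin.ext_iff] <;> omega

theorem conj_annWeight_succ (Q : Kernel σ) {n : ℕ} {j : ℕ} (hj : j < n) (u : T) (s : Fin n → T) :
    conj (annWeight Q ⟨j + 1, by omega⟩ u s) =
      Q.val (s ⟨j, hj⟩) u * conj (annWeight Q ⟨j, by omega⟩ u s) := by
  have : (Finset.univ.filter fun l : Fin n => l.castSucc < (⟨j + 1, by omega⟩ : Fin (n + 1))) =
      insert ⟨j, hj⟩ (Finset.univ.filter fun l : Fin n =>
        l.castSucc < (⟨j, by omega⟩ : Fin (n + 1))) := by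
    ext l; simp [Fin.lt_def, Fin.ext_iff]; omega
  unfold annWeight
  rw [this, Finset.prod_insert (by simp [Fin.lt_def]), map_mul, Q.val_conj]

/-- Moving the variable of `h` past its right neighbour costs `Q(t_j, t_{j+1})`, which is exactly
the factor by which the conjugated weights for `j` and `j + 1` differ. -/
theorem psiFun_insertedTensor_left (Q : Kernel σ) {n : ℕ} (h : T → ℂ) (y : (Fin n → T) → ℂ)
    {j : ℕ} (hj : j + 1 < n + 1) :
    psiFun Q j hj (insertedTensor Q h y ⟨j, by omega⟩) = insertedTensor Q h y ⟨j + 1, hj⟩ := by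
  funext t
  have hr : (⟨j, by omega⟩ : Fin (n + 1)).removeNth
      (fun i => t (Equiv.swap (⟨j, by omega⟩ : Fin (n + 1)) ⟨j + 1, hj⟩ i)) =
      (⟨j + 1, hj⟩ : Fin (n + 1)).removeNth t := by
    funext i
    simp only [Fin.removeNth, swap_succAbove_left hj]
  have hv : (⟨j + 1, hj⟩ : Fin (n + 1)).removeNth t ⟨j, by omega⟩ = t ⟨j, by omega⟩ := by
    simp only [Fin.removeNth]
    rw [Fin.succAbove_of_castSucc_lt _ _ (by simp [Fin.lt_def])]
    rfl
  simp only [psiFun, insertedTensor, hr, Equiv.swap_apply_left]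
  rw [conj_annWeight_succ Q (by omega : j < n), hv]
  ring

variable [SigmaFinite σ] (Q : Kernel σ)

variable (σ) in
theorem measurePreserving_removeNth {n : ℕ} (k : Fin (n + 1)) :
    MeasurePreserving (fun t : Fin (n + 1) → T => (t k, k.removeNth t))
      (Measure.pi fun _ => σ) (σ.prod (Measure.pi fun _ => σ)) :=
  measurePreserving_piFinSuccAbove (fun _ : Fin (n + 1) => σ) k

variable (σ) in
theorem measurePreserving_insertNth {n : ℕ} (k : Fin (n + 1)) :
    MeasurePreserving (fun p : T × (Fin n → T) => (k.insertNth p.1 p.2 : Fin (n + 1) → T))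
      (σ.prod (Measure.pi fun _ => σ)) (Measure.pi fun _ => σ) :=
  (measurePreserving_piFinSuccAbove (fun _ : Fin (n + 1) => σ) k).symm

/-- The transposition only permutes arguments of `y`, where Q-symmetry absorbs it. The identity is
almost everywhere, since `y` is a class of functions. -/
theorem psiFun_insertedTensor_of_ne {n : ℕ} (h : T → ℂ) (y : L2n σ n) (hy : y ∈ Hsym Q n)
    {j : ℕ} (hj : j + 1 < n + 1) (k : Fin (n + 1)) (h1 : k.val ≠ j) (h2 : k.val ≠ j + 1) :
    psiFun Q j hj (insertedTensor Q h y k) =ᵐ[Measure.pi fun _ => σ] insertedTensor Q h y k := by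
  obtain ⟨j', hj', e1, e2, e3, e4⟩ := swap_succAbove_of_ne hj k h1 h2
  rw [mem_Hsym] at hy
  have hae : psiFun Q j' hj' y =ᵐ[Measure.pi fun _ => σ] y :=
    (coeFn_Psi Q j' hj' y).symm.trans (by rw [hy])
  have hq := (Measure.quasiMeasurePreserving_snd.comp
    (measurePreserving_removeNth σ k).quasiMeasurePreserving).ae_eq_comp hae
  filter_upwards [hq] with t ht
  simp only [Function.comp_apply, psiFun] at ht ⊢
  have hk : Equiv.swap (⟨j, by omega⟩ : Fin (n + 1)) ⟨j + 1, hj⟩ k = k :=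
    Equiv.swap_apply_of_ne_of_ne (by simpa [Fin.ext_iff] using h1)
      (by simpa [Fin.ext_iff] using h2)
  have hr : k.removeNth (fun i => t (Equiv.swap (⟨j, by omega⟩ : Fin (n + 1)) ⟨j + 1, hj⟩ i)) =
      fun i => k.removeNth t (Equiv.swap (⟨j', by omega⟩ : Fin n) ⟨j' + 1, hj'⟩ i) := by
    funext i
    simp only [Fin.removeNth, e3]
  have hw : annWeight Q k (t k)
      (fun i => k.removeNth t (Equiv.swap (⟨j', by omega⟩ : Fin n) ⟨j' + 1, hj'⟩ i)) =
      annWeight Q k (t k) (k.removeNth t) := by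
    unfold annWeight
    refine Finset.prod_equiv (Equiv.swap (⟨j', by omega⟩ : Fin n) ⟨j' + 1, hj'⟩) ?_ ?_
    · intro i; simp [e4]
    · intro i _; rfl
  simp only [insertedTensor, hk, hr, hw]
  rw [← ht]
  simp only [Fin.removeNth, e1, e2]
  ring

theorem memLp_insertedTensor {n : ℕ} {h : T → ℂ} (hh : MemLp h 2 σ) {y : (Fin n → T) → ℂ}
    (hy : MemLp y 2 (Measure.pi fun _ => σ)) (k : Fin (n + 1)) :
    MemLp (insertedTensor Q h y k) 2 (Measure.pi fun _ => σ) := by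
  have hm : AEStronglyMeasurable (fun p : T × (Fin n → T) => h p.1 * y p.2)
      (σ.prod (Measure.pi fun _ => σ)) :=
    hh.aestronglyMeasurable.comp_fst.mul hy.aestronglyMeasurable.comp_snd
  have h1 : MemLp (fun p : T × (Fin n → T) => h p.1 * y p.2) 2
      (σ.prod (Measure.pi fun _ => σ)) := by
    refine ⟨hm, ?_⟩
    rw [eLpNorm_tensor hh.aestronglyMeasurable hy.aestronglyMeasurable]
    exact ENNReal.mul_lt_top hh.2 hy.2
  have h2 : MemLp (fun p : T × (Fin n → T) => conj (annWeight Q k p.1 p.2) * (h p.1 * y p.2)) 2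
      (σ.prod (Measure.pi fun _ => σ)) := by
    refine h1.congr_norm ?_ (ae_of_all _ fun p => ?_)
    · exact ((Complex.continuous_conj.measurable.comp
        (measurable_annWeight Q k)).aestronglyMeasurable).mul hm
    · simp [norm_annWeight]
  have h3 := h2.comp_measurePreserving (measurePreserving_removeNth σ k)
  exact h3

theorem Psi_insertedTensor {n : ℕ} {h : T → ℂ} (hh : MemLp h 2 σ) (y : L2n σ n)
    (hy : y ∈ Hsym Q n) {j : ℕ} (hj : j + 1 < n + 1) (k : Fin (n + 1)) :
    Psi Q j hj ((memLp_insertedTensor Q hh (Lp.memLp y) k).toLp _) =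
      (memLp_insertedTensor Q hh (Lp.memLp y)
        (Equiv.swap ⟨j, by omega⟩ ⟨j + 1, hj⟩ k)).toLp _ := by
  refine Lp.ext ((Psi_toLp Q j hj _).trans (EventuallyEq.trans ?_ (MemLp.coeFn_toLp _).symm))
  by_cases h1 : k.val = j
  · subst h1
    rw [Equiv.swap_apply_left, psiFun_insertedTensor_left]
  · by_cases h2 : k.val = j + 1
    · obtain rfl : k = ⟨j + 1, hj⟩ := Fin.ext h2
      rw [Equiv.swap_apply_right, ← psiFun_insertedTensor_left, psiFun_psiFun]
    · rw [Equiv.swap_apply_of_ne_of_ne (by simpa [Fin.ext_iff] using h1)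
        (by simpa [Fin.ext_iff] using h2)]
      exact psiFun_insertedTensor_of_ne Q h y hy hj k h1 h2

/-- The variable of `h` is carried from the front to position `k` by successive unitaries `Ψⱼ`, each
of which fixes `z`. -/
theorem inner_insertedTensor {n : ℕ} {h : T → ℂ} (hh : MemLp h 2 σ) (y : L2n σ n)
    (hy : y ∈ Hsym Q n) {z : L2n σ (n + 1)} (hz : z ∈ Hsym Q (n + 1)) (k : Fin (n + 1)) :
    inner ℂ ((memLp_insertedTensor Q hh (Lp.memLp y) k).toLp _) z =
      inner ℂ (tensorLeft σ (hh.toLp h) n y) z := by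
  obtain ⟨k, hk⟩ := k
  induction k with
  | zero =>
    congr 1
    refine Lp.ext ((MemLp.coeFn_toLp _).trans
      (EventuallyEq.trans ?_ (coeFn_tensorLeft σ _ y).symm))
    have := (Measure.quasiMeasurePreserving_fst.comp
      (measurePreserving_headTail σ n).quasiMeasurePreserving).ae_eq_comp hh.coeFn_toLp
    filter_upwards [this] with t ht
    simp only [Function.comp_apply] at ht
    rw [ht]
    simp only [insertedTensor, annWeight, Fin.removeNth, Fin.zero_eta, Fin.succAbove_zero]
    simp
    exact Or.inl rfl
  | succ k ih =>
    rw [← ih (by omega), ← inner_Psi_Psi Q k hk, (mem_Hsym Q).1 hz k hk]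
    congr 1
    rw [Psi_insertedTensor Q hh y hy hk]
    simp only [Equiv.swap_apply_right]

/-- Each `Ψⱼ` permutes the summands on the right, so their sum is Q-symmetric. Each of the `n + 1`
summands pairs with Q-symmetric vectors as `h ⊗ y` does. -/
theorem smul_P_tensorLeft {n : ℕ} {h : T → ℂ} (hh : MemLp h 2 σ) (y : L2n σ n)
    (hy : y ∈ Hsym Q n) :
    ((n + 1 : ℕ) : ℂ) • (P Q (n + 1) (tensorLeft σ (hh.toLp h) n y) : L2n σ (n + 1)) =
      ∑ k : Fin (n + 1), (memLp_insertedTensor Q hh (Lp.memLp y) k).toLp _ := by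
  have hmem : ∑ k : Fin (n + 1), (memLp_insertedTensor Q hh (Lp.memLp y) k).toLp _ ∈
      Hsym Q (n + 1) := by
    rw [mem_Hsym]
    intro j hj
    rw [map_sum]
    simp only [Psi_insertedTensor Q hh y hy hj]
    exact Equiv.sum_comp (Equiv.swap (⟨j, by omega⟩ : Fin (n + 1)) ⟨j + 1, hj⟩)
      (fun k => (memLp_insertedTensor Q hh (Lp.memLp y) k).toLp _)
  have h1 : P Q (n + 1) (((n + 1 : ℕ) : ℂ) • tensorLeft σ (hh.toLp h) n y) = ⟨_, hmem⟩ := by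
    refine P_eq_of_inner Q fun z hz => ?_
    simp only [sum_inner, inner_insertedTensor Q hh y hy hz]
    simp [inner_smul_left]
  rw [map_smul] at h1
  exact congrArg Subtype.val h1

/-- `∑ᵢ ∫ (∏_{l < i} Q(u, s_l)) h(u) g(s₁, …, u, …, sₙ) σ(du)`, the variable `u` being at
position `i`. -/
noncomputable def annFun {n : ℕ} (h : T → ℂ) (g : (Fin (n + 1) → T) → ℂ) (s : Fin n → T) : ℂ :=
  ∑ i : Fin (n + 1), ∫ u, annWeight Q i u s * (h u * g (i.insertNth u s)) ∂σ

/-- Pairing `g` with the sum in `smul_P_tensorLeft` and integrating out the variable of `h` first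
transfers the weights to `g`. The conjugation in `insertedTensor` is what leaves `Q(u, s_l)`
unconjugated in `annFun`. -/
theorem adjoint_creationComp_P {n : ℕ} {h : T → ℂ} (hh : MemLp h 2 σ)
    (hr : ∀ u, conj (h u) = h u) {g : (Fin (n + 1) → T) → ℂ}
    (hg : MemLp g 2 (Measure.pi fun _ => σ))
    (ha : MemLp (annFun Q h g) 2 (Measure.pi fun _ => σ)) :
    ((n + 1 : ℕ) : ℂ) • ContinuousLinearMap.adjoint (creationComp Q (hh.toLp h) n)
      (P Q (n + 1) (hg.toLp g)) = P Q n (ha.toLp _) := by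
  symm
  refine P_eq_of_inner Q fun z hz => ?_
  have e1 : inner ℂ ((((n + 1 : ℕ) : ℂ) • ContinuousLinearMap.adjoint
      (creationComp Q (hh.toLp h) n) (P Q (n + 1) (hg.toLp g)) : Hsym Q n) : L2n σ n) z =
      ∑ k : Fin (n + 1), inner ℂ (hg.toLp g)
        ((memLp_insertedTensor Q hh (Lp.memLp z) k).toLp _) := by
    rw [← inner_sum, ← smul_P_tensorLeft Q hh z hz, inner_smul_right, Submodule.coe_smul,
      inner_smul_left, Complex.conj_natCast]
    congr 1
    have := ContinuousLinearMap.adjoint_inner_left (creationComp Q (hh.toLp h) n) ⟨z, hz⟩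
      (P Q (n + 1) (hg.toLp g))
    rw [Submodule.coe_inner, Submodule.coe_inner] at this
    rw [this]
    exact inner_P_left Q _ (Subtype.mem _)
  rw [e1]
  have hsplit : ∀ k : Fin (n + 1), Integrable (fun p : T × (Fin n → T) =>
      conj (annWeight Q k p.1 p.2 * (h p.1 * g (k.insertNth p.1 p.2))) * z p.2)
        (σ.prod (Measure.pi fun _ => σ)) ∧
      inner ℂ (hg.toLp g) ((memLp_insertedTensor Q hh (Lp.memLp z) k).toLp _) =
      ∫ s, conj (∫ u, annWeight Q k u s * (h u * g (k.insertNth u s)) ∂σ) * z s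
        ∂(Measure.pi fun _ => σ) := by
    intro k
    have hae : (fun t => inner ℂ ((hg.toLp g) t)
        (((memLp_insertedTensor Q hh (Lp.memLp z) k).toLp _) t)) =ᵐ[Measure.pi fun _ => σ]
        fun t => conj (g t) * insertedTensor Q h z k t := by
      filter_upwards [hg.coeFn_toLp, (memLp_insertedTensor Q hh (Lp.memLp z) k).coeFn_toLp]
        with t h1 h2
      rw [h1, h2, RCLike.inner_apply, mul_comm]
    have hint := (integrable_congr hae).1 (L2.integrable_inner (hg.toLp g)
      ((memLp_insertedTensor Q hh (Lp.memLp z) k).toLp _))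
    have hmp := measurePreserving_insertNth (n := n) σ k
    have hemb : MeasurableEmbedding
        (fun p : T × (Fin n → T) => (k.insertNth p.1 p.2 : Fin (n + 1) → T)) :=
      (MeasurableEquiv.piFinSuccAbove (fun _ : Fin (n + 1) => T) k).symm.measurableEmbedding
    have hfun : (fun p : T × (Fin n → T) =>
        conj (g (k.insertNth p.1 p.2)) * insertedTensor Q h z k (k.insertNth p.1 p.2)) =
        fun p => conj (annWeight Q k p.1 p.2 * (h p.1 * g (k.insertNth p.1 p.2))) * z p.2 := by
      funext p
      simp only [insertedTensor, Fin.insertNth_apply_same, Fin.removeNth_insertNth, map_mul, hr]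
      ring
    have hint2 := (hmp.integrable_comp_emb hemb).2 hint
    simp only [Function.comp_def] at hint2
    rw [hfun] at hint2
    refine ⟨hint2, ?_⟩
    rw [L2.inner_def, integral_congr_ae hae, ← hmp.integral_comp hemb, hfun,
      integral_prod_symm _ hint2]
    refine integral_congr_ae (ae_of_all _ fun s => ?_)
    simp only
    rw [integral_mul_const, integral_conj]
  rw [Finset.sum_congr rfl fun k _ => (hsplit k).2, L2.inner_def, ← integral_finsetSum]
  · refine integral_congr_ae ?_
    filter_upwards [ha.coeFn_toLp] with s hs
    rw [hs, RCLike.inner_apply, annFun, map_sum, Finset.mul_sum]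
    exact Finset.sum_congr rfl fun k _ => mul_comm _ _
  · intro k _
    refine (hsplit k).1.integral_prod_right.congr (ae_of_all _ fun s => ?_)
    simp only
    rw [integral_mul_const, integral_conj]

end Annihilation

/-! ### The unsymmetrized field and its positive majorant. -/

section Step

variable {T : Type*} [MeasurableSpace T] {σ : Measure T}

/-- Graded sequences of functions of `0, 1, 2, …` variables. -/
abbrev Graded (T : Type*) : Type _ := ∀ m : ℕ, (Fin m → T) → ℂ

/-- The unsymmetrized creation step. -/
def creationStep (H : T → Graded T) : Graded T
  | 0, _ => 0
  | m + 1, s => H (s 0) m (fun i => s i.succ)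

/-- The action of the unsymmetrized field on a family `H` of graded functions, the variable of the
field being the parameter of the family. -/
noncomputable def step (Q : Kernel σ) (lam : ℝ) (H : T → Graded T) : Graded T := fun m s =>
  creationStep H m s + (lam : ℂ) * ∑ i, H (s i) m s +
    ∑ i : Fin (m + 1), ∫ u, annWeight Q i u s * H u (m + 1) (i.insertNth u s) ∂σ

/-- The iterated action of the unsymmetrized field; the last variable acts first. -/
noncomputable def iter (Q : Kernel σ) (lam : ℝ) :
    ∀ n : ℕ, ((Fin n → T) → Graded T) → Graded T
  | 0, G => G ![]
  | n + 1, G => iter Q lam n fun t => step Q lam fun u => G (Fin.snoc t u)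

/-- `iter` peels off the last variable, whereas a product of operators is unfolded at its first
factor. This lemma reconciles the two orders. -/
theorem iter_succ_eq_step (Q : Kernel σ) (lam : ℝ) (n : ℕ) (G : (Fin (n + 1) → T) → Graded T) :
    iter Q lam (n + 1) G = step Q lam fun u => iter Q lam n fun t => G (Fin.cons u t) := by
  induction n with
  | zero =>
    simp only [iter]
    congr 1
    funext u
    congr 1
    funext i
    fin_cases i
    rfl
  | succ n ih =>
    rw [iter, ih]
    congr 1
    funext u
    rw [iter]
    congr 1
    funext t
    congr 1
    funext v
    rw [Fin.cons_snoc_eq_snoc_cons]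

theorem measurable_snoc {n : ℕ} :
    Measurable fun p : (Fin n → T) × T => (Fin.snoc p.1 p.2 : Fin (n + 1) → T) := by
  refine measurable_pi_iff.2 fun i => ?_
  refine Fin.lastCases ?_ (fun i => ?_) i
  · simpa using measurable_snd
  · simp only [Fin.snoc_castSucc]
    exact (measurable_pi_apply i).comp measurable_fst

theorem Measurable.finSnoc {X : Type*} [MeasurableSpace X] {n : ℕ} {f : X → Fin n → T} {g : X → T}
    (hf : Measurable f) (hg : Measurable g) :
    Measurable fun x => (Fin.snoc (f x) (g x) : Fin (n + 1) → T) :=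
  measurable_snoc.comp (hf.prodMk hg)

theorem measurable_insertNth {n : ℕ} (i : Fin (n + 1)) :
    Measurable fun p : T × (Fin n → T) => (i.insertNth p.1 p.2 : Fin (n + 1) → T) :=
  (MeasurableEquiv.piFinSuccAbove (fun _ : Fin (n + 1) => T) i).symm.measurable

theorem measurable_insertNth_left {n : ℕ} (i : Fin (n + 1)) (s : Fin n → T) :
    Measurable fun u : T => (i.insertNth u s : Fin (n + 1) → T) :=
  (measurable_insertNth i).comp (measurable_id.prodMk measurable_const)

/-- Graded sequences of nonnegative functions. -/
abbrev EGraded (T : Type*) : Type _ := ∀ m : ℕ, (Fin m → T) → ℝ≥0∞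

open Classical in
/-- The creation part of `absStep`. -/
noncomputable def absCreation (K : Set T) (Φ : EGraded T) : EGraded T
  | 0, _ => 0
  | m + 1, s => K.indicator (fun _ => Φ m (fun i => s i.succ)) (s 0)

variable (σ) in
/-- The positive operator which dominates the unsymmetrized field of a variable in `K`. -/
noncomputable def absStep (lam : ℝ) (K : Set T) (Φ : EGraded T) : EGraded T := fun m s =>
  absCreation K Φ m s + ‖(lam : ℂ)‖ₑ * ∑ _i : Fin m, Φ m s +
    ∑ i : Fin (m + 1), ∫⁻ u in K, Φ (m + 1) (i.insertNth u s) ∂σ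

/-- A measurable family of graded functions which is dominated by `Φ` and vanishes unless the
parameters are in `K`. -/
structure Dominated {n : ℕ} (K : Set T) (Φ : EGraded T) (G : (Fin n → T) → Graded T) : Prop where
  bound : ∀ t m s, ‖G t m s‖ₑ ≤ Φ m s
  supp : ∀ t m s, (∃ i, t i ∉ K) → G t m s = 0
  meas : ∀ m, Measurable fun p : (Fin n → T) × (Fin m → T) => G p.1 m p.2

variable (σ) in
/-- Measurable square integrable graded functions. -/
structure SqIntegrable (Φ : EGraded T) : Prop where
  meas : ∀ m, Measurable (Φ m)
  lt_top : ∀ m, eLpNorm (Φ m) 2 (Measure.pi fun _ => σ) < ∞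

theorem Dominated.enorm_snoc_le {n : ℕ} {K : Set T} {Φ : EGraded T}
    {G : (Fin (n + 1) → T) → Graded T} (hG : Dominated K Φ G) (t : Fin n → T) (u : T) (m : ℕ)
    (s : Fin m → T) : ‖G (Fin.snoc t u) m s‖ₑ ≤ K.indicator (fun _ => Φ m s) u := by
  classical
  by_cases hu : u ∈ K
  · simpa [hu] using hG.bound _ m s
  · rw [hG.supp (Fin.snoc t u) m s ⟨Fin.last n, by simpa using hu⟩]
    simp

theorem lintegral_indicator_insertNth {K : Set T} (hK : MeasurableSet K) (Φ : EGraded T) {m : ℕ}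
    (i : Fin (m + 1)) (s : Fin m → T) :
    ∫⁻ u, K.indicator (fun _ => Φ (m + 1) (i.insertNth u s)) u ∂σ =
      ∫⁻ u in K, Φ (m + 1) (i.insertNth u s) ∂σ := by
  rw [← lintegral_indicator hK]
  rfl

/-- All weights have modulus one, so the triangle inequality suffices. The majorant does not depend
on the field variables; only the restriction of the consumed variable to `K` is kept, in the
creation and annihilation terms. -/
theorem Dominated.step [SFinite σ] {Q : Kernel σ} {lam : ℝ} {n : ℕ} {K : Set T}
    (hK : MeasurableSet K) {Φ : EGraded T}
    {G : (Fin (n + 1) → T) → Graded T} (hG : Dominated K Φ G) :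
    Dominated K (absStep σ lam K Φ) fun t => step Q lam fun u => G (Fin.snoc t u) where
  bound t m s := by
    unfold QField.step absStep
    refine (enorm_add_le _ _).trans (add_le_add ((enorm_add_le _ _).trans (add_le_add ?_ ?_)) ?_)
    · cases m with
      | zero => simp [creationStep]
      | succ m => exact hG.enorm_snoc_le t (s 0) m _
    · rw [enorm_mul]
      gcongr
      refine (enorm_sum_le _ _).trans (Finset.sum_le_sum fun i _ => hG.bound _ _ _)
    · refine (enorm_sum_le _ _).trans (Finset.sum_le_sum fun i _ => ?_)
      refine (enorm_integral_le_lintegral_enorm _).trans ?_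
      rw [← lintegral_indicator_insertNth hK]
      refine lintegral_mono fun u => ?_
      rw [enorm_mul, enorm_annWeight, one_mul]
      exact hG.enorm_snoc_le t u _ _
  supp t m s := by
    rintro ⟨i, hi⟩
    have h0 : ∀ u m' s', G (Fin.snoc t u) m' s' = 0 := fun u m' s' =>
      hG.supp _ _ _ ⟨i.castSucc, by simpa using hi⟩
    unfold QField.step
    cases m <;> simp [creationStep, h0]
  meas m := by
    unfold QField.step
    refine Measurable.add (Measurable.add ?_ ?_) ?_
    · cases m with
      | zero => exact measurable_const
      | succ m =>
        have h1 : Measurable fun p : (Fin n → T) × (Fin (m + 1) → T) =>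
            ((Fin.snoc p.1 (p.2 0) : Fin (n + 1) → T), fun i : Fin m => p.2 i.succ) := by
          refine Measurable.prodMk (Measurable.finSnoc measurable_fst
            ((measurable_pi_apply 0).comp measurable_snd)) ?_
          exact measurable_pi_iff.2 fun i => (measurable_pi_apply i.succ).comp measurable_snd
        exact (hG.meas m).comp h1
    · refine Measurable.const_mul (Finset.measurable_sum _ fun i _ => ?_) _
      have h1 : Measurable fun p : (Fin n → T) × (Fin m → T) =>
          ((Fin.snoc p.1 (p.2 i) : Fin (n + 1) → T), p.2) := by
        refine Measurable.prodMk (Measurable.finSnoc measurable_fst ?_) measurable_snd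
        exact (measurable_pi_apply i).comp measurable_snd
      exact (hG.meas m).comp h1
    · refine Finset.measurable_sum _ fun i _ => ?_
      have h2 : Measurable fun q : ((Fin n → T) × (Fin m → T)) × T => (q.2, q.1.2) :=
        measurable_snd.prodMk (measurable_snd.comp measurable_fst)
      have h1 : Measurable fun q : ((Fin n → T) × (Fin m → T)) × T =>
          ((Fin.snoc q.1.1 q.2 : Fin (n + 1) → T), (i.insertNth q.2 q.1.2 : Fin (m + 1) → T)) :=
        (Measurable.finSnoc (measurable_fst.comp measurable_fst) measurable_snd).prodMk
          ((measurable_insertNth i).comp h2)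
      have h3 : Measurable fun q : ((Fin n → T) × (Fin m → T)) × T =>
          annWeight Q i q.2 q.1.2 * G (Fin.snoc q.1.1 q.2) (m + 1) (i.insertNth q.2 q.1.2) :=
        ((measurable_annWeight Q i).comp h2).mul ((hG.meas (m + 1)).comp h1)
      exact h3.stronglyMeasurable.integral_prod_right'.measurable

theorem Dominated.iter [SFinite σ] {Q : Kernel σ} {lam : ℝ} {K : Set T} (hK : MeasurableSet K)
    {n : ℕ} {Φ : EGraded T} {G : (Fin n → T) → Graded T} (hG : Dominated K Φ G) (m : ℕ) :
    (∀ s, ‖iter Q lam n G m s‖ₑ ≤ (absStep σ lam K)^[n] Φ m s) ∧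
      Measurable (iter Q lam n G m) := by
  induction n generalizing Φ with
  | zero =>
    exact ⟨fun s => hG.bound _ _ _, (hG.meas m).comp (measurable_const.prodMk measurable_id)⟩
  | succ n ih => exact ih (Dominated.step hK hG)

/-! ### L² bounds for the majorant. -/

section Norms

variable [SigmaFinite σ]

omit [SigmaFinite σ] in
theorem measurable_absCreation {K : Set T} (hK : MeasurableSet K)
    {Φ : EGraded T} (hΦ : ∀ m, Measurable (Φ m)) (m : ℕ) : Measurable (absCreation K Φ m) := by
  cases m with
  | zero => exact measurable_const
  | succ m =>
    have h1 : Measurable fun s : Fin (m + 1) → T => Φ m (fun i => s i.succ) :=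
      (hΦ m).comp (measurable_pi_iff.2 fun i => measurable_pi_apply i.succ)
    exact h1.indicator (hK.preimage (measurable_pi_apply (0 : Fin (m + 1))))

theorem measurable_lintegral_insertNth (K : Set T) {Φ : EGraded T}
    (hΦ : ∀ m, Measurable (Φ m)) {m : ℕ} (i : Fin (m + 1)) :
    Measurable fun s => ∫⁻ u in K, Φ (m + 1) (i.insertNth u s) ∂σ :=
  Measurable.lintegral_prod_right' (ν := σ.restrict K)
    (f := fun p : (Fin m → T) × T => Φ (m + 1) (i.insertNth p.2 p.1))
    ((hΦ (m + 1)).comp ((measurable_insertNth i).comp measurable_swap))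

theorem measurable_absStep (lam : ℝ) {K : Set T} (hK : MeasurableSet K)
    {Φ : EGraded T} (hΦ : ∀ m, Measurable (Φ m)) (m : ℕ) : Measurable (absStep σ lam K Φ m) :=
  ((measurable_absCreation hK hΦ m).add
    ((Finset.measurable_sum _ fun _ _ => hΦ m).const_mul _)).add
    (Finset.measurable_sum _ fun i _ => measurable_lintegral_insertNth K hΦ i)

theorem eLpNorm_two_ennreal {X : Type*} [MeasurableSpace X] {μ : Measure X} (f : X → ℝ≥0∞) :
    eLpNorm f 2 μ = (∫⁻ x, f x ^ (2 : ℝ) ∂μ) ^ (1 / 2 : ℝ) := by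
  rw [eLpNorm_eq_lintegral_rpow_enorm_toReal (by norm_num) (by norm_num)]
  simp

theorem eLpNorm_const_mul_ennreal {X : Type*} [MeasurableSpace X] {μ : Measure X} (c : ℝ≥0∞)
    {f : X → ℝ≥0∞} (hf : Measurable f) :
    eLpNorm (fun x => c * f x) 2 μ = c * eLpNorm f 2 μ := by
  rw [eLpNorm_two_ennreal, eLpNorm_two_ennreal]
  simp only [ENNReal.mul_rpow_of_nonneg _ _ (by norm_num : (0 : ℝ) ≤ 2)]
  rw [lintegral_const_mul _ (hf.pow_const _),
    ENNReal.mul_rpow_of_nonneg _ _ (by norm_num), ← ENNReal.rpow_mul]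
  norm_num

theorem eLpNorm_absCreation {K : Set T} (hK : MeasurableSet K) {Φ : EGraded T}
    (hΦ : ∀ m, Measurable (Φ m)) (m : ℕ) :
    eLpNorm (absCreation K Φ (m + 1)) 2 (Measure.pi fun _ => σ) =
      (σ K) ^ (1 / 2 : ℝ) * eLpNorm (Φ m) 2 (Measure.pi fun _ => σ) := by
  have h1 : absCreation K Φ (m + 1) = (fun p : T × (Fin m → T) =>
      K.indicator (fun _ => (1 : ℝ≥0∞)) p.1 * Φ m p.2) ∘
      fun t : Fin (m + 1) → T => (t 0, fun i : Fin m => t i.succ) := by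
    funext s
    by_cases hs : s 0 ∈ K <;> simp [absCreation, hs]
  have hm1 : Measurable (K.indicator (fun _ => (1 : ℝ≥0∞))) := measurable_const.indicator hK
  rw [eLpNorm_two_ennreal, eLpNorm_two_ennreal, h1]
  simp only [Function.comp_apply]
  have hmeas : Measurable fun p : T × (Fin m → T) =>
      (K.indicator (fun _ => (1 : ℝ≥0∞)) p.1 * Φ m p.2) ^ (2 : ℝ) :=
    ((hm1.comp measurable_fst).mul ((hΦ m).comp measurable_snd)).pow_const _
  rw [(measurePreserving_headTail σ m).lintegral_comp hmeas]
  simp only [ENNReal.mul_rpow_of_nonneg _ _ (by norm_num : (0 : ℝ) ≤ 2)]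
  rw [lintegral_prod_mul (f := fun x => K.indicator (fun _ => (1 : ℝ≥0∞)) x ^ (2 : ℝ))
    (g := fun x => Φ m x ^ (2 : ℝ)) (hm1.pow_const _).aemeasurable
    ((hΦ m).pow_const _).aemeasurable, ENNReal.mul_rpow_of_nonneg _ _ (by norm_num)]
  congr 2
  have : (fun x => K.indicator (fun _ => (1 : ℝ≥0∞)) x ^ (2 : ℝ)) = K.indicator 1 := by
    funext x
    by_cases hx : x ∈ K <;> simp [hx]
  rw [this, lintegral_indicator_one hK]

/-- Cauchy–Schwarz in `u` against the constant 1 on `K`, then Tonelli. -/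
theorem eLpNorm_lintegral_insertNth_le (K : Set T) {Φ : EGraded T}
    (hΦ : ∀ m, Measurable (Φ m)) {m : ℕ} (i : Fin (m + 1)) :
    eLpNorm (fun s => ∫⁻ u in K, Φ (m + 1) (i.insertNth u s) ∂σ) 2 (Measure.pi fun _ => σ) ≤
      (σ K) ^ (1 / 2 : ℝ) * eLpNorm (Φ (m + 1)) 2 (Measure.pi fun _ => σ) := by
  rw [eLpNorm_two_ennreal, eLpNorm_two_ennreal,
    ← ENNReal.mul_rpow_of_nonneg _ _ (by norm_num)]
  refine ENNReal.rpow_le_rpow ?_ (by norm_num)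
  have hCS : ∀ s : Fin m → T, (∫⁻ u in K, Φ (m + 1) (i.insertNth u s) ∂σ) ^ (2 : ℝ) ≤
      σ K * ∫⁻ u, Φ (m + 1) (i.insertNth u s) ^ (2 : ℝ) ∂σ := by
    intro s
    have hms : Measurable fun u => Φ (m + 1) (i.insertNth u s) :=
      (hΦ (m + 1)).comp (measurable_insertNth_left i s)
    have h := ENNReal.lintegral_mul_le_Lp_mul_Lq (σ.restrict K) Real.HolderConjugate.two_two
      (f := fun _ => (1 : ℝ≥0∞)) aemeasurable_const hms.aemeasurable
    simp only [Pi.mul_apply, one_mul, ENNReal.one_rpow, lintegral_const, Measure.restrict_apply,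
      MeasurableSet.univ, Set.univ_inter] at h
    refine (ENNReal.rpow_le_rpow h (by norm_num)).trans ?_
    rw [ENNReal.mul_rpow_of_nonneg _ _ (by norm_num), ← ENNReal.rpow_mul, ← ENNReal.rpow_mul]
    norm_num
    gcongr
    exact Measure.restrict_le_self
  refine (lintegral_mono hCS).trans ?_
  have hm2 : Measurable fun p : T × (Fin m → T) => Φ (m + 1) (i.insertNth p.1 p.2) ^ (2 : ℝ) :=
    ((hΦ (m + 1)).comp (measurable_insertNth i)).pow_const _
  rw [lintegral_const_mul _ hm2.lintegral_prod_left', ← lintegral_prod_symm' _ hm2,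
    (measurePreserving_insertNth σ i).lintegral_comp ((hΦ (m + 1)).pow_const (2 : ℝ))]

/-- The sum of the norms of the first components. -/
noncomputable def normSum (σ : Measure T) (M : ℕ) (Φ : EGraded T) : ℝ≥0∞ :=
  ∑ m ∈ Finset.range M, eLpNorm (Φ m) 2 (Measure.pi fun _ => σ)

omit [SigmaFinite σ] in
theorem eLpNorm_le_normSum {M m : ℕ} (h : m < M) (Φ : EGraded T) :
    eLpNorm (Φ m) 2 (Measure.pi fun _ => σ) ≤ normSum σ M Φ :=
  Finset.single_le_sum (f := fun m => eLpNorm (Φ m) 2 (Measure.pi fun _ => σ))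
    (fun _ _ => zero_le) (Finset.mem_range.2 h)

omit [SigmaFinite σ] in
theorem normSum_mono {M N : ℕ} (h : M ≤ N) (Φ : EGraded T) : normSum σ M Φ ≤ normSum σ N Φ :=
  Finset.sum_le_sum_of_subset (Finset.range_mono h)

theorem eLpNorm_absCreation_le_normSum {K : Set T} (hK : MeasurableSet K) {Φ : EGraded T}
    (hΦ : ∀ m, Measurable (Φ m)) (m : ℕ) :
    eLpNorm (absCreation K Φ m) 2 (Measure.pi fun _ => σ) ≤
      (σ K) ^ (1 / 2 : ℝ) * normSum σ (m + 2) Φ := by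
  cases m with
  | zero =>
    have : absCreation K Φ 0 = 0 := rfl
    rw [this, eLpNorm_zero]
    exact zero_le
  | succ m =>
    rw [eLpNorm_absCreation hK hΦ]
    exact mul_le_mul_right (eLpNorm_le_normSum (by omega) Φ) _

theorem eLpNorm_sum_lintegral_insertNth_le (K : Set T) {Φ : EGraded T}
    (hΦ : ∀ m, Measurable (Φ m)) (m : ℕ) :
    eLpNorm (fun s => ∑ i : Fin (m + 1), ∫⁻ u in K, Φ (m + 1) (i.insertNth u s) ∂σ) 2
      (Measure.pi fun _ => σ) ≤ ((m + 1 : ℕ) * (σ K) ^ (1 / 2 : ℝ)) * normSum σ (m + 2) Φ := by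
  have e : (fun s => ∑ i : Fin (m + 1), ∫⁻ u in K, Φ (m + 1) (i.insertNth u s) ∂σ) =
      ∑ i : Fin (m + 1), fun s => ∫⁻ u in K, Φ (m + 1) (i.insertNth u s) ∂σ := by
    funext s
    simp
  rw [e]
  refine (eLpNorm_sum_le (fun i _ =>
    (measurable_lintegral_insertNth K hΦ i).aestronglyMeasurable) (by norm_num)).trans ?_
  have h3 : ∀ i : Fin (m + 1), eLpNorm (fun s => ∫⁻ u in K, Φ (m + 1) (i.insertNth u s) ∂σ) 2
      (Measure.pi fun _ => σ) ≤ (σ K) ^ (1 / 2 : ℝ) * normSum σ (m + 2) Φ := fun i =>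
    (eLpNorm_lintegral_insertNth_le K hΦ i).trans
      (mul_le_mul_right (eLpNorm_le_normSum (by omega) Φ) _)
  refine (Finset.sum_le_sum fun i _ => h3 i).trans ?_
  rw [Finset.sum_const, Finset.card_univ, Fintype.card_fin, nsmul_eq_mul, mul_assoc]

theorem exists_eLpNorm_absStep_le (lam : ℝ) {K : Set T} (hK : MeasurableSet K)
    (hKσ : σ K < ∞) (m : ℕ) :
    ∃ C : ℝ≥0∞, C < ∞ ∧ ∀ Φ : EGraded T, (∀ m, Measurable (Φ m)) →
      eLpNorm (absStep σ lam K Φ m) 2 (Measure.pi fun _ => σ) ≤ C * normSum σ (m + 2) Φ := by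
  have hc : (σ K) ^ (1 / 2 : ℝ) < ∞ := ENNReal.rpow_lt_top_of_nonneg (by norm_num) hKσ.ne
  refine ⟨(σ K) ^ (1 / 2 : ℝ) + ‖(lam : ℂ)‖ₑ * m + (m + 1 : ℕ) * (σ K) ^ (1 / 2 : ℝ),
    ENNReal.add_lt_top.2 ⟨ENNReal.add_lt_top.2 ⟨hc, ENNReal.mul_lt_top enorm_lt_top
      (ENNReal.natCast_lt_top _)⟩, ENNReal.mul_lt_top (ENNReal.natCast_lt_top _) hc⟩,
    fun Φ hΦ => ?_⟩
  have hmN : Measurable fun s => ‖(lam : ℂ)‖ₑ * ∑ _i : Fin m, Φ m s :=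
    (Finset.measurable_sum _ fun i _ => hΦ m).const_mul _
  have hmC := measurable_absCreation hK hΦ m
  have hmL : Measurable fun s =>
      ∑ i : Fin (m + 1), ∫⁻ u in K, Φ (m + 1) (i.insertNth u s) ∂σ :=
    Finset.measurable_sum _ fun i _ => measurable_lintegral_insertNth K hΦ i
  have h2 : eLpNorm (fun s => ‖(lam : ℂ)‖ₑ * ∑ _i : Fin m, Φ m s) 2 (Measure.pi fun _ => σ) ≤
      ‖(lam : ℂ)‖ₑ * m * normSum σ (m + 2) Φ := by
    simp only [Finset.sum_const, Finset.card_univ, Fintype.card_fin, nsmul_eq_mul, ← mul_assoc]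
    rw [eLpNorm_const_mul_ennreal _ (hΦ m)]
    exact mul_le_mul_right (eLpNorm_le_normSum (by omega) Φ) _
  rw [add_mul, add_mul]
  have h4 := eLpNorm_add_le (μ := Measure.pi fun _ : Fin m => σ) (p := 2)
    (hmC.add hmN).aestronglyMeasurable hmL.aestronglyMeasurable (by norm_num)
  have h5 := eLpNorm_add_le (μ := Measure.pi fun _ : Fin m => σ) (p := 2)
    hmC.aestronglyMeasurable hmN.aestronglyMeasurable (by norm_num)
  exact h4.trans (add_le_add (h5.trans (add_le_add (eLpNorm_absCreation_le_normSum hK hΦ m) h2))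
    (eLpNorm_sum_lintegral_insertNth_le K hΦ m))

/-- A step lowers the degree by at most one, so component `m` after `n` steps involves only the
components up to `m + n`. The constant does not depend on `Φ`, which later yields continuity on the
Fock space. -/
theorem exists_eLpNorm_iterate_absStep_le (lam : ℝ) {K : Set T} (hK : MeasurableSet K)
    (hKσ : σ K < ∞) (n m : ℕ) :
    ∃ C : ℝ≥0∞, C < ∞ ∧ ∀ Φ : EGraded T, (∀ m, Measurable (Φ m)) →
      eLpNorm ((absStep σ lam K)^[n] Φ m) 2 (Measure.pi fun _ => σ) ≤
        C * normSum σ (m + n + 1) Φ := by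
  induction n with
  | zero => exact ⟨1, by simp, fun Φ _ => by
      simpa using eLpNorm_le_normSum (Nat.lt_succ_self m) Φ⟩
  | succ n ih =>
    obtain ⟨C, hC, h⟩ := ih
    choose D hD hD' using exists_eLpNorm_absStep_le (σ := σ) lam hK hKσ
    refine ⟨C * ∑ m' ∈ Finset.range (m + n + 1), D m',
      ENNReal.mul_lt_top hC (ENNReal.sum_lt_top.2 fun i _ => hD i), fun Φ hΦ => ?_⟩
    rw [Function.iterate_succ_apply]
    refine (h _ (measurable_absStep lam hK hΦ)).trans ?_
    rw [mul_assoc]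
    refine mul_le_mul_right ?_ _
    rw [Finset.sum_mul]
    refine Finset.sum_le_sum fun m' hm' => (hD' m' Φ hΦ).trans ?_
    rw [Finset.mem_range] at hm'
    exact mul_le_mul_right (normSum_mono (by omega) Φ) _

theorem SqIntegrable.absStep {lam : ℝ} {K : Set T} (hK : MeasurableSet K) (hKσ : σ K < ∞)
    {Φ : EGraded T} (hΦ : SqIntegrable σ Φ) : SqIntegrable σ (absStep σ lam K Φ) where
  meas := measurable_absStep lam hK hΦ.meas
  lt_top m := by
    obtain ⟨C, hC, h⟩ := exists_eLpNorm_absStep_le (σ := σ) lam hK hKσ m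
    exact (h Φ hΦ.meas).trans_lt (ENNReal.mul_lt_top hC
      (ENNReal.sum_lt_top.2 fun i _ => hΦ.lt_top i))

theorem SqIntegrable.iterate {lam : ℝ} {K : Set T} (hK : MeasurableSet K) (hKσ : σ K < ∞)
    {Φ : EGraded T} (hΦ : SqIntegrable σ Φ) (n : ℕ) :
    SqIntegrable σ ((QField.absStep σ lam K)^[n] Φ) := by
  induction n with
  | zero => exact hΦ
  | succ n ih => rw [Function.iterate_succ_apply']; exact ih.absStep hK hKσ

/-- The integrals are summands of `absStep`, which is square integrable and hence finite almost
everywhere. -/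
theorem SqIntegrable.ae_lintegral_lt_top {K : Set T} (hK : MeasurableSet K) (hKσ : σ K < ∞)
    {Φ : EGraded T} (hΦ : SqIntegrable σ Φ) (m : ℕ) : ∀ᵐ s ∂(Measure.pi fun _ : Fin m => σ),
      ∀ i : Fin (m + 1), ∫⁻ u in K, Φ (m + 1) (i.insertNth u s) ∂σ < ∞ := by
  -- The value of `λ` is immaterial, because only the annihilation part is used.
  have h := (hΦ.absStep (lam := 0) hK hKσ)
  have h2 := h.lt_top m
  rw [eLpNorm_two_ennreal, ENNReal.rpow_lt_top_iff_of_pos (by norm_num)] at h2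
  filter_upwards [ae_lt_top ((h.meas m).pow_const _) h2.ne] with s hs i
  rw [ENNReal.rpow_lt_top_iff_of_pos (by norm_num)] at hs
  refine lt_of_le_of_lt ?_ hs
  unfold QField.absStep
  refine le_trans ?_ le_add_self
  exact Finset.single_le_sum
    (f := fun i : Fin (m + 1) => ∫⁻ u in K, Φ (m + 1) (i.insertNth u s) ∂σ)
    (fun _ _ => zero_le) (Finset.mem_univ i)

end Norms

end Step

/-! ### Almost everywhere congruence, linearity and convergence of the iterates. -/

section IterAe

variable {T : Type*} [MeasurableSpace T] {σ : Measure T} [SigmaFinite σ]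

theorem ae_insertNth {m : ℕ} {p : (Fin (m + 1) → T) → Prop}
    (h : ∀ᵐ s ∂(Measure.pi fun _ => σ), p s) :
    ∀ᵐ s ∂(Measure.pi fun _ : Fin m => σ), ∀ i : Fin (m + 1), ∀ᵐ u ∂σ, p (i.insertNth u s) := by
  refine ae_all_iff.2 fun i => ?_
  have hq := (measurePreserving_insertNth (n := m) σ i).comp
    (Measure.measurePreserving_swap (μ := Measure.pi fun _ : Fin m => σ) (ν := σ))
  exact Measure.ae_ae_of_ae_prod (hq.quasiMeasurePreserving.ae h)

variable (Q : Kernel σ) (lam : ℝ)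

/-- The exceptional null set lives in the Fock variables and is uniform in the field variables. This
is essential: creation and the neutral part evaluate the field variable at coordinates of `s`, where
a null set of field variables gives no control. -/
theorem step_congr {n : ℕ} {G G' : (Fin (n + 1) → T) → Graded T} {m : ℕ}
    (h : ∀ m', m ≤ m' + 1 → ∀ᵐ s ∂(Measure.pi fun _ : Fin m' => σ), ∀ t, G t m' s = G' t m' s) :
    ∀ᵐ s ∂(Measure.pi fun _ : Fin m => σ), ∀ t : Fin n → T,
      step Q lam (fun u => G (Fin.snoc t u)) m s = step Q lam (fun u => G' (Fin.snoc t u)) m s := by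
  have hc : ∀ᵐ s ∂(Measure.pi fun _ : Fin m => σ), ∀ t : Fin n → T,
      creationStep (fun u => G (Fin.snoc t u)) m s =
        creationStep (fun u => G' (Fin.snoc t u)) m s := by
    cases m with
    | zero => exact ae_of_all _ fun s t => rfl
    | succ m =>
      filter_upwards [(quasi_tail σ m).ae (h m le_rfl)] with s hs t
      exact hs _
  filter_upwards [hc, h m (by omega), ae_insertNth (h (m + 1) (by omega))] with s h1 h2 h3 t
  unfold step
  congr 2
  · exact h1 t
  · congr 1
    exact Finset.sum_congr rfl fun i _ => h2 _
  · funext i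
    refine integral_congr_ae ?_
    filter_upwards [h3 i] with u hu
    simp only [hu]

/-- Each step raises the degree by at most one, so only the components `m'` with `m ≤ m' + n`
matter. -/
theorem iter_congr {n : ℕ} {G G' : (Fin n → T) → Graded T} {m : ℕ}
    (h : ∀ m', m ≤ m' + n → ∀ᵐ s ∂(Measure.pi fun _ : Fin m' => σ), ∀ t, G t m' s = G' t m' s) :
    iter Q lam n G m =ᵐ[Measure.pi fun _ => σ] iter Q lam n G' m := by
  induction n with
  | zero =>
    filter_upwards [h m le_rfl] with s hs using hs _
  | succ n ih =>
    exact ih fun m' hm' => step_congr Q lam fun m'' hm'' => h m'' (by omega)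

omit [SigmaFinite σ] in
theorem step_const_mul (c : ℂ) (H : T → Graded T) :
    step Q lam (fun u m s => c * H u m s) = fun m s => c * step Q lam H m s := by
  funext m s
  have hc : creationStep (fun u m s => c * H u m s) m s = c * creationStep H m s := by
    cases m <;> simp [creationStep]
  unfold step
  have e : ∀ i : Fin (m + 1), ∫ u, annWeight Q i u s * (c * H u (m + 1) (i.insertNth u s)) ∂σ =
      c * ∫ u, annWeight Q i u s * H u (m + 1) (i.insertNth u s) ∂σ := by
    intro i
    rw [← integral_const_mul]
    refine integral_congr_ae (ae_of_all _ fun u => ?_)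
    simp only
    ring
  simp only [e, hc, ← Finset.mul_sum]
  ring

omit [SigmaFinite σ] in
theorem iter_const_mul {n : ℕ} (c : ℂ) (G : (Fin n → T) → Graded T) :
    iter Q lam n (fun t m s => c * G t m s) = fun m s => c * iter Q lam n G m s := by
  induction n with
  | zero => rfl
  | succ n ih =>
    rw [iter, iter, ← ih]
    congr 1
    funext t
    exact step_const_mul Q lam c _

/-- The null set depends on `Φ` alone and serves all dominated families at once, in particular all
members of a sequence. -/
theorem Dominated.integrable {n : ℕ} {K : Set T} (hK : MeasurableSet K) (hKσ : σ K < ∞)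
    {Φ : EGraded T} (hΦ : SqIntegrable σ Φ) (m : ℕ) :
    ∀ᵐ s ∂(Measure.pi fun _ : Fin m => σ), ∀ (G : (Fin (n + 1) → T) → Graded T),
      Dominated K Φ G → ∀ (t : Fin n → T) (i : Fin (m + 1)),
        Integrable (fun u => annWeight Q i u s * G (Fin.snoc t u) (m + 1) (i.insertNth u s)) σ := by
  filter_upwards [hΦ.ae_lintegral_lt_top hK hKσ m] with s hs G hG t i
  have h1 : Measurable fun u => annWeight Q i u s :=
    (measurable_annWeight Q i).comp (measurable_id.prodMk measurable_const)
  have h2 : Measurable fun u =>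
      ((Fin.snoc t u : Fin (n + 1) → T), (i.insertNth u s : Fin (m + 1) → T)) :=
    (Measurable.finSnoc measurable_const measurable_id).prodMk (measurable_insertNth_left i s)
  refine ⟨(h1.mul ((hG.meas (m + 1)).comp h2)).aestronglyMeasurable, ?_⟩
  refine lt_of_le_of_lt ?_ (hs i)
  rw [← lintegral_indicator_insertNth hK]
  refine lintegral_mono fun u => ?_
  rw [enorm_mul, enorm_annWeight, one_mul]
  exact hG.enorm_snoc_le t u _ _

theorem step_linear {n : ℕ} {K K' : Set T} (hK : MeasurableSet K) (hKσ : σ K < ∞)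
    (hK' : MeasurableSet K') (hKσ' : σ K' < ∞) {Φ Φ' : EGraded T}
    (hΦ : SqIntegrable σ Φ) (hΦ' : SqIntegrable σ Φ') {G G' : (Fin (n + 1) → T) → Graded T}
    (hG : Dominated K Φ G) (hG' : Dominated K' Φ' G') (a b : ℂ) (m : ℕ) :
    ∀ᵐ s ∂(Measure.pi fun _ : Fin m => σ), ∀ t : Fin n → T,
      step Q lam (fun u m s => a * G (Fin.snoc t u) m s + b * G' (Fin.snoc t u) m s) m s =
        a * step Q lam (fun u => G (Fin.snoc t u)) m s +
          b * step Q lam (fun u => G' (Fin.snoc t u)) m s := by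
  filter_upwards [Dominated.integrable (n := n) Q hK hKσ hΦ m,
    Dominated.integrable (n := n) Q hK' hKσ' hΦ' m] with s h1 h2 t
  unfold step
  have e : ∀ i : Fin (m + 1), ∫ u, annWeight Q i u s *
      (a * G (Fin.snoc t u) (m + 1) (i.insertNth u s) +
        b * G' (Fin.snoc t u) (m + 1) (i.insertNth u s)) ∂σ =
      a * ∫ u, annWeight Q i u s * G (Fin.snoc t u) (m + 1) (i.insertNth u s) ∂σ +
      b * ∫ u, annWeight Q i u s * G' (Fin.snoc t u) (m + 1) (i.insertNth u s) ∂σ := by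
    intro i
    rw [← integral_const_mul, ← integral_const_mul,
      ← integral_add ((h1 G hG t i).const_mul _) ((h2 G' hG' t i).const_mul _)]
    refine integral_congr_ae (ae_of_all _ fun u => ?_)
    simp only
    ring
  simp only [e, Finset.sum_add_distrib, ← Finset.mul_sum]
  have hc : creationStep (fun u m s => a * G (Fin.snoc t u) m s + b * G' (Fin.snoc t u) m s) m s =
      a * creationStep (fun u => G (Fin.snoc t u)) m s +
        b * creationStep (fun u => G' (Fin.snoc t u)) m s := by
    cases m <;> simp [creationStep]
  rw [hc]
  ring

theorem iter_linear {n : ℕ} {K K' : Set T} (hK : MeasurableSet K) (hKσ : σ K < ∞)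
    (hK' : MeasurableSet K') (hKσ' : σ K' < ∞) {Φ Φ' : EGraded T}
    (hΦ : SqIntegrable σ Φ) (hΦ' : SqIntegrable σ Φ') {G G' : (Fin n → T) → Graded T}
    (hG : Dominated K Φ G) (hG' : Dominated K' Φ' G') (a b : ℂ) (m : ℕ) :
    iter Q lam n (fun t m s => a * G t m s + b * G' t m s) m =ᵐ[Measure.pi fun _ => σ]
      fun s => a * iter Q lam n G m s + b * iter Q lam n G' m s := by
  induction n generalizing Φ Φ' with
  | zero => exact ae_of_all _ fun s => rfl
  | succ n ih =>
    refine EventuallyEq.trans ?_ (ih (hΦ.absStep hK hKσ) (hΦ'.absStep hK' hKσ')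
      (hG.step (Q := Q) (lam := lam) hK) (hG'.step (Q := Q) (lam := lam) hK'))
    exact iter_congr Q lam fun m _ => step_linear Q lam hK hKσ hK' hKσ' hΦ hΦ' hG hG' a b m

/-- Creation and the neutral part converge pointwise. For the integrals, the common majorant `Φ` on
`K` permits dominated convergence. -/
theorem step_tendsto {n : ℕ} {K : Set T} (hK : MeasurableSet K) (hKσ : σ K < ∞) {Φ : EGraded T}
    (hΦ : SqIntegrable σ Φ) {G : ℕ → (Fin (n + 1) → T) → Graded T}
    {G' : (Fin (n + 1) → T) → Graded T} (hG : ∀ k, Dominated K Φ (G k))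
    (h : ∀ m, ∀ᵐ s ∂(Measure.pi fun _ : Fin m => σ), ∀ t,
      Tendsto (fun k => G k t m s) atTop (𝓝 (G' t m s))) (m : ℕ) :
    ∀ᵐ s ∂(Measure.pi fun _ : Fin m => σ), ∀ t : Fin n → T,
      Tendsto (fun k => step Q lam (fun u => G k (Fin.snoc t u)) m s) atTop
        (𝓝 (step Q lam (fun u => G' (Fin.snoc t u)) m s)) := by
  have hc : ∀ᵐ s ∂(Measure.pi fun _ : Fin m => σ), ∀ t : Fin n → T,
      Tendsto (fun k => creationStep (fun u => G k (Fin.snoc t u)) m s) atTop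
        (𝓝 (creationStep (fun u => G' (Fin.snoc t u)) m s)) := by
    cases m with
    | zero => exact ae_of_all _ fun s t => tendsto_const_nhds
    | succ m =>
      filter_upwards [(quasi_tail σ m).ae (h m)] with s hs t
      exact hs _
  filter_upwards [hc, h m, ae_insertNth (h (m + 1)), hΦ.ae_lintegral_lt_top hK hKσ m,
    Dominated.integrable (n := n) Q hK hKσ hΦ m] with s h1 h2 h3 h4 h5 t
  unfold step
  refine ((h1 t).add (Tendsto.const_mul _ (tendsto_finsetSum _ fun i _ => h2 _))).add
    (tendsto_finsetSum _ fun i _ => ?_)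
  have hmΦ : Measurable fun u => K.indicator (fun _ => Φ (m + 1) (i.insertNth u s)) u :=
    ((hΦ.meas (m + 1)).comp (measurable_insertNth_left i s)).indicator hK
  have hfin := h4 i
  rw [← lintegral_indicator_insertNth hK] at hfin
  refine tendsto_integral_of_dominated_convergence
    (fun u => (K.indicator (fun _ => Φ (m + 1) (i.insertNth u s)) u).toReal)
    (fun k => (h5 (G k) (hG k) t i).aestronglyMeasurable)
    (integrable_toReal_of_lintegral_ne_top hmΦ.aemeasurable hfin.ne) (fun k => ?_) ?_
  · filter_upwards [ae_lt_top hmΦ hfin.ne] with u hu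
    rw [norm_mul, norm_annWeight, one_mul, ← toReal_enorm]
    exact ENNReal.toReal_mono hu.ne ((hG k).enorm_snoc_le t u _ _)
  · filter_upwards [h3 i] with u hu
    exact (hu _).const_mul _

theorem iter_tendsto {n : ℕ} {K : Set T} (hK : MeasurableSet K) (hKσ : σ K < ∞) {Φ : EGraded T}
    (hΦ : SqIntegrable σ Φ) {G : ℕ → (Fin n → T) → Graded T}
    {G' : (Fin n → T) → Graded T} (hG : ∀ k, Dominated K Φ (G k))
    (h : ∀ m, ∀ᵐ s ∂(Measure.pi fun _ : Fin m => σ), ∀ t,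
      Tendsto (fun k => G k t m s) atTop (𝓝 (G' t m s))) (m : ℕ) :
    ∀ᵐ s ∂(Measure.pi fun _ : Fin m => σ),
      Tendsto (fun k => iter Q lam n (G k) m s) atTop (𝓝 (iter Q lam n G' m s)) := by
  induction n generalizing Φ with
  | zero =>
    filter_upwards [h m] with s hs using hs _
  | succ n ih =>
    exact ih (hΦ.absStep hK hKσ) (fun k => (hG k).step hK)
      (fun m => step_tendsto Q lam hK hKσ hΦ hG h m)

theorem Dominated.memLp_iter {n : ℕ} {K : Set T} (hK : MeasurableSet K) (hKσ : σ K < ∞)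
    {Φ : EGraded T} (hΦ : SqIntegrable σ Φ) {G : (Fin n → T) → Graded T}
    (hG : Dominated K Φ G) (m : ℕ) : MemLp (QField.iter Q lam n G m) 2 (Measure.pi fun _ => σ) := by
  obtain ⟨hb, hm⟩ := hG.iter (Q := Q) (lam := lam) hK m
  exact ⟨hm.aestronglyMeasurable, (eLpNorm_mono_enorm fun s => by
    simpa using hb s).trans_lt ((hΦ.iterate (lam := lam) hK hKσ n).lt_top m)⟩

omit [SigmaFinite σ] in
theorem tendsto_toLp_of_dominated {X : Type*} [MeasurableSpace X] {μ : Measure X}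
    {f : ℕ → X → ℂ} {g : X → ℂ} {Ψ : X → ℝ≥0∞} (hf : ∀ k, MemLp (f k) 2 μ) (hg : MemLp g 2 μ)
    (hΨ : eLpNorm Ψ 2 μ < ∞) (hb : ∀ k x, ‖f k x‖ₑ ≤ Ψ x)
    (h : ∀ᵐ x ∂μ, Tendsto (fun k => f k x) atTop (𝓝 (g x))) :
    Tendsto (fun k => (hf k).toLp (f k)) atTop (𝓝 (hg.toLp g)) := by
  rw [Lp.tendsto_Lp_iff_tendsto_eLpNorm'']
  have hgb : ∀ᵐ x ∂μ, ‖g x‖ₑ ≤ Ψ x := by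
    filter_upwards [h] with x hx
    exact le_of_tendsto hx.enorm (Eventually.of_forall fun k => hb k x)
  have key : Tendsto (fun k => ∫⁻ x, ‖f k x - g x‖ₑ ^ (2 : ℝ) ∂μ) atTop (𝓝 0) := by
    have h0 : ∫⁻ _x, (0 : ℝ≥0∞) ∂μ = 0 := lintegral_zero
    rw [← h0]
    -- The limit inherits the bound `Ψ`, so the differences are at most `2 * Ψ`.
    refine tendsto_lintegral_of_dominated_convergence' (fun x => (2 * Ψ x) ^ (2 : ℝ))
      (fun k => ?_) (fun k => ?_) ?_ ?_
    · exact (((hf k).1.sub hg.1).enorm).pow_const _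
    · filter_upwards [hgb] with x hx
      refine ENNReal.rpow_le_rpow ?_ (by norm_num)
      rw [two_mul]
      exact (enorm_sub_le).trans (add_le_add (hb k x) hx)
    · simp only [ENNReal.mul_rpow_of_nonneg _ _ (by norm_num : (0 : ℝ) ≤ 2)]
      rw [lintegral_const_mul' _ _ (by norm_num)]
      rw [eLpNorm_two_ennreal, ENNReal.rpow_lt_top_iff_of_pos (by norm_num)] at hΨ
      exact ENNReal.mul_ne_top (by norm_num) hΨ.ne
    · filter_upwards [h] with x hx
      have h1 : Tendsto (fun k => ‖f k x - g x‖ₑ) atTop (𝓝 0) := by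
        have := (hx.sub_const (g x)).enorm
        simpa using this
      have h2 := (ENNReal.continuous_rpow_const (y := (2 : ℝ))).tendsto 0 |>.comp h1
      simpa [Function.comp_def] using h2
  have h2 := ((ENNReal.continuous_rpow_const (y := (1 / 2 : ℝ))).tendsto 0).comp key
  rw [ENNReal.zero_rpow_of_pos (by norm_num)] at h2
  refine h2.congr fun k => ?_
  rw [eLpNorm_eq_lintegral_rpow_enorm_toReal (by norm_num) (by norm_num)]
  simp

end IterAe

/-! ### Components of the Fock space operators, and symmetrization of functions. -/

section FockComponents

variable {T : Type*} [MeasurableSpace T] {σ : Measure T} [SigmaFinite σ] (Q : Kernel σ)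

theorem creation_apply_zero (h : Lp ℂ 2 σ) (F : FockFin Q) : creation Q h F 0 = 0 := by
  have : (DirectSum.component ℂ ℕ (fun n => Hsym Q n) 0) ∘ₗ creation Q h = 0 := by
    refine DirectSum.linearMap_ext ℂ fun n => LinearMap.ext fun x => ?_
    simp only [LinearMap.comp_apply, creation, DirectSum.toModule_lof, LinearMap.zero_apply]
    exact DirectSum.of_eq_of_ne (n + 1) 0 (creationComp Q h n x) (by omega)
  exact LinearMap.congr_fun this F

theorem creation_apply_succ (h : Lp ℂ 2 σ) (F : FockFin Q) (m : ℕ) :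
    creation Q h F (m + 1) = creationComp Q h m (F m) := by
  have : (DirectSum.component ℂ ℕ (fun n => Hsym Q n) (m + 1)) ∘ₗ creation Q h =
      (creationComp Q h m : Hsym Q m →ₗ[ℂ] Hsym Q (m + 1)) ∘ₗ
        DirectSum.component ℂ ℕ (fun n => Hsym Q n) m := by
    refine DirectSum.linearMap_ext ℂ fun n => LinearMap.ext fun x => ?_
    simp only [LinearMap.comp_apply, creation, DirectSum.toModule_lof]
    by_cases hn : n = m
    · subst hn
      rw [DirectSum.component.lof_self, DirectSum.component.lof_self]
    · have h1 : DirectSum.lof ℂ ℕ (fun n => Hsym Q n) n x m = 0 :=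
        DirectSum.of_eq_of_ne _ _ _ (by omega)
      have h2 : ∀ y, DirectSum.lof ℂ ℕ (fun n => Hsym Q n) (n + 1) y (m + 1) = 0 := fun y =>
        DirectSum.of_eq_of_ne _ _ _ (by omega)
      rw [DirectSum.component, DirectSum.component, DFinsupp.lapply_apply, DFinsupp.lapply_apply]
      erw [h1, h2]
      simp
  exact LinearMap.congr_fun this F

theorem annihilation_apply (h : Lp ℂ 2 σ) (F : FockFin Q) (m : ℕ) :
    annihilation Q h F m =
      ((m + 1 : ℕ) : ℂ) • ContinuousLinearMap.adjoint (creationComp Q h m) (F (m + 1)) := by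
  have : (DirectSum.component ℂ ℕ (fun n => Hsym Q n) m) ∘ₗ annihilation Q h =
      (((m + 1 : ℕ) : ℂ) • (ContinuousLinearMap.adjoint (creationComp Q h m) :
          Hsym Q (m + 1) →ₗ[ℂ] Hsym Q m)) ∘ₗ
        DirectSum.component ℂ ℕ (fun n => Hsym Q n) (m + 1) := by
    refine DirectSum.linearMap_ext ℂ fun n => LinearMap.ext fun x => ?_
    simp only [LinearMap.comp_apply, annihilation, DirectSum.toModule_lof]
    by_cases hn : n = m + 1
    · subst hn
      simp only [LinearMap.comp_apply]
      rw [DirectSum.component.lof_self, DirectSum.component.lof_self]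
    · have h1 : DirectSum.component ℂ ℕ (fun n => Hsym Q n) (m + 1)
          (DirectSum.lof ℂ ℕ (fun n => Hsym Q n) n x) = 0 :=
        DirectSum.of_eq_of_ne _ _ _ (by omega)
      rw [h1, map_zero]
      cases n with
      | zero => simp
      | succ n => exact DirectSum.of_eq_of_ne _ _ _ (by omega)
  exact LinearMap.congr_fun this F

theorem neutral_apply [TopologicalSpace T] (f : B0 ℝ T) (F : FockFin Q) (m : ℕ) :
    neutral Q f F m = P Q m (mulOp _ (memLp_sum_eval f m) (F m : L2n σ m)) := by
  have : (DirectSum.component ℂ ℕ (fun n => Hsym Q n) m) ∘ₗ neutral Q f =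
      ((((P Q m).comp (mulOp _ (memLp_sum_eval f m))).comp (Hsym Q m).subtypeL) :
        Hsym Q m →ₗ[ℂ] Hsym Q m) ∘ₗ DirectSum.component ℂ ℕ (fun n => Hsym Q n) m := by
    refine DirectSum.linearMap_ext ℂ fun n => LinearMap.ext fun x => ?_
    simp only [LinearMap.comp_apply, neutral, DirectSum.toModule_lof]
    by_cases hn : n = m
    · subst hn
      rw [DirectSum.component.lof_self, DirectSum.component.lof_self]
    · have h1 : DirectSum.component ℂ ℕ (fun n => Hsym Q n) m
          (DirectSum.lof ℂ ℕ (fun n => Hsym Q n) n x) = 0 :=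
        DirectSum.of_eq_of_ne _ _ _ (by omega)
      rw [h1, map_zero]
      exact DirectSum.of_eq_of_ne _ _ _ (by omega)
  exact LinearMap.congr_fun this F

/-- The `Q`-symmetrization of a square integrable function. -/
noncomputable def symmetrize (m : ℕ) (φ : (Fin m → T) → ℂ) : Hsym Q m :=
  open Classical in
  if h : MemLp φ 2 (Measure.pi fun _ => σ) then P Q m (h.toLp φ) else 0

variable {Q}

theorem symmetrize_of_memLp {m : ℕ} {φ : (Fin m → T) → ℂ}
    (h : MemLp φ 2 (Measure.pi fun _ => σ)) : symmetrize Q m φ = P Q m (h.toLp φ) :=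
  dif_pos h

theorem symmetrize_congr {m : ℕ} {φ ψ : (Fin m → T) → ℂ}
    (h : φ =ᵐ[Measure.pi fun _ => σ] ψ) : symmetrize Q m φ = symmetrize Q m ψ := by
  by_cases hφ : MemLp φ 2 (Measure.pi fun _ => σ)
  · have hψ := (memLp_congr_ae h).1 hφ
    rw [symmetrize_of_memLp hφ, symmetrize_of_memLp hψ, MemLp.toLp_congr hφ hψ h]
  · have hψ : ¬ MemLp ψ 2 (Measure.pi fun _ => σ) := fun hψ => hφ ((memLp_congr_ae h).2 hψ)
    rw [symmetrize, symmetrize, dif_neg hφ, dif_neg hψ]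

theorem symmetrize_linear {m : ℕ} {φ ψ : (Fin m → T) → ℂ}
    (hφ : MemLp φ 2 (Measure.pi fun _ => σ)) (hψ : MemLp ψ 2 (Measure.pi fun _ => σ)) (a b : ℂ) :
    symmetrize Q m (fun s => a * φ s + b * ψ s) =
      a • symmetrize Q m φ + b • symmetrize Q m ψ := by
  have h : MemLp (fun s => a * φ s + b * ψ s) 2 (Measure.pi fun _ => σ) :=
    (hφ.const_mul a).add (hψ.const_mul b)
  rw [symmetrize_of_memLp hφ, symmetrize_of_memLp hψ, symmetrize_of_memLp h, ← map_smul,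
    ← map_smul, ← map_add]
  congr 1

theorem symmetrize_coeFn {m : ℕ} (y : Hsym Q m) : symmetrize Q m (y : L2n σ m) = y := by
  rw [symmetrize_of_memLp (Lp.memLp (y : L2n σ m)), Lp.toLp_coeFn, P_of_mem]

theorem symmetrize_zero {m : ℕ} : symmetrize Q m (fun _ => 0) = 0 := by
  have h : MemLp (fun _ : Fin m → T => (0 : ℂ)) 2 (Measure.pi fun _ => σ) := MemLp.zero
  rw [symmetrize_of_memLp h]
  have : h.toLp _ = 0 := MemLp.toLp_zero h
  rw [this, map_zero]

end FockComponents

/-! ### The unsymmetrized field represents the field. -/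

section FieldAction

variable {T : Type*} [MeasurableSpace T] {σ : Measure T}

theorem dominated_mul {n : ℕ} {K : Set T} {C : ℝ} {f : (Fin n → T) → ℂ} (hm : Measurable f)
    (hb : ∀ t, ‖f t‖ ≤ C) (hs : ∀ t, (∃ i, t i ∉ K) → f t = 0) {γ : Graded T}
    (hγ : ∀ m, Measurable (γ m)) :
    Dominated K (fun m s => ENNReal.ofReal C * ‖γ m s‖ₑ) fun t m s => f t * γ m s where
  bound t m s := by
    rw [enorm_mul, ← ofReal_norm]
    gcongr
    exact hb t
  supp t m s ht := by rw [hs t ht, zero_mul]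
  meas m := (hm.comp measurable_fst).mul ((hγ m).comp measurable_snd)

theorem eLpNorm_ofReal_mul_enorm {X : Type*} [MeasurableSpace X] {μ : Measure X} (C : ℝ)
    {f : X → ℂ} (hf : Measurable f) :
    eLpNorm (fun x => ENNReal.ofReal C * ‖f x‖ₑ) 2 μ = ENNReal.ofReal C * eLpNorm f 2 μ := by
  rw [eLpNorm_const_mul_ennreal _ hf.enorm]
  congr 1

theorem sqIntegrable_mul (C : ℝ) {γ : Graded T}
    (hγ : ∀ m, Measurable (γ m)) (hγ2 : ∀ m, MemLp (γ m) 2 (Measure.pi fun _ => σ)) :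
    SqIntegrable σ (fun m s => ENNReal.ofReal C * ‖γ m s‖ₑ) where
  meas m := (hγ m).enorm.const_mul _
  lt_top m := by
    rw [eLpNorm_ofReal_mul_enorm C (hγ m)]
    exact ENNReal.mul_lt_top ENNReal.ofReal_lt_top (hγ2 m).2

variable [SigmaFinite σ] [TopologicalSpace T] [OpensMeasurableSpace T]
  [IsFiniteMeasureOnCompacts σ] (Q : Kernel σ) (lam : ℝ)

theorem memLp_step (f : B0 ℝ T) {γ : Graded T} (hγ : ∀ m, Measurable (γ m))
    (hγ2 : ∀ m, MemLp (γ m) 2 (Measure.pi fun _ => σ)) (m : ℕ) :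
    MemLp (step Q lam (fun u m s => ((f.1 u : ℝ) : ℂ) * γ m s) m) 2 (Measure.pi fun _ => σ) := by
  obtain ⟨C, hC⟩ := f.2.2.1
  have hd := dominated_mul (n := 1) (K := tsupport f.1) (C := C)
    (f := fun t => ((f.1 (t 0) : ℝ) : ℂ))
    (Complex.measurable_ofReal.comp (f.2.1.comp (measurable_pi_apply 0)))
    (fun t => by simpa using hC (t 0))
    (fun t ht => by
      obtain ⟨i, hi⟩ := ht
      have h0 : i = 0 := Subsingleton.elim _ _
      rw [h0] at hi
      simp [image_eq_zero_of_notMem_tsupport hi]) hγ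
  exact hd.memLp_iter Q lam (isClosed_tsupport _).measurableSet
    f.2.2.2.isCompact.measure_lt_top (sqIntegrable_mul C hγ hγ2) m

/-- The link between the two pictures: the three summands of `step` symmetrize to the three parts of
`field`, because each part ignores whether its argument has been symmetrized beforehand. -/
theorem symmetrize_step (f : B0 ℝ T) {γ : Graded T} (hγ : ∀ m, Measurable (γ m))
    (hγ2 : ∀ m, MemLp (γ m) 2 (Measure.pi fun _ => σ)) {F : FockFin Q}
    (hF : ∀ m, F m = symmetrize Q m (γ m)) (m : ℕ) :
    symmetrize Q m (step Q lam (fun u m s => ((f.1 u : ℝ) : ℂ) * γ m s) m) =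
      field Q lam f F m := by
  have hh := memLp_two (σ := σ) f
  obtain ⟨hc, hc'⟩ : ∃ hc : MemLp (creationStep (fun u m s => ((f.1 u : ℝ) : ℂ) * γ m s) m) 2
      (Measure.pi fun _ => σ), P Q m (hc.toLp _) = creation Q (hh.toLp _) F m := by
    cases m with
    | zero =>
      have h0 : creationStep (fun u m s => ((f.1 u : ℝ) : ℂ) * γ m s) 0 = fun _ => 0 := rfl
      have hc : MemLp (creationStep (fun u m s => ((f.1 u : ℝ) : ℂ) * γ m s) 0) 2
          (Measure.pi fun _ => σ) := by rw [h0]; exact MemLp.zero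
      refine ⟨hc, ?_⟩
      rw [creation_apply_zero, ← symmetrize_of_memLp hc, h0, symmetrize_zero]
    | succ m =>
      have hae : creationStep (fun u m s => ((f.1 u : ℝ) : ℂ) * γ m s) (m + 1)
          =ᵐ[Measure.pi fun _ => σ] tensorLeft σ (hh.toLp _) m ((hγ2 m).toLp _) := by
        refine EventuallyEq.trans ?_ (coeFn_tensorLeft σ _ _).symm
        have h1 := (Measure.quasiMeasurePreserving_fst.comp
          (measurePreserving_headTail σ m).quasiMeasurePreserving).ae_eq_comp hh.coeFn_toLp
        have h2 := (quasi_tail σ m).ae_eq_comp (hγ2 m).coeFn_toLp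
        filter_upwards [h1, h2] with t h1 h2
        simp only [Function.comp_apply] at h1 h2
        rw [h1, h2]
        rfl
      have hc := (memLp_congr_ae hae).2 (Lp.memLp _)
      refine ⟨hc, ?_⟩
      rw [creation_apply_succ, hF m, symmetrize_of_memLp (hγ2 m), creationComp_P]
      congr 1
      exact Lp.ext (hc.coeFn_toLp.trans hae)
  obtain ⟨hn, hn'⟩ : ∃ hn : MemLp (fun s => (lam : ℂ) * ∑ i, ((f.1 (s i) : ℝ) : ℂ) * γ m s) 2
      (Measure.pi fun _ => σ), P Q m (hn.toLp _) = (lam : ℂ) • neutral Q f F m := by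
    have hae : (fun s => (lam : ℂ) * ∑ i, ((f.1 (s i) : ℝ) : ℂ) * γ m s)
        =ᵐ[Measure.pi fun _ => σ]
        ((lam : ℂ) • mulOp _ (memLp_sum_eval f m) ((hγ2 m).toLp _) : L2n σ m) := by
      filter_upwards [Lp.coeFn_smul (lam : ℂ) (mulOp _ (memLp_sum_eval f m) ((hγ2 m).toLp _)),
        coeFn_mulOp _ (memLp_sum_eval f m) ((hγ2 m).toLp _), (hγ2 m).coeFn_toLp] with s h1 h2 h3
      rw [h1, Pi.smul_apply, h2, h3, Finset.sum_mul, smul_eq_mul]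
    have hn := (memLp_congr_ae hae).2 (Lp.memLp _)
    refine ⟨hn, ?_⟩
    rw [neutral_apply, hF m, symmetrize_of_memLp (hγ2 m), P_mulOp_P, ← map_smul]
    congr 1
    exact Lp.ext (hn.coeFn_toLp.trans hae)
  -- Obtained by subtraction: the whole step is square integrable, and so are its creation and
  -- neutral parts.
  have ha : MemLp (annFun Q (fun u => ((f.1 u : ℝ) : ℂ)) (γ (m + 1))) 2
      (Measure.pi fun _ => σ) := by
    have h := ((memLp_step Q lam f hγ hγ2 m).sub hc).sub hn
    refine (memLp_congr_ae (ae_of_all _ fun s => ?_)).1 h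
    simp only [Pi.sub_apply, step, annFun]
    ring
  have ha' := adjoint_creationComp_P Q hh (fun u => by simp) (hγ2 (m + 1)) ha
  have hsum : step Q lam (fun u m s => ((f.1 u : ℝ) : ℂ) * γ m s) m =
      (creationStep (fun u m s => ((f.1 u : ℝ) : ℂ) * γ m s) m +
        fun s => (lam : ℂ) * ∑ i, ((f.1 (s i) : ℝ) : ℂ) * γ m s) +
      annFun Q (fun u => ((f.1 u : ℝ) : ℂ)) (γ (m + 1)) := rfl
  rw [hsum, symmetrize_of_memLp ((hc.add hn).add ha), MemLp.toLp_add (hc.add hn) ha,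
    MemLp.toLp_add hc hn, map_add, map_add, hc', hn', ← ha', ← symmetrize_of_memLp, ← hF,
    ← annihilation_apply]
  rfl

end FieldAction

/-! ### Construction of the monomials for general test functions. -/

section Wick

variable {T : Type*} [TopologicalSpace T] [T2Space T]

omit [T2Space T] in
theorem exists_isCompact_box {n : ℕ} {S : Set (Fin n → T)} (hS : IsCompact S) :
    ∃ K : Set T, IsCompact K ∧ ∀ t ∈ S, ∀ i, t i ∈ K :=
  ⟨⋃ i, (fun t : Fin n → T => t i) '' S,
    isCompact_iUnion fun i => hS.image (continuous_apply i),
    fun t ht i => Set.mem_iUnion.2 ⟨i, t, ht, rfl⟩⟩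

omit [TopologicalSpace T] [T2Space T] in
theorem eq_zero_of_notMem_box {n : ℕ} {S : Set (Fin n → T)} {K : Set T}
    (hK : ∀ t ∈ S, ∀ i, t i ∈ K) {f : (Fin n → T) → ℂ} (hf : Function.support f ⊆ S)
    (t : Fin n → T) (ht : ∃ i, t i ∉ K) : f t = 0 := by
  by_contra h
  obtain ⟨i, hi⟩ := ht
  exact hi (hK t (hf h) i)

variable [MeasurableSpace T] [OpensMeasurableSpace T] {σ : Measure T} [SigmaFinite σ]
  [IsFiniteMeasureOnCompacts σ] {Q : Kernel σ}

/-- A vector of the Fock space as a graded function. -/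
noncomputable def toGraded (F : FockFin Q) : Graded T := fun m =>
  ((F m : L2n σ m) : (Fin m → T) → ℂ)

omit [TopologicalSpace T] [T2Space T] [OpensMeasurableSpace T] [IsFiniteMeasureOnCompacts σ] in
theorem measurable_toGraded (F : FockFin Q) (m : ℕ) : Measurable (toGraded F m) :=
  (Lp.stronglyMeasurable _).measurable

omit [TopologicalSpace T] [T2Space T] [OpensMeasurableSpace T] [IsFiniteMeasureOnCompacts σ] in
theorem memLp_toGraded (F : FockFin Q) (m : ℕ) :
    MemLp (toGraded F m) 2 (Measure.pi fun _ => σ) := Lp.memLp _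

variable (Q) in
/-- The `m`-th component of `⟨f, ω^{⊗n}⟩ F`. -/
noncomputable def wickComp (lam : ℝ) {n : ℕ} (f : (Fin n → T) → ℂ) (F : FockFin Q) (m : ℕ) :
    Hsym Q m :=
  symmetrize Q m (iter Q lam n (fun t m s => f t * toGraded F m s) m)

omit [SigmaFinite σ] in
theorem exists_dominated {n : ℕ} (f : B0 ℂ (Fin n → T)) :
    ∃ (K : Set T) (C : ℝ), MeasurableSet K ∧ σ K < ∞ ∧ ∀ γ : Graded T, (∀ m, Measurable (γ m)) →
      Dominated K (fun m s => ENNReal.ofReal C * ‖γ m s‖ₑ) (fun t m s => f.1 t * γ m s) := by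
  obtain ⟨C, hC⟩ := f.2.2.1
  obtain ⟨K, hK, hK'⟩ := exists_isCompact_box f.2.2.2.isCompact
  exact ⟨K, C, hK.isClosed.measurableSet, hK.measure_lt_top, fun γ hγ =>
    dominated_mul f.2.1 hC (eq_zero_of_notMem_box hK' (subset_tsupport _)) hγ⟩

variable (lam : ℝ) {n : ℕ}

theorem memLp_iter_mul (f : B0 ℂ (Fin n → T)) {γ : Graded T} (hγ : ∀ m, Measurable (γ m))
    (hγ2 : ∀ m, MemLp (γ m) 2 (Measure.pi fun _ => σ)) (m : ℕ) :
    MemLp (iter Q lam n (fun t m s => f.1 t * γ m s) m) 2 (Measure.pi fun _ => σ) := by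
  obtain ⟨K, C, hK, hKσ, h⟩ := exists_dominated (σ := σ) f
  exact (h γ hγ).memLp_iter Q lam hK hKσ (sqIntegrable_mul C hγ hγ2) m

-- Since `n` steps raise the degree by at most `n`, a finite vector yields a finite vector.
omit [T2Space T] [IsFiniteMeasureOnCompacts σ] [OpensMeasurableSpace T] [TopologicalSpace T] in
theorem wickComp_eq_zero (f : (Fin n → T) → ℂ) {F : FockFin Q} {N m : ℕ}
    (hF : ∀ m', N ≤ m' → F m' = 0) (hm : N + n ≤ m) : wickComp Q lam f F m = 0 := by
  rw [wickComp, ← symmetrize_zero]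
  refine symmetrize_congr ?_
  -- On the components that matter `F` vanishes, so `f` may be replaced by 0, and this scalar is
  -- then pulled out of `iter`.
  have h1 : iter Q lam n (fun t m s => f t * toGraded F m s) m =ᵐ[Measure.pi fun _ => σ]
      iter Q lam n (fun t m s => 0 * toGraded F m s) m := by
    refine iter_congr Q lam fun m' hm' => ?_
    have h0 : toGraded F m' =ᵐ[Measure.pi fun _ => σ] 0 := by
      unfold toGraded
      rw [hF m' (by omega)]
      exact Lp.coeFn_zero _ _ _
    filter_upwards [h0] with s hs t
    rw [hs]
    simp
  refine h1.trans ?_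
  rw [iter_const_mul Q lam 0 (fun _ => toGraded F)]
  exact ae_of_all _ fun s => zero_mul _

theorem wickComp_linear_right (f : B0 ℂ (Fin n → T)) (F G : FockFin Q) (a b : ℂ) (m : ℕ) :
    wickComp Q lam f.1 (a • F + b • G) m =
      a • wickComp Q lam f.1 F m + b • wickComp Q lam f.1 G m := by
  obtain ⟨K, C, hK, hKσ, h⟩ := exists_dominated (σ := σ) f
  unfold wickComp
  rw [← symmetrize_linear (memLp_iter_mul lam f (measurable_toGraded F) (memLp_toGraded F) m)
    (memLp_iter_mul lam f (measurable_toGraded G) (memLp_toGraded G) m)]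
  refine symmetrize_congr (EventuallyEq.trans ?_ (iter_linear Q lam hK hKσ hK hKσ
    (sqIntegrable_mul C (measurable_toGraded F) (memLp_toGraded F))
    (sqIntegrable_mul C (measurable_toGraded G) (memLp_toGraded G))
    (h _ (measurable_toGraded F)) (h _ (measurable_toGraded G)) a b m))
  refine iter_congr Q lam fun m' _ => ?_
  have h1 : toGraded (a • F + b • G) m' =ᵐ[Measure.pi fun _ => σ]
      fun s => a * toGraded F m' s + b * toGraded G m' s := by
    have h2 : (((a • F + b • G : FockFin Q) m' : Hsym Q m') : L2n σ m') =
      a • (F m' : L2n σ m') + b • (G m' : L2n σ m') := rfl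
    unfold toGraded
    rw [h2]
    filter_upwards [Lp.coeFn_add (a • (F m' : L2n σ m')) (b • (G m' : L2n σ m')),
      Lp.coeFn_smul a (F m' : L2n σ m'), Lp.coeFn_smul b (G m' : L2n σ m')] with s h3 h4 h5
    rw [h3, Pi.add_apply, h4, h5]
    rfl
  filter_upwards [h1] with s hs t
  rw [hs]
  ring

theorem wickComp_linear_left (f g : B0 ℂ (Fin n → T)) (F : FockFin Q) (a b : ℂ) (m : ℕ) :
    wickComp Q lam (a • f + b • g).1 F m =
      a • wickComp Q lam f.1 F m + b • wickComp Q lam g.1 F m := by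
  obtain ⟨K, C, hK, hKσ, h⟩ := exists_dominated (σ := σ) f
  obtain ⟨K', C', hK', hKσ', h'⟩ := exists_dominated (σ := σ) g
  unfold wickComp
  rw [← symmetrize_linear (memLp_iter_mul lam f (measurable_toGraded F) (memLp_toGraded F) m)
    (memLp_iter_mul lam g (measurable_toGraded F) (memLp_toGraded F) m)]
  refine symmetrize_congr (EventuallyEq.trans (EventuallyEq.of_eq ?_)
    (iter_linear Q lam hK hKσ hK' hKσ'
    (sqIntegrable_mul C (measurable_toGraded F) (memLp_toGraded F))
    (sqIntegrable_mul C' (measurable_toGraded F) (memLp_toGraded F))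
    (h _ (measurable_toGraded F)) (h' _ (measurable_toGraded F)) a b m))
  congr 1
  funext t m s
  have h2 : (a • f + b • g : B0 ℂ (Fin n → T)).1 t = a * f.1 t + b * g.1 t := rfl
  rw [h2]
  ring

omit [TopologicalSpace T] [T2Space T] [OpensMeasurableSpace T] [IsFiniteMeasureOnCompacts σ] in
theorem exists_component_bound (F : FockFin Q) : ∃ N, ∀ m, N ≤ m → F m = 0 := by
  classical
  refine ⟨(DFinsupp.support F).sup id + 1, fun m hm => ?_⟩
  by_contra h
  have := Finset.le_sup (f := id) (DFinsupp.mem_support_iff.2 h)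
  simp only [id] at this
  omega

variable (Q) in
/-- The vector `⟨f, ω^{⊗n}⟩ F`. -/
noncomputable def wickVec (f : (Fin n → T) → ℂ) (F : FockFin Q) : FockFin Q :=
  ∑ m ∈ Finset.range ((exists_component_bound F).choose + n),
    DirectSum.of (fun m => Hsym Q m) m (wickComp Q lam f F m)

omit [T2Space T] [IsFiniteMeasureOnCompacts σ] [OpensMeasurableSpace T] [TopologicalSpace T] in
theorem wickVec_apply (f : (Fin n → T) → ℂ) (F : FockFin Q) (m : ℕ) :
    wickVec Q lam f F m = wickComp Q lam f F m := by
  unfold wickVec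
  rw [DFinsupp.finsetSum_apply]
  by_cases hm : m < (exists_component_bound F).choose + n
  · rw [Finset.sum_eq_single m]
    · exact DirectSum.of_eq_same _ _
    · intro k _ hk
      exact DirectSum.of_eq_of_ne _ _ _ hk.symm
    · intro h
      exact absurd (Finset.mem_range.2 hm) h
  · rw [wickComp_eq_zero lam f (exists_component_bound F).choose_spec (by omega)]
    refine Finset.sum_eq_zero fun k hk => DirectSum.of_eq_of_ne _ _ _ ?_
    rw [Finset.mem_range] at hk
    omega

variable (Q n) in
/-- The map `f ↦ ⟨f, ω^{⊗n}⟩`. -/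
noncomputable def wick : B0 ℂ (Fin n → T) →ₗ[ℂ] Module.End ℂ (FockFin Q) where
  toFun f :=
    { toFun := wickVec Q lam f.1
      map_add' := fun F G => DFinsupp.ext fun m => by
        have := wickComp_linear_right lam f F G 1 1 m
        rw [one_smul, one_smul, one_smul, one_smul] at this
        rw [DFinsupp.add_apply]
        simp only [wickVec_apply, this]
      map_smul' := fun c F => DFinsupp.ext fun m => by
        have := wickComp_linear_right lam f F 0 c 0 m
        rw [zero_smul, zero_smul, add_zero, add_zero] at this
        rw [RingHom.id_apply, DFinsupp.smul_apply]
        simp only [wickVec_apply, this] }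
  map_add' f g := LinearMap.ext fun F => DFinsupp.ext fun m => by
    have := wickComp_linear_left lam f g F 1 1 m
    rw [one_smul, one_smul, one_smul, one_smul] at this
    rw [LinearMap.add_apply, DFinsupp.add_apply]
    simp only [LinearMap.coe_mk, AddHom.coe_mk, wickVec_apply, this]
  map_smul' c f := LinearMap.ext fun F => DFinsupp.ext fun m => by
    have := wickComp_linear_left lam f 0 F c 0 m
    rw [zero_smul, zero_smul, add_zero, add_zero] at this
    rw [RingHom.id_apply, LinearMap.smul_apply, DFinsupp.smul_apply]
    simp only [LinearMap.coe_mk, AddHom.coe_mk, wickVec_apply, this]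

theorem wick_apply (f : B0 ℂ (Fin n → T)) (F : FockFin Q) (m : ℕ) :
    wick Q lam n f F m = wickComp Q lam f.1 F m :=
  wickVec_apply lam f.1 F m

omit [OpensMeasurableSpace T] in
theorem tensorB0_cons {n : ℕ} (f : Fin (n + 1) → B0 ℝ T) (u : T) (t : Fin n → T) :
    (tensorB0 f).1 (Fin.cons u t) =
      (((f 0).1 u : ℝ) : ℂ) * (tensorB0 fun i => f i.succ).1 t := by
  simp only [tensorB0, Fin.prod_univ_succ, Fin.cons_zero, Fin.cons_succ]

/-- Induction on the leftmost factor, which acts last. For a product test function, the value of the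
first factor is a scalar for the remaining iteration, so the outermost step has the form treated in
`symmetrize_step`. -/
theorem wickComp_tensor (f : Fin n → B0 ℝ T) (F : FockFin Q) (m : ℕ) :
    wickComp Q lam (tensorB0 f).1 F m = (List.ofFn fun i => field Q lam (f i)).prod F m := by
  induction n generalizing m with
  | zero =>
    have : iter Q lam 0 (fun t m s => (tensorB0 f).1 t * toGraded F m s) m = toGraded F m := by
      funext s
      simp [iter, tensorB0]
    rw [wickComp, this]
    rw [List.ofFn_zero, List.prod_nil]
    exact symmetrize_coeFn (F m)
  | succ n ih =>
    rw [List.ofFn_succ, List.prod_cons, Module.End.mul_apply]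
    have hm := measurable_toGraded F
    have hL := memLp_toGraded F
    obtain ⟨K, C, hK, hKσ, h⟩ := exists_dominated (σ := σ) (tensorB0 fun i => f i.succ)
    rw [← symmetrize_step Q lam (f 0)
      (γ := iter Q lam n fun t m s => (tensorB0 fun i => f i.succ).1 t * toGraded F m s)
      (fun m => ((h _ hm).iter hK m).2) (memLp_iter_mul lam _ hm hL)
      (fun m => (ih (fun i => f i.succ) m).symm) m]
    rw [wickComp, iter_succ_eq_step]
    simp only [tensorB0_cons, mul_assoc]
    simp only [fun u => iter_const_mul Q lam (((f 0).1 u : ℝ) : ℂ)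
      (fun t m s => (tensorB0 fun i => f i.succ).1 t * toGraded F m s)]

theorem wick_tensor (f : Fin n → B0 ℝ T) :
    wick Q lam n (tensorB0 f) = (List.ofFn fun i => field Q lam (f i)).prod :=
  LinearMap.ext fun F => DFinsupp.ext fun m =>
    (wick_apply lam _ F m).trans (wickComp_tensor lam f F m)

/-- Component `m` is bounded by finitely many components of `F`, with a constant independent of `F`.
Componentwise convergence is therefore preserved. -/
theorem exists_norm_wickComp_le (f : B0 ℂ (Fin n → T)) (m : ℕ) :
    ∃ C : ℝ, ∀ F : FockFin Q,
      ‖wickComp Q lam f.1 F m‖ ≤ C * ∑ m' ∈ Finset.range (m + n + 1), ‖F m'‖ := by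
  obtain ⟨K, C, hK, hKσ, h⟩ := exists_dominated (σ := σ) f
  obtain ⟨D, hD, hD'⟩ := exists_eLpNorm_iterate_absStep_le (σ := σ) lam hK hKσ n m
  refine ⟨(D * ENNReal.ofReal C).toReal, fun F => ?_⟩
  have hm := measurable_toGraded F
  have hL := memLp_toGraded F
  have hmem := memLp_iter_mul (Q := Q) lam f hm hL m
  rw [wickComp, symmetrize_of_memLp hmem]
  have h1 : ‖P Q m (hmem.toLp _)‖ ≤ ‖hmem.toLp _‖ := by
    refine ((P Q m).le_opNorm _).trans ?_
    refine mul_le_of_le_one_left (norm_nonneg _) ?_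
    exact Submodule.orthogonalProjectionOnto_norm_le _
  refine h1.trans ?_
  rw [Lp.norm_toLp]
  have h2 : eLpNorm (iter Q lam n (fun t m s => f.1 t * toGraded F m s) m) 2
      (Measure.pi fun _ => σ) ≤ D * ENNReal.ofReal C *
        ∑ m' ∈ Finset.range (m + n + 1), eLpNorm (toGraded F m') 2 (Measure.pi fun _ => σ) := by
    refine (eLpNorm_mono_enorm fun s => ?_).trans ((hD' _ (sqIntegrable_mul C hm hL).meas).trans
      (le_of_eq ?_))
    · simpa using ((h _ hm).iter (Q := Q) (lam := lam) hK m).1 s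
    · unfold normSum
      rw [mul_assoc]
      congr 1
      rw [Finset.mul_sum]
      exact Finset.sum_congr rfl fun m' _ => eLpNorm_ofReal_mul_enorm C (hm m')
  have hfin : D * ENNReal.ofReal C *
      ∑ m' ∈ Finset.range (m + n + 1), eLpNorm (toGraded F m') 2 (Measure.pi fun _ => σ) ≠ ∞ :=
    (ENNReal.mul_lt_top (ENNReal.mul_lt_top hD ENNReal.ofReal_lt_top)
      (ENNReal.sum_lt_top.2 fun i _ => (hL i).2)).ne
  refine (ENNReal.toReal_mono hfin h2).trans (le_of_eq ?_)
  rw [ENNReal.toReal_mul, ENNReal.toReal_sum fun i _ => (hL i).2.ne]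
  rfl

theorem isContinuousOp_wick (f : B0 ℂ (Fin n → T)) : IsContinuousOp Q (wick Q lam n f) := by
  rintro u F ⟨⟨N, hN⟩, hu⟩
  refine ⟨⟨N + 1 + n, fun k m hm => ?_⟩, fun m => ?_⟩
  · rw [wick_apply]
    exact wickComp_eq_zero lam f.1 (N := N + 1) (fun m' hm' => hN k m' hm') hm.le
  · obtain ⟨C, hC⟩ := exists_norm_wickComp_le (Q := Q) lam f m
    rw [tendsto_iff_norm_sub_tendsto_zero]
    have h1 : ∀ k, ‖wick Q lam n f (u k) m - wick Q lam n f F m‖ ≤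
        C * ∑ m' ∈ Finset.range (m + n + 1), ‖u k m' - F m'‖ := by
      intro k
      have h2 : wick Q lam n f (u k) m - wick Q lam n f F m = wick Q lam n f (u k - F) m := by
        rw [map_sub]; rfl
      rw [h2, wick_apply]
      exact hC (u k - F)
    refine squeeze_zero (fun k => norm_nonneg _) h1 ?_
    have h3 : Tendsto (fun k => C * ∑ m' ∈ Finset.range (m + n + 1), ‖u k m' - F m'‖) atTop
        (𝓝 (C * ∑ _m' ∈ Finset.range (m + n + 1), 0)) :=
      (tendsto_finsetSum _ fun m' _ => tendsto_iff_norm_sub_tendsto_zero.1 (hu m')).const_mul C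
    simpa using h3

theorem tendsto_wick (g : ℕ → B0 ℂ (Fin n → T)) (f : B0 ℂ (Fin n → T))
    (hK : ∃ K : Set (Fin n → T), IsCompact K ∧ ∀ k, Function.support (g k).1 ⊆ K)
    (hC : ∃ C : ℝ, ∀ k t, ‖(g k).1 t‖ ≤ C)
    (hg : ∀ t, Tendsto (fun k => (g k).1 t) atTop (𝓝 (f.1 t))) (F : FockFin Q) :
    FockTendsto Q (fun k => wick Q lam n (g k) F) (wick Q lam n f F) := by
  obtain ⟨S, hS, hgS⟩ := hK
  obtain ⟨C, hC⟩ := hC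
  obtain ⟨K, hK, hSK⟩ := exists_isCompact_box hS
  obtain ⟨N, hN⟩ := exists_component_bound F
  have hm := measurable_toGraded F
  have hL := memLp_toGraded F
  refine ⟨⟨N + n, fun k m hm => ?_⟩, fun m => ?_⟩
  · rw [wick_apply]
    exact wickComp_eq_zero lam _ hN hm.le
  · have hd : ∀ k, Dominated K (fun m s => ENNReal.ofReal C * ‖toGraded F m s‖ₑ)
        (fun t m s => (g k).1 t * toGraded F m s) := fun k =>
      dominated_mul (g k).2.1 (hC k) (eq_zero_of_notMem_box hSK (hgS k)) hm
    have hKm := hK.isClosed.measurableSet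
    have hs := sqIntegrable_mul (σ := σ) C hm hL
    have hae := iter_tendsto Q lam hKm hK.measure_lt_top hs
      (G' := fun t m s => f.1 t * toGraded F m s) hd
      (fun m => ae_of_all _ fun s t => (hg t).mul_const _) m
    have ht := tendsto_toLp_of_dominated
      (fun k => memLp_iter_mul (Q := Q) lam (g k) hm hL m)
      (memLp_iter_mul (Q := Q) lam f hm hL m)
      ((hs.iterate (lam := lam) hKm hK.measure_lt_top n).lt_top m)
      (fun k s => ((hd k).iter (Q := Q) (lam := lam) hKm m).1 s) hae
    have := ((P Q m).continuous.tendsto _).comp ht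
    simp only [wick_apply, wickComp]
    rw [symmetrize_of_memLp (memLp_iter_mul (Q := Q) lam f hm hL m)]
    refine this.congr fun k => ?_
    rw [symmetrize_of_memLp (memLp_iter_mul (Q := Q) lam (g k) hm hL m)]
    rfl

theorem isMonomialMap_wick : IsMonomialMap Q lam n (wick Q lam n) where
  continuousOp := isContinuousOp_wick lam
  tensor := wick_tensor lam
  continuous := tendsto_wick lam

end Wick

/-! ### Uniqueness of the extension by linearity and continuity. -/

section Uniqueness

variable {T : Type*} [TopologicalSpace T] [T2Space T]
  [MeasurableSpace T] [OpensMeasurableSpace T] {σ : Measure T} [SigmaFinite σ]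
  [IsFiniteMeasureOnCompacts σ] {Q : Kernel σ}

omit [TopologicalSpace T] [T2Space T] [OpensMeasurableSpace T] [IsFiniteMeasureOnCompacts σ] in
theorem FockTendsto.unique {u : ℕ → FockFin Q} {F G : FockFin Q} (hF : FockTendsto Q u F)
    (hG : FockTendsto Q u G) : F = G :=
  DFinsupp.ext fun m => tendsto_nhds_unique (hF.2 m) (hG.2 m)

theorem measurableSet_box (n : ℕ) {K : Set T} (hK : IsCompact K) :
    MeasurableSet (Set.univ.pi fun _ : Fin n => K) :=
  MeasurableSet.univ_pi fun _ => hK.isClosed.measurableSet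

/-- The restriction of a bounded measurable function to a compact box. -/
noncomputable def restrictBox {n : ℕ} {K : Set T} (hK : IsCompact K) {s : (Fin n → T) → ℂ}
    (hs : Measurable s) (hb : ∃ C : ℝ, ∀ t, ‖s t‖ ≤ C) : B0 ℂ (Fin n → T) :=
  ⟨(Set.univ.pi fun _ => K).indicator s, hs.indicator (measurableSet_box n hK), by
    obtain ⟨C, hC⟩ := hb
    exact ⟨C, fun t => (norm_indicator_le_norm_self _ _).trans (hC t)⟩,
    HasCompactSupport.intro (isCompact_univ_pi fun _ => hK) fun t ht => by
      rw [Set.indicator_of_notMem ht]⟩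

variable {lam : ℝ} {n : ℕ} {W W' : B0 ℂ (Fin n → T) →ₗ[ℂ] Module.End ℂ (FockFin Q)}

theorem IsMonomialMap.eq_of_tendsto (hW : IsMonomialMap Q lam n W) (hW' : IsMonomialMap Q lam n W')
    {K : Set T} (hK : IsCompact K) {g : ℕ → B0 ℂ (Fin n → T)} {f : B0 ℂ (Fin n → T)}
    (hgK : ∀ k, Function.support (g k).1 ⊆ Set.univ.pi fun _ => K)
    (hC : ∃ C : ℝ, ∀ k t, ‖(g k).1 t‖ ≤ C)
    (hg : ∀ t, Tendsto (fun k => (g k).1 t) atTop (𝓝 (f.1 t)))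
    (h : ∀ k, W (g k) = W' (g k)) : W f = W' f := by
  refine LinearMap.ext fun F => ?_
  have h1 := hW.continuous g f ⟨_, isCompact_univ_pi fun _ => hK, hgK⟩ hC hg F
  have h2 := hW'.continuous g f ⟨_, isCompact_univ_pi fun _ => hK, hgK⟩ hC hg F
  simp only [h] at h1
  exact h1.unique h2

/-- On a measurable rectangle, cut down to the box, the indicator is a tensor product of test
functions, so both maps agree there. The π-λ theorem extends this to all measurable sets.
Restriction to a fixed box keeps every function compactly supported. -/
theorem IsMonomialMap.eq_indicator (hW : IsMonomialMap Q lam n W)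
    (hW' : IsMonomialMap Q lam n W') {K : Set T} (hK : IsCompact K) {E : Set (Fin n → T)}
    (hE : MeasurableSet E) (g : B0 ℂ (Fin n → T))
    (hg : g.1 = (Set.univ.pi fun _ => K).indicator (E.indicator 1)) : W g = W' g := by
  have hone : ∀ E : Set (Fin n → T), ∃ C : ℝ, ∀ t, ‖E.indicator (1 : (Fin n → T) → ℂ) t‖ ≤ C :=
    fun E => ⟨1, fun t => by
      by_cases ht : t ∈ E <;> simp [ht]⟩
  have hrect : ∀ (s : Fin n → Set T), (∀ i, MeasurableSet (s i)) → ∀ g : B0 ℂ (Fin n → T),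
      g.1 = (Set.univ.pi fun _ => K).indicator ((Set.univ.pi s).indicator 1) → W g = W' g := by
    intro s hs g hg
    let e : Fin n → B0 ℝ T := fun i =>
      ⟨(s i ∩ K).indicator 1, measurable_const.indicator ((hs i).inter hK.isClosed.measurableSet),
        ⟨1, fun t => by by_cases ht : t ∈ s i ∩ K <;> simp [ht]⟩,
        HasCompactSupport.intro hK fun t ht => Set.indicator_of_notMem (fun h => ht h.2) _⟩
    have he : g = tensorB0 e := by
      refine Subtype.ext (hg.trans (funext fun t => ?_))
      simp only [tensorB0, e]
      by_cases ht : ∀ i, t i ∈ s i ∩ K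
      · have h1 : t ∈ Set.univ.pi s := fun i _ => (ht i).1
        have h2 : t ∈ Set.univ.pi fun _ : Fin n => K := fun i _ => (ht i).2
        rw [Set.indicator_of_mem h2, Set.indicator_of_mem h1]
        simp [ht]
      · rw [Set.indicator_indicator, Set.indicator_of_notMem]
        · obtain ⟨i, hi⟩ := not_forall.1 ht
          refine (Finset.prod_eq_zero (Finset.mem_univ i) ?_).symm
          rw [Set.indicator_of_notMem hi, Complex.ofReal_zero]
        · exact fun h => ht fun i => ⟨h.2 i (Set.mem_univ i), h.1 i (Set.mem_univ i)⟩
    rw [he, hW.tensor, hW'.tensor]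
  refine MeasurableSpace.induction_on_inter (C := fun E _ => ∀ g : B0 ℂ (Fin n → T),
    g.1 = (Set.univ.pi fun _ => K).indicator (E.indicator 1) → W g = W' g)
    generateFrom_pi.symm isPiSystem_pi ?_ ?_ ?_ ?_ E hE g hg
  · intro g hg
    have : g = 0 := Subtype.ext (hg.trans (by
      rw [Set.indicator_empty]; exact Set.indicator_zero' _))
    rw [this, map_zero, map_zero]
  · rintro E ⟨s, hs, rfl⟩ g hg
    exact hrect s (fun i => hs i (Set.mem_univ i)) g hg
  · intro E hE ih g hg
    have h1 := hrect (fun _ => Set.univ) (fun _ => MeasurableSet.univ)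
      (restrictBox hK (measurable_const.indicator MeasurableSet.univ) (hone Set.univ))
      (by rw [Set.pi_univ]; rfl)
    have h2 := ih (restrictBox hK (measurable_const.indicator hE) (hone E)) rfl
    have h3 : g = restrictBox hK (measurable_const.indicator MeasurableSet.univ) (hone Set.univ) -
        restrictBox hK (measurable_const.indicator hE) (hone E) := by
      refine Subtype.ext (hg.trans (funext fun t => ?_))
      change _ = (Set.univ.pi fun _ => K).indicator
        (Set.univ.indicator (1 : (Fin n → T) → ℂ)) t -
        (Set.univ.pi fun _ => K).indicator (E.indicator (1 : (Fin n → T) → ℂ)) t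
      by_cases h1 : t ∈ Set.univ.pi fun _ : Fin n => K
      · rw [Set.indicator_of_mem h1, Set.indicator_of_mem h1, Set.indicator_of_mem h1]
        by_cases h2 : t ∈ E <;> simp [h2]
      · rw [Set.indicator_of_notMem h1, Set.indicator_of_notMem h1, Set.indicator_of_notMem h1,
          sub_zero]
    rw [h3, map_sub, map_sub, h1, h2]
  -- Partial sums of the indicators are indicators of finite unions, bounded by 1 on a common box.
  -- Continuity applies to their pointwise limit.
  · intro E hd hE ih g hg
    have hval : ∀ k t, (∑ j ∈ Finset.range k,
        restrictBox hK (measurable_const.indicator (hE j)) (hone (E j)) : B0 ℂ (Fin n → T)).1 t =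
        (Set.univ.pi fun _ => K).indicator
          ((⋃ j ∈ Finset.range k, E j).indicator (1 : (Fin n → T) → ℂ)) t := by
      intro k t
      rw [Finset.indicator_biUnion _ _ fun i _ j _ hij => hd hij]
      have h1 : (∑ j ∈ Finset.range k, restrictBox hK (measurable_const.indicator (hE j))
          (hone (E j)) : B0 ℂ (Fin n → T)).1 t = ∑ j ∈ Finset.range k,
          (Set.univ.pi fun _ => K).indicator ((E j).indicator (1 : (Fin n → T) → ℂ)) t := by
        have := Submodule.coe_sum (B0 ℂ (Fin n → T)) (fun j => restrictBox hK
          (measurable_const.indicator (hE j)) (hone (E j))) (Finset.range k)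
        rw [this, Finset.sum_apply]
        rfl
      rw [h1]
      by_cases h2 : t ∈ Set.univ.pi fun _ : Fin n => K
      · simp only [Set.indicator_of_mem h2]
      · simp only [Set.indicator_of_notMem h2, Finset.sum_const_zero]
    refine hW.eq_of_tendsto hW' hK (g := fun k => ∑ j ∈ Finset.range k,
      restrictBox hK (measurable_const.indicator (hE j)) (hone (E j))) ?_ ?_ ?_ ?_
    · intro k t ht
      rw [Function.mem_support, hval] at ht
      exact Set.mem_of_indicator_ne_zero ht
    · refine ⟨1, fun k t => ?_⟩
      rw [hval]
      refine (norm_indicator_le_norm_self _ _).trans ?_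
      by_cases ht : t ∈ ⋃ j ∈ Finset.range k, E j
      · rw [Set.indicator_of_mem ht]; simp
      · rw [Set.indicator_of_notMem ht]; simp
    · intro t
      simp only [hval, hg]
      by_cases h2 : t ∈ Set.univ.pi fun _ : Fin n => K
      · simp only [Set.indicator_of_mem h2]
        exact ((tendsto_indicator_biUnion_finset E (1 : (Fin n → T) → ℂ) t).comp
          tendsto_finset_range).mono_right (pure_le_nhds _)
      · simp only [Set.indicator_of_notMem h2]
        exact tendsto_const_nhds
    · intro k
      rw [map_sum, map_sum]
      exact Finset.sum_congr rfl fun j _ => ih j _ rfl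

theorem IsMonomialMap.unique (hW : IsMonomialMap Q lam n W) (hW' : IsMonomialMap Q lam n W') :
    W = W' := by
  refine LinearMap.ext fun f => ?_
  obtain ⟨K, hK, hfK⟩ := exists_isCompact_box f.2.2.2.isCompact
  have hsimple : ∀ s : SimpleFunc (Fin n → T) ℂ, ∀ g : B0 ℂ (Fin n → T),
      g.1 = (Set.univ.pi fun _ => K).indicator s → W g = W' g := by
    intro s
    induction s using SimpleFunc.induction with
    | const c hE =>
      rename_i E
      intro g hg
      have hone : ∃ C : ℝ, ∀ t, ‖E.indicator (1 : (Fin n → T) → ℂ) t‖ ≤ C :=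
        ⟨1, fun t => by by_cases ht : t ∈ E <;> simp [ht]⟩
      have h1 := hW.eq_indicator hW' hK hE (restrictBox hK (measurable_const.indicator hE) hone) rfl
      have h2 : g = c • restrictBox hK (measurable_const.indicator hE) hone := by
        refine Subtype.ext (hg.trans (funext fun t => ?_))
        change _ = c * (Set.univ.pi fun _ => K).indicator (E.indicator 1) t
        by_cases h1 : t ∈ Set.univ.pi fun _ : Fin n => K
        · rw [Set.indicator_of_mem h1, Set.indicator_of_mem h1]
          by_cases h2 : t ∈ E <;> simp [h2]
        · rw [Set.indicator_of_notMem h1, Set.indicator_of_notMem h1, mul_zero]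
      rw [h2, map_smul, map_smul, h1]
    | add hd h1 h2 =>
      rename_i s₁ s₂
      intro g hg
      have hb : ∀ s : SimpleFunc (Fin n → T) ℂ, ∃ C : ℝ, ∀ t, ‖s t‖ ≤ C := fun s =>
        s.exists_forall_norm_le
      have h3 : g = restrictBox hK s₁.measurable (hb s₁) + restrictBox hK s₂.measurable (hb s₂) := by
        refine Subtype.ext (hg.trans ?_)
        rw [SimpleFunc.coe_add, Set.indicator_add']
        rfl
      rw [h3, map_add, map_add, h1 _ rfl, h2 _ rfl]
  obtain ⟨C, hC⟩ := f.2.2.1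
  have hm := f.2.1.stronglyMeasurable
  -- Simple approximations with the same bound `C` as `f`, as bounded pointwise convergence
  -- requires.
  have hb : ∀ k, ∀ t, ‖hm.approxBounded C k t‖ ≤ C := fun k t =>
    hm.norm_approxBounded_le ((norm_nonneg _).trans (hC t)) k t
  refine hW.eq_of_tendsto hW' hK (g := fun k =>
    restrictBox hK (hm.approxBounded C k).measurable ⟨C, hb k⟩) ?_ ?_ ?_ ?_
  · exact fun k t ht => Set.mem_of_indicator_ne_zero ht
  · exact ⟨C, fun k t => (norm_indicator_le_norm_self _ _).trans (hb k t)⟩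
  · intro t
    change Tendsto (fun k => (Set.univ.pi fun _ => K).indicator (hm.approxBounded C k) t) _ _
    by_cases h1 : t ∈ Set.univ.pi fun _ : Fin n => K
    · simp only [Set.indicator_of_mem h1]
      exact hm.tendsto_approxBounded_of_norm_le (hC t)
    · simp only [Set.indicator_of_notMem h1]
      rw [eq_zero_of_notMem_box hfK (subset_tsupport _) t (by
        simpa [Set.mem_pi] using h1)]
      exact tendsto_const_nhds
  · exact fun k => hsimple _ _ rfl

end Uniqueness

/-! ### Partitions as equivalence relations: inserting and deleting an element. -/

section Setoids

instance {α : Type*} [Finite α] : Finite (Setoid α) :=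
  Finite.of_injective (fun (r : Setoid α) (x y : α) => r x y) fun _ _ h =>
    Setoid.ext fun x y => iff_of_eq (congrFun (congrFun h x) y)

noncomputable instance {α : Type*} [Finite α] : Fintype (Setoid α) := Fintype.ofFinite _

variable {N : ℕ}

theorem val_succAbove (a : Fin (N + 1)) (x : Fin N) :
    (a.succAbove x).val = if x.val < a.val then x.val else x.val + 1 := by
  unfold Fin.succAbove
  split_ifs <;> simp_all [Fin.lt_def]

/-- The setoid obtained from `r` by inserting a new element at position `a` and joining it to the
block of `b`. -/
def joinSetoid (a : Fin (N + 1)) (b : Fin N) (r : Setoid (Fin N)) : Setoid (Fin (N + 1)) :=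
  r.comap (a.insertNth b id)

/-- The setoid obtained from `r` by inserting a new element at position `b` as a singleton. -/
def singletonSetoid (b : Fin (N + 1)) (r : Setoid (Fin N)) : Setoid (Fin (N + 1)) :=
  Setoid.ker (b.insertNth none (fun x => some (Quotient.mk r x)) : Fin (N + 1) → Option (Quotient r))

variable (a : Fin (N + 1)) (b : Fin N) (r : Setoid (Fin N))

theorem joinSetoid_apply (x y : Fin (N + 1)) : joinSetoid a b r x y ↔
    r ((a.insertNth b id : Fin (N + 1) → Fin N) x) ((a.insertNth b id : Fin (N + 1) → Fin N) y) :=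
  Iff.rfl

theorem singletonSetoid_apply (x y : Fin (N + 1)) : singletonSetoid a r x y ↔
    (a.insertNth none (fun x => some (Quotient.mk r x)) : Fin (N + 1) → Option (Quotient r)) x =
      (a.insertNth none (fun x => some (Quotient.mk r x)) : Fin (N + 1) → Option (Quotient r)) y :=
  Iff.rfl

@[simp] theorem joinSetoid_succAbove (x y : Fin N) :
    joinSetoid a b r (a.succAbove x) (a.succAbove y) ↔ r x y := by
  simp [joinSetoid_apply]

@[simp] theorem joinSetoid_left (y : Fin N) : joinSetoid a b r a (a.succAbove y) ↔ r b y := by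
  simp [joinSetoid_apply]

@[simp] theorem joinSetoid_right (x : Fin N) : joinSetoid a b r (a.succAbove x) a ↔ r x b := by
  simp [joinSetoid_apply]

@[simp] theorem singletonSetoid_succAbove (x y : Fin N) :
    singletonSetoid a r (a.succAbove x) (a.succAbove y) ↔ r x y := by
  simp only [singletonSetoid_apply, Fin.insertNth_apply_succAbove, Option.some.injEq]
  exact Quotient.eq

@[simp] theorem singletonSetoid_left (y : Fin N) :
    singletonSetoid a r a (a.succAbove y) ↔ False := by
  simp [singletonSetoid_apply]

@[simp] theorem singletonSetoid_right (x : Fin N) :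
    singletonSetoid a r (a.succAbove x) a ↔ False := by
  simp [singletonSetoid_apply]

theorem setoid_ext_succAbove {r r' : Setoid (Fin (N + 1))}
    (h1 : ∀ x, r a (a.succAbove x) ↔ r' a (a.succAbove x))
    (h2 : ∀ x y, r (a.succAbove x) (a.succAbove y) ↔ r' (a.succAbove x) (a.succAbove y)) :
    r = r' := by
  refine Setoid.ext fun x y => ?_
  rcases Fin.eq_self_or_eq_succAbove a x with hx | ⟨x, rfl⟩ <;>
    rcases Fin.eq_self_or_eq_succAbove a y with hy | ⟨y, rfl⟩
  · rw [hx, hy]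
    exact ⟨fun _ => r'.refl' _, fun _ => r.refl' _⟩
  · rw [hx]
    exact h1 _
  · rw [hy, r.comm', r'.comm', h1]
  · exact h2 _ _

theorem comap_joinSetoid : (joinSetoid a b r).comap a.succAbove = r :=
  Setoid.ext fun x y => by rw [Setoid.comap_rel, joinSetoid_succAbove]

theorem comap_singletonSetoid : (singletonSetoid a r).comap a.succAbove = r :=
  Setoid.ext fun x y => by rw [Setoid.comap_rel, singletonSetoid_succAbove]

theorem joinSetoid_comap {r : Setoid (Fin (N + 1))} (h : r a (a.succAbove b)) :
    joinSetoid a b (r.comap a.succAbove) = r := by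
  refine setoid_ext_succAbove a (fun x => ?_) (fun x y => ?_)
  · rw [joinSetoid_left, Setoid.comap_rel]
    exact ⟨fun h' => r.trans' h h', fun h' => r.trans' (r.symm' h) h'⟩
  · rw [joinSetoid_succAbove, Setoid.comap_rel]

/-- The block of `x` has at least two elements. -/
def HasPartner (r : Setoid (Fin N)) (x : Fin N) : Prop := ∃ y, y ≠ x ∧ r x y

theorem singletonSetoid_comap {r : Setoid (Fin (N + 1))} (h : ¬ HasPartner r a) :
    singletonSetoid a (r.comap a.succAbove) = r := by
  refine setoid_ext_succAbove a (fun x => ?_) (fun x y => ?_)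
  · rw [singletonSetoid_left, false_iff]
    exact fun h' => h ⟨_, Fin.succAbove_ne a x, h'⟩
  · rw [singletonSetoid_succAbove, Setoid.comap_rel]

/-- The elements `≥ k` belong to different blocks. -/
def Separated (k : ℕ) (r : Setoid (Fin N)) : Prop :=
  ∀ x y : Fin N, k ≤ x.val → k ≤ y.val → r x y → x = y

/-- All blocks have at least two elements, and the elements `≥ k` belong to different blocks. -/
def Good (k : ℕ) (r : Setoid (Fin N)) : Prop := (∀ x, HasPartner r x) ∧ Separated k r

theorem hasPartner_joinSetoid (x : Fin N) :
    HasPartner (joinSetoid a b r) (a.succAbove x) ↔ x = b ∨ HasPartner r x := by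
  unfold HasPartner
  rw [Fin.exists_iff_succAbove a]
  simp only [joinSetoid_right, joinSetoid_succAbove, ne_eq, Fin.succAbove_right_inj]
  constructor
  · rintro (⟨-, h⟩ | h)
    · by_cases hx : x = b
      · exact Or.inl hx
      · exact Or.inr ⟨b, fun h' => hx h'.symm, h⟩
    · exact Or.inr h
  · rintro (rfl | h)
    · exact Or.inl ⟨(Fin.succAbove_ne a x).symm, r.refl' _⟩
    · exact Or.inr h

theorem hasPartner_joinSetoid_self : HasPartner (joinSetoid a b r) a :=
  ⟨a.succAbove b, Fin.succAbove_ne a b, (joinSetoid_left a b r b).2 (r.refl' _)⟩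

theorem hasPartner_singletonSetoid (x : Fin N) :
    HasPartner (singletonSetoid a r) (a.succAbove x) ↔ HasPartner r x := by
  unfold HasPartner
  rw [Fin.exists_iff_succAbove a]
  simp only [singletonSetoid_right, singletonSetoid_succAbove, ne_eq, Fin.succAbove_right_inj,
    and_false, false_or]

theorem not_hasPartner_singletonSetoid : ¬ HasPartner (singletonSetoid a r) a := by
  rintro ⟨y, hy, h⟩
  rcases Fin.eq_self_or_eq_succAbove a y with rfl | ⟨y, rfl⟩
  · exact hy rfl
  · exact (singletonSetoid_left a r y).1 h

theorem separated_joinSetoid {k : ℕ} (ha : a.val = k) :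
    Separated (k + 1) (joinSetoid a b r) ↔ Separated k r := by
  unfold Separated
  constructor
  · intro h x y hx hy hxy
    have := h (a.succAbove x) (a.succAbove y) (by rw [val_succAbove]; split_ifs <;> omega)
      (by rw [val_succAbove]; split_ifs <;> omega) ((joinSetoid_succAbove a b r x y).2 hxy)
    exact Fin.succAbove_right_injective this
  · intro h x y hx hy hxy
    rcases Fin.eq_self_or_eq_succAbove a x with rfl | ⟨x, rfl⟩
    · omega
    rcases Fin.eq_self_or_eq_succAbove a y with rfl | ⟨y, rfl⟩
    · omega
    rw [val_succAbove] at hx hy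
    rw [h x y (by split_ifs at hx <;> omega) (by split_ifs at hy <;> omega)
      ((joinSetoid_succAbove a b r x y).1 hxy)]

theorem separated_singletonSetoid {k : ℕ} (ha : k ≤ a.val) :
    Separated k (singletonSetoid a r) ↔ Separated k r := by
  unfold Separated
  constructor
  · intro h x y hx hy hxy
    have := h (a.succAbove x) (a.succAbove y) (by rw [val_succAbove]; split_ifs <;> omega)
      (by rw [val_succAbove]; split_ifs <;> omega) ((singletonSetoid_succAbove a r x y).2 hxy)
    exact Fin.succAbove_right_injective this
  · intro h x y hx hy hxy
    rcases Fin.eq_self_or_eq_succAbove a x with hxa | ⟨x, rfl⟩ <;>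
      rcases Fin.eq_self_or_eq_succAbove a y with hya | ⟨y, rfl⟩
    · rw [hxa, hya]
    · rw [hxa] at hxy
      exact absurd hxy (by simp)
    · rw [hya] at hxy
      exact absurd hxy (by simp)
    rw [val_succAbove] at hx hy
    rw [h x y (by split_ifs at hx <;> omega) (by split_ifs at hy <;> omega)
      ((singletonSetoid_succAbove a r x y).1 hxy)]

/-- Deleting `a` from the block it shares with `b` can leave at most `b` without a partner. As `a`
sits at position `k`, the threshold `k + 1` becomes `k` after the deletion. -/
theorem good_joinSetoid {k : ℕ} (ha : a.val = k) :
    Good (k + 1) (joinSetoid a b r) ↔ (∀ x, x ≠ b → HasPartner r x) ∧ Separated k r := by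
  unfold Good
  rw [separated_joinSetoid a b r ha, Fin.forall_iff_succAbove a]
  simp only [hasPartner_joinSetoid_self, hasPartner_joinSetoid, true_and]
  refine and_congr_left fun _ => forall_congr' fun x => ?_
  tauto

theorem good_singletonSetoid {k : ℕ} (ha : k ≤ a.val) :
    ((∀ x, x ≠ a → HasPartner (singletonSetoid a r) x) ∧ Separated k (singletonSetoid a r)) ↔
      Good k r := by
  unfold Good
  rw [separated_singletonSetoid a r ha, Fin.forall_iff_succAbove a]
  simp [hasPartner_singletonSetoid, Fin.succAbove_ne]

open Classical in
/-- The setoids satisfying `Good k`. -/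
noncomputable def goodSetoids (N k : ℕ) : Finset (Setoid (Fin N)) :=
  Finset.univ.filter (Good k)

theorem mem_goodSetoids {k : ℕ} {r : Setoid (Fin N)} : r ∈ goodSetoids N k ↔ Good k r := by
  simp [goodSetoids]

-- The two sums separate the cases in which `b` keeps a partner after the deletion of `a` (neutral)
-- and in which `{a, b}` is a whole block (annihilation). In the second case `b` is deleted too.
open Classical in
theorem sum_good_joined {M : Type*} [AddCommMonoid M] {k : ℕ} (a : Fin (N + 1 + 1))
    (b : Fin (N + 1)) (ha : a.val = k) (hb : k ≤ b.val) (f : Setoid (Fin (N + 1 + 1)) → M) :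
    ∑ r ∈ goodSetoids (N + 1 + 1) (k + 1) with r a (a.succAbove b), f r =
      ∑ r ∈ goodSetoids (N + 1) k, f (joinSetoid a b r) +
        ∑ r ∈ goodSetoids N k, f (joinSetoid a b (singletonSetoid b r)) := by
  have h1 : ∑ r ∈ goodSetoids (N + 1 + 1) (k + 1) with r a (a.succAbove b), f r =
      ∑ r : Setoid (Fin (N + 1)) with (∀ x, x ≠ b → HasPartner r x) ∧ Separated k r,
        f (joinSetoid a b r) := by
    symm
    refine Finset.sum_bij' (fun r _ => joinSetoid a b r) (fun r _ => r.comap a.succAbove)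
      ?_ ?_ ?_ ?_ ?_
    · intro r hr
      rw [Finset.mem_filter, mem_goodSetoids, good_joinSetoid a b r ha]
      exact ⟨(Finset.mem_filter.1 hr).2, (joinSetoid_left a b r b).2 (r.refl' _)⟩
    · intro r hr
      rw [Finset.mem_filter, mem_goodSetoids] at hr
      rw [Finset.mem_filter, ← good_joinSetoid a b _ ha, joinSetoid_comap a b hr.2]
      exact ⟨Finset.mem_univ _, hr.1⟩
    · intro r _
      exact comap_joinSetoid a b r
    · intro r hr
      exact joinSetoid_comap a b (Finset.mem_filter.1 hr).2
    · intro r _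
      rfl
  rw [h1, ← Finset.sum_filter_add_sum_filter_not _ (fun r => HasPartner r b)]
  congr 1
  · refine Finset.sum_congr ?_ fun _ _ => rfl
    ext r
    simp only [Finset.mem_filter, Finset.mem_univ, true_and, mem_goodSetoids, Good]
    constructor
    · rintro ⟨⟨h1, h2⟩, h3⟩
      exact ⟨fun x => if hx : x = b then hx ▸ h3 else h1 x hx, h2⟩
    · rintro ⟨h1, h2⟩
      exact ⟨⟨fun x _ => h1 x, h2⟩, h1 b⟩
  · symm
    refine Finset.sum_bij' (fun r _ => singletonSetoid b r) (fun r _ => r.comap b.succAbove)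
      ?_ ?_ ?_ ?_ ?_
    · intro r hr
      rw [mem_goodSetoids, ← good_singletonSetoid b r hb] at hr
      simp only [Finset.mem_filter, Finset.mem_univ, true_and]
      exact ⟨hr, not_hasPartner_singletonSetoid b r⟩
    · intro r hr
      simp only [Finset.mem_filter, Finset.mem_univ, true_and] at hr
      rw [mem_goodSetoids, ← good_singletonSetoid b _ hb, singletonSetoid_comap b hr.2]
      exact hr.1
    · intro r _
      exact comap_singletonSetoid b r
    · intro r hr
      simp only [Finset.mem_filter, Finset.mem_univ, true_and] at hr
      exact singletonSetoid_comap b hr.2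
    · intro r _
      rfl

-- Either `a` is separated from all later elements, or it is joined to one of them. That element is
-- unique, since the later elements lie in different blocks.
open Classical in
theorem sum_good_succ {M : Type*} [AddCommMonoid M] {k m : ℕ} (h : N = k + m)
    (a : Fin (N + 1)) (ha : a.val = k) (f : Setoid (Fin (N + 1)) → M) :
    ∑ r ∈ goodSetoids (N + 1) (k + 1), f r =
      ∑ r ∈ goodSetoids (N + 1) k, f r +
        ∑ i : Fin m, ∑ r ∈ goodSetoids (N + 1) (k + 1) with r a (a.succAbove ⟨k + i, by omega⟩),
          f r := by
  have hval : ∀ i : Fin m, (a.succAbove ⟨k + i, by omega⟩).val = k + i + 1 := by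
    intro i
    rw [val_succAbove]
    simp [ha]
  rw [← Finset.sum_biUnion]
  · rw [← Finset.sum_filter_add_sum_filter_not (goodSetoids (N + 1) (k + 1)) (Separated k)]
    congr 1
    · refine Finset.sum_congr ?_ fun _ _ => rfl
      ext r
      simp only [Finset.mem_filter, mem_goodSetoids, Good]
      constructor
      · rintro ⟨⟨h1, -⟩, h2⟩
        exact ⟨h1, h2⟩
      · rintro ⟨h1, h2⟩
        exact ⟨⟨h1, fun x y hx hy => h2 x y (by omega) (by omega)⟩, h2⟩
    · refine Finset.sum_congr ?_ fun _ _ => rfl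
      ext r
      simp only [Finset.mem_filter, mem_goodSetoids, Finset.mem_biUnion, Finset.mem_univ, true_and]
      constructor
      · rintro ⟨h1, h2⟩
        by_contra hne
        push Not at hne
        refine h2 ?_
        have key : ∀ y : Fin (N + 1), k + 1 ≤ y.val → ¬ r a y := by
          intro y hy hr
          refine hne ⟨y.val - (k + 1), by omega⟩ h1 ?_
          have : a.succAbove ⟨k + (y.val - (k + 1)), by omega⟩ = y := by
            refine Fin.ext ?_
            rw [hval ⟨y.val - (k + 1), by omega⟩]
            simp only
            omega
          simp only
          rwa [this]
        intro x y hx hy hxy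
        by_cases hx' : k + 1 ≤ x.val <;> by_cases hy' : k + 1 ≤ y.val
        · exact h1.2 x y hx' hy' hxy
        · have : y = a := Fin.ext (by omega)
          subst this
          exact absurd (r.symm' hxy) (key x hx')
        · have : x = a := Fin.ext (by omega)
          subst this
          exact absurd hxy (key y hy')
        · exact Fin.ext (by omega)
      · rintro ⟨i, h1, h2⟩
        refine ⟨h1, fun h3 => ?_⟩
        have := h3 a _ ha.ge (by rw [hval]; omega) h2
        have := congrArg Fin.val this
        rw [hval] at this
        omega
  · intro i _ j _ hij
    rw [Function.onFun, Finset.disjoint_left]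
    intro r hi hj
    rw [Finset.mem_filter, mem_goodSetoids] at hi hj
    refine hij ?_
    have := hi.1.2 _ _ (by rw [hval]; omega) (by rw [hval]; omega)
      (r.trans' (r.symm' hi.2) hj.2)
    have := congrArg Fin.val this
    rw [hval, hval] at this
    exact Fin.ext (by omega)

/-- A block has at least two elements, of which at most one is at a position `≥ k`. Thus every Fock
variable belongs to a block which starts among the field variables and ends in that Fock variable.
-/
theorem Good.exists_lt {k : ℕ} {r : Setoid (Fin N)} (h : Good k r) (x : Fin N) :
    ∃ y, y.val < k ∧ r x y := by
  by_cases hx : x.val < k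
  · exact ⟨x, hx, r.refl' _⟩
  · obtain ⟨y, hy, hxy⟩ := h.1 x
    refine ⟨y, ?_, hxy⟩
    by_contra hy'
    exact hy (h.2 x y (by omega) (by omega) hxy).symm

end Setoids

/-! ### Crossings and block measures under insertion. -/

section CrossingWeight

variable {N : ℕ}

/-- `x` is the minimum of its block `B₂`, `y` is the maximum of its block `B₁`, and
`min B₁ < x < y < max B₂`. -/
def IsCrossing (r : Setoid (Fin N)) (x y : Fin N) : Prop :=
  (∀ z, r x z → x ≤ z) ∧ (∀ z, r y z → z ≤ y) ∧ x < y ∧ (∃ z, r y z ∧ z < x) ∧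
    ∃ z, r x z ∧ y < z

theorem succAbove_lt_self {a : Fin (N + 1)} {k : ℕ} (ha : a.val = k) (x : Fin N) :
    a.succAbove x < a ↔ x.val < k := by
  rw [Fin.succAbove_lt_iff_castSucc_lt, Fin.lt_def, ha]
  rfl

theorem self_lt_succAbove {a : Fin (N + 1)} {k : ℕ} (ha : a.val = k) (x : Fin N) :
    a < a.succAbove x ↔ k ≤ x.val := by
  rw [Fin.lt_succAbove_iff_le_castSucc, Fin.le_def, ha]
  rfl

/-- The block of `b` already has an element before position `k` and its maximum at `b`. The inserted
`a` lies strictly between, so it changes no minimum or maximum. -/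
theorem isCrossing_joinSetoid {k : ℕ} {a : Fin (N + 1)} {b : Fin N} {r : Setoid (Fin N)}
    (ha : a.val = k) (hb : k ≤ b.val) (hr : Good k r) (x y : Fin N) :
    IsCrossing (joinSetoid a b r) (a.succAbove x) (a.succAbove y) ↔ IsCrossing r x y := by
  obtain ⟨p, hp, hbp⟩ := hr.exists_lt b
  unfold IsCrossing
  rw [Fin.forall_iff_succAbove a, Fin.forall_iff_succAbove a, Fin.exists_iff_succAbove a,
    Fin.exists_iff_succAbove a]
  simp only [joinSetoid_right, joinSetoid_succAbove, Fin.succAbove_le_succAbove_iff,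
    Fin.succAbove_lt_succAbove_iff, succAbove_lt_self ha, self_lt_succAbove ha]
  constructor
  · rintro ⟨⟨-, h1⟩, ⟨-, h2⟩, h3, h4, h5⟩
    refine ⟨h1, h2, h3, ?_, ?_⟩
    · rcases h4 with ⟨h4, h4'⟩ | h4
      · exact ⟨p, r.trans' h4 hbp, Fin.lt_def.2 (by omega)⟩
      · exact h4
    · rcases h5 with ⟨h5, h5'⟩ | h5
      · exact ⟨b, h5, Fin.lt_def.2 (by omega)⟩
      · exact h5
  · rintro ⟨h1, h2, h3, h4, h5⟩
    refine ⟨⟨fun h => ?_, h1⟩, ⟨fun h => ?_, h2⟩, h3, Or.inr h4, Or.inr h5⟩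
    · have := Fin.le_def.1 (h1 p (r.trans' h hbp))
      exact ((succAbove_lt_self ha x).2 (by omega)).le
    · have := Fin.le_def.1 (h2 b h)
      exact ((self_lt_succAbove ha y).2 (by omega)).le

theorem not_isCrossing_joinSetoid_left {k : ℕ} {a : Fin (N + 1)} {b : Fin N}
    {r : Setoid (Fin N)} (ha : a.val = k) (hr : Good k r) (y : Fin (N + 1)) :
    ¬ IsCrossing (joinSetoid a b r) a y := by
  obtain ⟨p, hp, hbp⟩ := hr.exists_lt b
  rintro ⟨h, -⟩
  exact absurd ((succAbove_lt_self ha p).2 hp)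
    (not_lt.2 (h (a.succAbove p) ((joinSetoid_left a b r p).2 hbp)))

theorem not_isCrossing_joinSetoid_right {k : ℕ} {a : Fin (N + 1)} {b : Fin N}
    {r : Setoid (Fin N)} (ha : a.val = k) (hb : k ≤ b.val) (x : Fin (N + 1)) :
    ¬ IsCrossing (joinSetoid a b r) x a := by
  rintro ⟨-, h, -⟩
  exact absurd ((self_lt_succAbove ha b).2 hb)
    (not_lt.2 (h (a.succAbove b) ((joinSetoid_left a b r b).2 (r.refl' _))))

section Pair

variable {k : ℕ} {a : Fin (N + 1 + 1)} {b : Fin (N + 1)} {r : Setoid (Fin N)}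

theorem isCrossing_pair (x y : Fin N) :
    IsCrossing (joinSetoid a b (singletonSetoid b r)) (a.succAbove (b.succAbove x))
      (a.succAbove (b.succAbove y)) ↔ IsCrossing r x y := by
  unfold IsCrossing
  simp only [Fin.forall_iff_succAbove a, Fin.exists_iff_succAbove a, Fin.forall_iff_succAbove b,
    Fin.exists_iff_succAbove b, joinSetoid_right, joinSetoid_succAbove,
    Fin.succAbove_le_succAbove_iff, Fin.succAbove_lt_succAbove_iff, singletonSetoid_succAbove,
    singletonSetoid_right, false_imp_iff, false_and, true_and, false_or]

/-- The pair starts at position `k`. A Fock variable in front of `b` is the maximum of a block which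
starts before `k`, so this block crosses the pair. Conversely, a crossing block must end strictly
between the two elements of the pair. -/
theorem isCrossing_pair_left (ha : a.val = k) (hb : k ≤ b.val) (hr : Good k r) (y : Fin N) :
    IsCrossing (joinSetoid a b (singletonSetoid b r)) a (a.succAbove (b.succAbove y)) ↔
      k ≤ y.val ∧ y.castSucc < b := by
  have hbb : singletonSetoid b r b b := (singletonSetoid b r).refl' _
  have haa : joinSetoid a b (singletonSetoid b r) a a :=
    (joinSetoid a b (singletonSetoid b r)).refl' _
  have hv := val_succAbove b y
  unfold IsCrossing
  simp only [Fin.forall_iff_succAbove a, Fin.exists_iff_succAbove a, Fin.forall_iff_succAbove b,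
    Fin.exists_iff_succAbove b, joinSetoid_right, joinSetoid_left, joinSetoid_succAbove,
    Fin.succAbove_le_succAbove_iff, Fin.succAbove_lt_succAbove_iff, singletonSetoid_succAbove,
    singletonSetoid_right, singletonSetoid_left, false_imp_iff, false_and, true_and, false_or,
    haa, hbb, le_refl, imp_true_iff, and_true, or_false,
    succAbove_lt_self ha, self_lt_succAbove ha, Fin.succAbove_lt_iff_castSucc_lt, forall_const,
    exists_false]
  constructor
  · rintro ⟨-, -, h3, -, h5⟩
    have h6 : y.castSucc < b := by
      rcases h5 with h5 | h5
      · exact absurd h5 (by omega)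
      · exact h5
    refine ⟨?_, h6⟩
    have := Fin.lt_def.1 h6
    simp only [Fin.val_castSucc] at this
    rw [if_pos this] at hv
    omega
  · rintro ⟨h1, h2⟩
    have := Fin.lt_def.1 h2
    simp only [Fin.val_castSucc] at this
    rw [if_pos this] at hv
    obtain ⟨w, hw, hyw⟩ := hr.exists_lt y
    refine ⟨((self_lt_succAbove ha b).2 hb).le, fun z hz => ?_, by omega, ⟨w, hyw, ?_⟩, Or.inr h2⟩
    · by_contra hlt
      have := Fin.lt_def.1 (not_le.1 hlt)
      exact hlt (hr.2 y z h1 (by omega) hz).ge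
    · rw [val_succAbove, if_pos (by omega)]
      exact hw

theorem not_isCrossing_pair_left_right (ha : a.val = k) (hb : k ≤ b.val) :
    ¬ IsCrossing (joinSetoid a b (singletonSetoid b r)) a (a.succAbove b) := by
  rintro ⟨-, -, -, ⟨z, hz, hza⟩, -⟩
  rcases Fin.eq_self_or_eq_succAbove a z with hz' | ⟨z, rfl⟩
  · exact absurd hza (by rw [hz']; exact lt_irrefl _)
  · rcases Fin.eq_self_or_eq_succAbove b z with hz' | ⟨z, rfl⟩
    · rw [hz', succAbove_lt_self ha] at hza
      omega
    · simp at hz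

theorem not_isCrossing_pair_of_left (ha : a.val = k) (hb : k ≤ b.val) (y : Fin (N + 1 + 1)) :
    ¬ IsCrossing (joinSetoid a b (singletonSetoid b r)) (a.succAbove b) y := by
  rintro ⟨h, -⟩
  exact absurd ((self_lt_succAbove ha b).2 hb) (not_lt.2 (h a (by
    rw [joinSetoid_right])))

/-- The minimum `x` of an old block lies before position `k`, whereas the pair begins at `k`, so the
pair cannot begin before `x`. -/
theorem not_isCrossing_pair_of_right (ha : a.val = k) (hr : Good k r) (x : Fin N) :
    ¬ IsCrossing (joinSetoid a b (singletonSetoid b r)) (a.succAbove (b.succAbove x))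
      (a.succAbove b) := by
  rintro ⟨h1, -, h3, ⟨z, hz, hzx⟩, -⟩
  rw [Fin.succAbove_lt_succAbove_iff, Fin.succAbove_lt_iff_castSucc_lt] at h3
  have h3' := Fin.lt_def.1 h3
  simp only [Fin.val_castSucc] at h3'
  have hv := val_succAbove b x
  rw [if_pos h3'] at hv
  obtain ⟨w, hw, hxw⟩ := hr.exists_lt x
  have h4 := h1 (a.succAbove (b.succAbove w)) (by simpa using hxw)
  rw [Fin.succAbove_le_succAbove_iff, Fin.succAbove_le_succAbove_iff] at h4
  have h4' := Fin.le_def.1 h4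
  rcases Fin.eq_self_or_eq_succAbove a z with hz' | ⟨z, rfl⟩
  · rw [hz', self_lt_succAbove ha] at hzx
    omega
  · rcases Fin.eq_self_or_eq_succAbove b z with hz' | ⟨z, rfl⟩
    · rw [hz', Fin.succAbove_lt_succAbove_iff] at hzx
      have := Fin.lt_def.1 hzx
      omega
    · simp at hz

end Pair

variable {T : Type*} [MeasurableSpace T] {σ : Measure T}

open Classical in
/-- The crossing weight of a setoid. -/
noncomputable def setoidWeight (Q : Kernel σ) (r : Setoid (Fin N)) (t : Fin N → T) : ℂ :=
  ∏ x, ∏ y, if IsCrossing r x y then Q.val (t x) (t y) else 1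

theorem norm_setoidWeight (Q : Kernel σ) (r : Setoid (Fin N)) (t : Fin N → T) :
    ‖setoidWeight Q r t‖ = 1 := by
  classical
  unfold setoidWeight
  rw [norm_prod]
  refine Finset.prod_eq_one fun x _ => ?_
  rw [norm_prod]
  refine Finset.prod_eq_one fun y _ => ?_
  split_ifs
  · exact Q.norm_val _ _
  · exact norm_one

theorem measurable_setoidWeight (Q : Kernel σ) (r : Setoid (Fin N)) :
    Measurable (setoidWeight Q r) := by
  classical
  refine Finset.measurable_prod _ fun x _ => Finset.measurable_prod _ fun y _ => ?_
  by_cases h : IsCrossing r x y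
  · simp only [h, if_true]
    exact measurable_val_eval Q x y
  · simp only [h, if_false]
    exact measurable_const

theorem setoidWeight_join (Q : Kernel σ) {k : ℕ} {a : Fin (N + 1)} {b : Fin N}
    {r : Setoid (Fin N)} (ha : a.val = k) (hb : k ≤ b.val) (hr : Good k r) (u : T)
    (x : Fin N → T) :
    setoidWeight Q (joinSetoid a b r) (a.insertNth u x) = setoidWeight Q r x := by
  classical
  unfold setoidWeight
  simp only [Fin.prod_univ_succAbove _ a, not_isCrossing_joinSetoid_left ha hr,
    not_isCrossing_joinSetoid_right ha hb, isCrossing_joinSetoid ha hb hr, if_false, one_mul,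
    Finset.prod_const_one, Fin.insertNth_apply_succAbove]

-- The only new crossings have the new pair as their second block, and they supply the annihilation
-- weight.
open Classical in
theorem setoidWeight_pair (Q : Kernel σ) {k : ℕ} {a : Fin (N + 1 + 1)} {b : Fin (N + 1)}
    {r : Setoid (Fin N)} (ha : a.val = k) (hb : k ≤ b.val) (hr : Good k r) (u : T)
    (x : Fin N → T) :
    setoidWeight Q (joinSetoid a b (singletonSetoid b r)) (a.insertNth u (b.insertNth u x)) =
      (∏ y : Fin N, if k ≤ y.val ∧ y.castSucc < b then Q.val u (x y) else 1) *
        setoidWeight Q r x := by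
  unfold setoidWeight
  have h0 : ¬ IsCrossing (joinSetoid a b (singletonSetoid b r)) a a := fun h => lt_irrefl _ h.2.2.1
  simp only [Fin.prod_univ_succAbove _ a, Fin.prod_univ_succAbove _ b,
    not_isCrossing_joinSetoid_right ha hb,
    isCrossing_pair, isCrossing_pair_left ha hb hr, not_isCrossing_pair_left_right ha hb,
    not_isCrossing_pair_of_left ha hb, not_isCrossing_pair_of_right ha hr,
    if_false, one_mul, mul_one,
    Finset.prod_const_one, Fin.insertNth_apply_succAbove, Fin.insertNth_apply_same]

/-- A colouring whose colour classes are the blocks of `r`. -/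
structure IsColoring {ι : Type*} (c : Fin N → ι) (r : Setoid (Fin N)) : Prop where
  surjective : Function.Surjective c
  rel_iff : ∀ x y, r x y ↔ c x = c y

theorem isColoring_mk (r : Setoid (Fin N)) : IsColoring (Quotient.mk r) r :=
  ⟨Quotient.mk_surjective, fun _ _ => Quotient.eq.symm⟩

theorem IsColoring.exists_equiv {ι ι' : Type*} {c : Fin N → ι} {c' : Fin N → ι'}
    {r : Setoid (Fin N)} (h : IsColoring c r) (h' : IsColoring c' r) :
    ∃ e : ι ≃ ι', ∀ x, e (c x) = c' x := by
  have h1 : ∀ x, c' (Function.surjInv h.surjective (c x)) = c' x := fun x => by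
    rw [← h'.rel_iff, h.rel_iff, Function.surjInv_eq h.surjective]
  refine ⟨Equiv.ofBijective (fun i => c' (Function.surjInv h.surjective i)) ⟨?_, ?_⟩, h1⟩
  · intro i j hij
    simp only at hij
    rw [← h'.rel_iff, h.rel_iff, Function.surjInv_eq h.surjective,
      Function.surjInv_eq h.surjective] at hij
    exact hij
  · intro j
    obtain ⟨x, rfl⟩ := h'.surjective j
    exact ⟨c x, h1 x⟩

variable (σ) in
/-- The image of the product measure on `T^ι` under the map which sets the variables `tᵢ` with
the same colour equal to each other. -/
noncomputable def colorMeasure {ι : Type*} [Fintype ι] (c : Fin N → ι) : Measure (Fin N → T) :=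
  (Measure.pi fun _ : ι => σ).map fun s i => s (c i)

theorem measurable_comp_right {ι κ : Type*} (c : κ → ι) :
    Measurable fun (s : ι → T) (i : κ) => s (c i) :=
  measurable_pi_iff.2 fun i => measurable_pi_apply (c i)

/-- Colourings with the same classes differ by a bijection of the colours, which preserves the
product measure. Convenient colourings may thus be used for inserted elements. -/
theorem IsColoring.colorMeasure_eq [SigmaFinite σ] {ι ι' : Type*} [Fintype ι] [Fintype ι']
    {c : Fin N → ι} {c' : Fin N → ι'} {r : Setoid (Fin N)} (h : IsColoring c r)
    (h' : IsColoring c' r) : colorMeasure σ c = colorMeasure σ c' := by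
  obtain ⟨e, he⟩ := h.exists_equiv h'
  have hmp := (measurePreserving_piCongrLeft (fun _ : ι' => σ) e).symm
  unfold colorMeasure
  rw [← hmp.map_eq, Measure.map_map (measurable_comp_right c) (MeasurableEquiv.measurable _)]
  congr 1
  funext s i
  rw [← he i]
  rfl

/-- The number of blocks. -/
noncomputable def blockCount (r : Setoid (Fin N)) : ℕ := Nat.card (Quotient r)

theorem IsColoring.blockCount_eq {ι : Type*} {c : Fin N → ι} {r : Setoid (Fin N)}
    (h : IsColoring c r) : blockCount r = Nat.card ι := by
  obtain ⟨e, -⟩ := (isColoring_mk r).exists_equiv h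
  exact Nat.card_congr e

theorem exists_fin_coloring (r : Setoid (Fin N)) :
    ∃ c : Fin N → Fin (blockCount r), IsColoring c r := by
  let e : Quotient r ≃ Fin (blockCount r) := Finite.equivFin (Quotient r)
  refine ⟨fun x => e (Quotient.mk r x), e.surjective.comp Quotient.mk_surjective, fun x y => ?_⟩
  rw [e.apply_eq_iff_eq]
  exact Quotient.eq.symm

variable (σ) in
/-- The measure on `T^N` which sets the variables in each block of `r` equal to each other. -/
noncomputable def setoidMeasure (r : Setoid (Fin N)) : Measure (Fin N → T) :=
  colorMeasure σ (exists_fin_coloring r).choose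

theorem IsColoring.setoidMeasure_eq [SigmaFinite σ] {ι : Type*} [Fintype ι]
    {c : Fin N → ι} {r : Setoid (Fin N)} (h : IsColoring c r) :
    setoidMeasure σ r = colorMeasure σ c :=
  (exists_fin_coloring r).choose_spec.colorMeasure_eq h

theorem IsColoring.join {ι : Type*} {a : Fin (N + 1)} {b : Fin N} {c : Fin N → ι}
    {r : Setoid (Fin N)} (h : IsColoring c r) :
    IsColoring (a.insertNth (c b) c : Fin (N + 1) → ι) (joinSetoid a b r) := by
  refine ⟨fun i => ?_, fun x y => ?_⟩
  · obtain ⟨x, rfl⟩ := h.surjective i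
    exact ⟨a.succAbove x, by simp⟩
  · have h1 : ∀ x, (a.insertNth (c b) c : Fin (N + 1) → ι) x =
        c ((a.insertNth b id : Fin (N + 1) → Fin N) x) := by
      intro x
      rcases Fin.eq_self_or_eq_succAbove a x with hx | ⟨x, rfl⟩
      · rw [hx]; simp
      · simp
    rw [joinSetoid_apply, h.rel_iff, h1, h1]

theorem IsColoring.singleton {p : ℕ} {b : Fin (N + 1)} {c : Fin N → Fin p}
    {r : Setoid (Fin N)} (h : IsColoring c r) :
    IsColoring (b.insertNth 0 (fun x => (c x).succ) : Fin (N + 1) → Fin (p + 1))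
      (singletonSetoid b r) := by
  refine ⟨fun i => ?_, fun x y => ?_⟩
  · refine Fin.cases ⟨b, by simp⟩ (fun i => ?_) i
    obtain ⟨x, rfl⟩ := h.surjective i
    exact ⟨b.succAbove x, by simp⟩
  · rcases Fin.eq_self_or_eq_succAbove b x with hx | ⟨x, rfl⟩ <;>
      rcases Fin.eq_self_or_eq_succAbove b y with hy | ⟨y, rfl⟩
    · rw [hx, hy]
      exact ⟨fun _ => rfl, fun _ => Setoid.refl' _ _⟩
    · rw [hx]
      simp [(Fin.succ_ne_zero _).symm]
    · rw [hy]
      simp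
    · simp [h.rel_iff]

theorem blockCount_join (a : Fin (N + 1)) (b : Fin N) (r : Setoid (Fin N)) :
    blockCount (joinSetoid a b r) = blockCount r :=
  (isColoring_mk r).join.blockCount_eq

theorem blockCount_singleton (b : Fin (N + 1)) (r : Setoid (Fin N)) :
    blockCount (singletonSetoid b r) = blockCount r + 1 := by
  obtain ⟨c, hc⟩ := exists_fin_coloring r
  rw [hc.singleton.blockCount_eq, Nat.card_fin]

/-- Ensures that the subtraction in the exponent `N - 2 * blockCount r` is not truncated. -/
theorem two_mul_blockCount_le {r : Setoid (Fin N)} (h : ∀ x, HasPartner r x) :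
    2 * blockCount r ≤ N := by
  obtain ⟨c, hc⟩ := exists_fin_coloring r
  have h1 := Finset.card_eq_sum_card_fiberwise (f := c) (s := Finset.univ) (t := Finset.univ)
    fun _ _ => Finset.mem_univ _
  have h2 := Finset.card_nsmul_le_sum Finset.univ
    (fun i => (Finset.univ.filter fun x => c x = i).card) 2 fun i _ => by
      obtain ⟨x, rfl⟩ := hc.surjective i
      obtain ⟨y, hy, hxy⟩ := h x
      exact Finset.one_lt_card.2 ⟨x, by simp, y, by simp [(hc.rel_iff x y).1 hxy], hy.symm⟩
  rw [← h1] at h2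
  simpa [mul_comm] using h2

theorem setoidMeasure_join [SigmaFinite σ] (a : Fin (N + 1)) (b : Fin N) (r : Setoid (Fin N)) :
    setoidMeasure σ (joinSetoid a b r) =
      (setoidMeasure σ r).map fun x => a.insertNth (x b) x := by
  have hm : Measurable fun x : Fin N → T => (a.insertNth (x b) x : Fin (N + 1) → T) :=
    (measurable_insertNth a).comp ((measurable_pi_apply b).prodMk measurable_id)
  obtain ⟨c, hc⟩ := exists_fin_coloring r
  rw [hc.join.setoidMeasure_eq, hc.setoidMeasure_eq, colorMeasure, colorMeasure,
    Measure.map_map hm (measurable_comp_right _)]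
  congr 1
  funext s i
  rcases Fin.eq_self_or_eq_succAbove a i with hx | ⟨i, rfl⟩
  · rw [hx]; simp
  · simp

theorem setoidMeasure_singleton [SigmaFinite σ] (b : Fin (N + 1)) (r : Setoid (Fin N)) :
    setoidMeasure σ (singletonSetoid b r) =
      (σ.prod (setoidMeasure σ r)).map fun p => b.insertNth p.1 p.2 := by
  obtain ⟨c, hc⟩ := exists_fin_coloring r
  have h1 := Measure.map_prod_map σ (Measure.pi fun _ : Fin (blockCount r) => σ) measurable_id
    (measurable_comp_right (T := T) c)
  rw [hc.singleton.setoidMeasure_eq, hc.setoidMeasure_eq, colorMeasure, colorMeasure]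
  rw [Measure.map_id] at h1
  rw [h1, Measure.map_map (measurable_insertNth b)
    (measurable_id.prodMap (measurable_comp_right c)),
    ← (measurePreserving_insertNth (n := blockCount r) σ 0).map_eq,
    Measure.map_map (measurable_comp_right _) (measurable_insertNth 0)]
  congr 1
  funext p i
  rcases Fin.eq_self_or_eq_succAbove b i with hx | ⟨i, rfl⟩
  · rw [hx]; simp
  · simp

end CrossingWeight

/-! ### The partition sum and its recursion. -/

section Moments

variable {T : Type*} [MeasurableSpace T] {σ : Measure T} {N : ℕ} {K : Set T}

/-- Bounded measurable functions on `T^N` which vanish outside `K^N`. -/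
structure BoxBounded (K : Set T) (G : (Fin N → T) → ℂ) : Prop where
  meas : Measurable G
  bound : ∃ C : ℝ, 0 ≤ C ∧ ∀ t, ‖G t‖ ≤ C
  supp : ∀ t i, t i ∉ K → G t = 0

/-- Every colour is used, so the integrand lives on `K` in each block variable, a box of finite
product measure. -/
theorem BoxBounded.integrable [SigmaFinite σ] {G : (Fin N → T) → ℂ} (hG : BoxBounded K G)
    (hK : MeasurableSet K) (hKσ : σ K < ∞) (r : Setoid (Fin N)) :
    Integrable G (setoidMeasure σ r) := by
  obtain ⟨c, hc⟩ := exists_fin_coloring r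
  obtain ⟨C, -, hC⟩ := hG.bound
  have hm := hG.meas.comp (measurable_comp_right (T := T) c)
  rw [hc.setoidMeasure_eq, colorMeasure, integrable_map_measure
    hG.meas.aestronglyMeasurable (measurable_comp_right c).aemeasurable]
  have hS : MeasurableSet (Set.univ.pi fun _ : Fin (blockCount r) => K) :=
    MeasurableSet.univ_pi fun _ => hK
  have hfin : (Measure.pi fun _ : Fin (blockCount r) => σ) (Set.univ.pi fun _ => K) < ∞ := by
    rw [Measure.pi_pi]
    exact ENNReal.prod_lt_top fun _ _ => hKσ
  refine ((integrable_indicator_iff hS).2 (Measure.integrableOn_of_bounded hfin.ne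
    hm.aestronglyMeasurable (M := C) (ae_of_all _ fun s => hC _))).congr (ae_of_all _ fun s => ?_)
  by_cases hs : s ∈ Set.univ.pi fun _ => K
  · rw [Set.indicator_of_mem hs]
  · rw [Set.indicator_of_notMem hs]
    simp only [Set.mem_univ_pi, not_forall] at hs
    obtain ⟨i, hi⟩ := hs
    obtain ⟨x, rfl⟩ := hc.surjective i
    exact (hG.supp _ x hi).symm

theorem BoxBounded.mul {G w : (Fin N → T) → ℂ} (hG : BoxBounded K G) (hw : Measurable w)
    (hw1 : ∀ t, ‖w t‖ = 1) : BoxBounded K fun t => G t * w t where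
  meas := hG.meas.mul hw
  bound := by
    obtain ⟨C, h0, hC⟩ := hG.bound
    exact ⟨C, h0, fun t => by rw [norm_mul, hw1, mul_one]; exact hC t⟩
  supp t i hi := by rw [hG.supp t i hi, zero_mul]

theorem BoxBounded.zero : BoxBounded K fun _ : Fin N → T => (0 : ℂ) where
  meas := measurable_const
  bound := ⟨0, le_rfl, fun _ => by simp⟩
  supp _ _ _ := rfl

theorem BoxBounded.add {G G' : (Fin N → T) → ℂ} (hG : BoxBounded K G) (hG' : BoxBounded K G') :
    BoxBounded K fun t => G t + G' t where
  meas := hG.meas.add hG'.meas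
  bound := by
    obtain ⟨C, h0, hC⟩ := hG.bound
    obtain ⟨C', h0', hC'⟩ := hG'.bound
    exact ⟨C + C', add_nonneg h0 h0', fun t => (norm_add_le _ _).trans (add_le_add (hC t) (hC' t))⟩
  supp t i hi := by rw [hG.supp t i hi, hG'.supp t i hi, zero_add]

theorem BoxBounded.const_mul {G : (Fin N → T) → ℂ} (c : ℂ) (hG : BoxBounded K G) :
    BoxBounded K fun t => c * G t where
  meas := hG.meas.const_mul c
  bound := by
    obtain ⟨C, h0, hC⟩ := hG.bound
    exact ⟨‖c‖ * C, by positivity, fun t => by rw [norm_mul]; gcongr; exact hC t⟩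
  supp t i hi := by rw [hG.supp t i hi, mul_zero]

theorem BoxBounded.sum {ι : Type*} {s : Finset ι} {G : ι → (Fin N → T) → ℂ}
    (hG : ∀ i, BoxBounded K (G i)) : BoxBounded K fun t => ∑ i ∈ s, G i t := by
  classical
  induction s using Finset.induction_on with
  | empty => simpa using BoxBounded.zero
  | insert i s hi ih =>
    simp only [Finset.sum_insert hi]
    exact (hG i).add ih

/-- The sum over the partitions in `goodSetoids N k` in the moment formula. -/
noncomputable def mom (Q : Kernel σ) (lam : ℝ) (k : ℕ) (G : (Fin N → T) → ℂ) : ℂ :=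
  ∑ r ∈ goodSetoids N k,
    (lam : ℂ) ^ (N - 2 * blockCount r) * ∫ t, G t * setoidWeight Q r t ∂(setoidMeasure σ r)

section Linear

variable [SigmaFinite σ] (Q : Kernel σ) (lam : ℝ) (k : ℕ)

theorem BoxBounded.integrable_mul_setoidWeight {G : (Fin N → T) → ℂ} (hG : BoxBounded K G)
    (hK : MeasurableSet K) (hKσ : σ K < ∞) (r : Setoid (Fin N)) :
    Integrable (fun t => G t * setoidWeight Q r t) (setoidMeasure σ r) :=
  (hG.mul (measurable_setoidWeight Q r) (norm_setoidWeight Q r)).integrable hK hKσ r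

omit [SigmaFinite σ] in
theorem mom_zero : mom Q lam k (fun _ : Fin N → T => (0 : ℂ)) = 0 := by
  simp [mom]

theorem mom_add {G G' : (Fin N → T) → ℂ} (hK : MeasurableSet K) (hKσ : σ K < ∞)
    (hG : BoxBounded K G) (hG' : BoxBounded K G') :
    mom Q lam k (fun t => G t + G' t) = mom Q lam k G + mom Q lam k G' := by
  unfold mom
  rw [← Finset.sum_add_distrib]
  refine Finset.sum_congr rfl fun r _ => ?_
  simp only [add_mul]
  rw [integral_add (hG.integrable_mul_setoidWeight Q hK hKσ r)
    (hG'.integrable_mul_setoidWeight Q hK hKσ r), mul_add]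

omit [SigmaFinite σ] in
theorem mom_const_mul (c : ℂ) (G : (Fin N → T) → ℂ) :
    mom Q lam k (fun t => c * G t) = c * mom Q lam k G := by
  unfold mom
  rw [Finset.mul_sum]
  refine Finset.sum_congr rfl fun r _ => ?_
  simp only [mul_assoc]
  rw [integral_const_mul]
  ring

theorem mom_sum {ι : Type*} {s : Finset ι} {G : ι → (Fin N → T) → ℂ} (hK : MeasurableSet K)
    (hKσ : σ K < ∞) (hG : ∀ i, BoxBounded K (G i)) :
    mom Q lam k (fun t => ∑ i ∈ s, G i t) = ∑ i ∈ s, mom Q lam k (G i) := by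
  classical
  induction s using Finset.induction_on with
  | empty => simpa using mom_zero Q lam k
  | insert i s hi ih =>
    simp only [Finset.sum_insert hi]
    rw [mom_add Q lam k hK hKσ (hG i) (BoxBounded.sum hG), ih]

end Linear

/-- The function of `N` variables obtained from `G` by setting the variable at position `a` equal
to the variable at position `b` of the remaining ones. -/
def diag (a : Fin (N + 1)) (b : Fin N) (G : (Fin (N + 1) → T) → ℂ) (x : Fin N → T) : ℂ :=
  G (a.insertNth (x b) x)

open Classical in
/-- The weight of the contraction of a new variable `u` at position `b` with a field to the left
of all variables at positions `≥ k`. -/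
noncomputable def pairWeight (Q : Kernel σ) (k : ℕ) (b : Fin (N + 1)) (u : T) (x : Fin N → T) : ℂ :=
  ∏ y : Fin N, if k ≤ y.val ∧ y.castSucc < b then Q.val u (x y) else 1

/-- The contraction of the variable at position `a` with the one at position `b` of the remaining
ones. -/
noncomputable def contract (Q : Kernel σ) (k : ℕ) (a : Fin (N + 1 + 1)) (b : Fin (N + 1))
    (G : (Fin (N + 1 + 1) → T) → ℂ) (x : Fin N → T) : ℂ :=
  ∫ u, pairWeight Q k b u x * G (a.insertNth u (b.insertNth u x)) ∂σ

theorem BoxBounded.diag {G : (Fin (N + 1) → T) → ℂ} (hG : BoxBounded K G) (a : Fin (N + 1))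
    (b : Fin N) : BoxBounded K (diag a b G) where
  meas := hG.meas.comp
    ((measurable_insertNth a).comp ((measurable_pi_apply b).prodMk measurable_id))
  bound := by
    obtain ⟨C, h0, hC⟩ := hG.bound
    exact ⟨C, h0, fun t => hC _⟩
  supp t i hi := hG.supp _ (a.succAbove i) (by simpa using hi)

theorem measurable_pairWeight (Q : Kernel σ) (k : ℕ) (b : Fin (N + 1)) :
    Measurable fun q : (Fin N → T) × T => pairWeight Q k b q.2 q.1 := by
  refine Finset.measurable_prod _ fun y _ => ?_
  by_cases h : k ≤ y.val ∧ y.castSucc < b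
  · simp only [h, if_true, and_self]
    exact Q.measurable_val.comp
      (measurable_snd.prodMk ((measurable_pi_apply y).comp measurable_fst))
  · simp only [h, if_false]
    exact measurable_const

theorem norm_pairWeight (Q : Kernel σ) (k : ℕ) (b : Fin (N + 1)) (u : T) (x : Fin N → T) :
    ‖pairWeight Q k b u x‖ = 1 := by
  unfold pairWeight
  rw [norm_prod]
  refine Finset.prod_eq_one fun y _ => ?_
  split_ifs
  · exact Q.norm_val _ _
  · exact norm_one

theorem BoxBounded.contract [SigmaFinite σ] (Q : Kernel σ) (k : ℕ) {G : (Fin (N + 1 + 1) → T) → ℂ}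
    (hG : BoxBounded K G) (hKσ : σ K < ∞) (a : Fin (N + 1 + 1))
    (b : Fin (N + 1)) : BoxBounded K (contract Q k a b G) where
  meas := by
    have h1 : Measurable fun q : (Fin N → T) × T =>
        G (a.insertNth q.2 (b.insertNth q.2 q.1 : Fin (N + 1) → T)) :=
      hG.meas.comp ((measurable_insertNth a).comp (measurable_snd.prodMk
        ((measurable_insertNth b).comp measurable_swap)))
    have h2 : Measurable fun q : (Fin N → T) × T =>
        pairWeight Q k b q.2 q.1 * G (a.insertNth q.2 (b.insertNth q.2 q.1 : Fin (N + 1) → T)) :=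
      (measurable_pairWeight Q k b).mul h1
    exact h2.stronglyMeasurable.integral_prod_right'.measurable
  bound := by
    obtain ⟨C, h0, hC⟩ := hG.bound
    refine ⟨C * σ.real K, by positivity, fun x => ?_⟩
    unfold QField.contract
    rw [← setIntegral_eq_integral_of_forall_compl_eq_zero (s := K)]
    · refine norm_setIntegral_le_of_norm_le_const hKσ fun u _ => ?_
      rw [norm_mul, norm_pairWeight, one_mul]
      exact hC _
    · intro u hu
      rw [hG.supp _ a (by simpa using hu), mul_zero]
  supp t i hi := by
    have h : ∀ u, G (a.insertNth u (b.insertNth u t)) = 0 := fun u =>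
      hG.supp _ (a.succAbove (b.succAbove i)) (by simpa using hi)
    simp [QField.contract, h]

variable [SigmaFinite σ] (Q : Kernel σ) (lam : ℝ) {k : ℕ}

theorem integral_joinSetoid {a : Fin (N + 1)} {b : Fin N} (ha : a.val = k) (hb : k ≤ b.val)
    {r : Setoid (Fin N)} (hr : Good k r) {G : (Fin (N + 1) → T) → ℂ} (hG : Measurable G) :
    ∫ t, G t * setoidWeight Q (joinSetoid a b r) t ∂(setoidMeasure σ (joinSetoid a b r)) =
      ∫ t, diag a b G t * setoidWeight Q r t ∂(setoidMeasure σ r) := by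
  have hm : Measurable fun x : Fin N → T => (a.insertNth (x b) x : Fin (N + 1) → T) :=
    (measurable_insertNth a).comp ((measurable_pi_apply b).prodMk measurable_id)
  have hG' : Measurable fun t => G t * setoidWeight Q (joinSetoid a b r) t :=
    hG.mul (measurable_setoidWeight Q _)
  rw [setoidMeasure_join, integral_map hm.aemeasurable hG'.aestronglyMeasurable]
  simp only [setoidWeight_join Q ha hb hr]
  rfl

instance (r : Setoid (Fin N)) : SFinite (setoidMeasure σ r) := by
  unfold setoidMeasure colorMeasure
  infer_instance

/-- Under the block measure the variable of the pair is independent of the others and distributed by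
`σ`. Fubini integrates it out first, with the crossing factors of the pair as weight. -/
theorem integral_pairSetoid {a : Fin (N + 1 + 1)} {b : Fin (N + 1)} (ha : a.val = k)
    (hb : k ≤ b.val) {r : Setoid (Fin N)} (hr : Good k r) {G : (Fin (N + 1 + 1) → T) → ℂ}
    (hG : BoxBounded K G) (hK : MeasurableSet K) (hKσ : σ K < ∞) :
    ∫ t, G t * setoidWeight Q (joinSetoid a b (singletonSetoid b r)) t
        ∂(setoidMeasure σ (joinSetoid a b (singletonSetoid b r))) =
      ∫ t, contract Q k a b G t * setoidWeight Q r t ∂(setoidMeasure σ r) := by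
  have hm : Measurable fun x : Fin (N + 1) → T => (a.insertNth (x b) x : Fin (N + 1 + 1) → T) :=
    (measurable_insertNth a).comp ((measurable_pi_apply b).prodMk measurable_id)
  have hm' : Measurable fun p : T × (Fin N → T) =>
      (a.insertNth p.1 (b.insertNth p.1 p.2 : Fin (N + 1) → T) : Fin (N + 1 + 1) → T) :=
    (measurable_insertNth a).comp (measurable_fst.prodMk (measurable_insertNth b))
  have hmeas : setoidMeasure σ (joinSetoid a b (singletonSetoid b r)) =
      (σ.prod (setoidMeasure σ r)).map fun p =>
        (a.insertNth p.1 (b.insertNth p.1 p.2 : Fin (N + 1) → T) : Fin (N + 1 + 1) → T) := by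
    rw [setoidMeasure_join, setoidMeasure_singleton, Measure.map_map hm (measurable_insertNth b)]
    congr 1
    funext p
    simp
  have hint := hG.integrable_mul_setoidWeight Q hK hKσ (joinSetoid a b (singletonSetoid b r))
  have hae : AEStronglyMeasurable
      (fun t => G t * setoidWeight Q (joinSetoid a b (singletonSetoid b r)) t)
      (setoidMeasure σ (joinSetoid a b (singletonSetoid b r))) := hint.aestronglyMeasurable
  rw [hmeas] at hint hae ⊢
  rw [integral_map hm'.aemeasurable hae]
  rw [integrable_map_measure hae hm'.aemeasurable] at hint
  refine (integral_prod_symm _ hint).trans (integral_congr_ae (ae_of_all _ fun x => ?_))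
  simp only [contract, Function.comp_apply]
  rw [← integral_mul_const]
  refine integral_congr_ae (ae_of_all _ fun u => ?_)
  simp only [setoidWeight_pair Q ha hb hr, pairWeight]
  ring

-- No position lies beyond `a`, so nothing can be joined to it. The case is separate because
-- contraction needs at least two variables.
omit [SigmaFinite σ] in
theorem mom_succ_of_eq {a : Fin (N + 1)} (h : N = k) (ha : a.val = k) (G : (Fin (N + 1) → T) → ℂ) :
    mom Q lam (k + 1) G = mom Q lam k G := by
  unfold mom
  rw [sum_good_succ (m := 0) h a ha]
  simp

/-- The combinatorial form of creation, neutral part and annihilation. Joining adds an element but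
no block, hence one factor `λ`. A new pair adds two elements and one block, hence none. -/
theorem mom_succ {m : ℕ} {a : Fin (N + 1 + 1)} (h : N + 1 = k + m) (ha : a.val = k)
    {G : (Fin (N + 1 + 1) → T) → ℂ} (hG : BoxBounded K G) (hK : MeasurableSet K)
    (hKσ : σ K < ∞) :
    mom Q lam (k + 1) G = mom Q lam k G +
      lam * ∑ i : Fin m, mom Q lam k (diag a ⟨k + i, by omega⟩ G) +
      ∑ i : Fin m, mom Q lam k (contract Q k a ⟨k + i, by omega⟩ G) := by
  classical
  rw [add_assoc (mom Q lam k G)]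
  refine (sum_good_succ h a ha _).trans (congrArg (mom Q lam k G + ·) ?_)
  rw [Finset.mul_sum, ← Finset.sum_add_distrib]
  refine Finset.sum_congr rfl fun i _ => ?_
  have hb : k ≤ (⟨k + i, by omega⟩ : Fin (N + 1)).val := Nat.le_add_right _ _
  rw [sum_good_joined a ⟨k + i, by omega⟩ ha hb]
  congr 1
  · rw [mom, Finset.mul_sum]
    refine Finset.sum_congr rfl fun r hr => ?_
    rw [mem_goodSetoids] at hr
    have h2 := two_mul_blockCount_le hr.1
    rw [integral_joinSetoid Q ha hb hr hG.meas, blockCount_join,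
      show N + 1 + 1 - 2 * blockCount r = (N + 1 - 2 * blockCount r) + 1 by omega, pow_succ]
    ring
  · refine Finset.sum_congr rfl fun r hr => ?_
    rw [mem_goodSetoids] at hr
    rw [integral_pairSetoid Q ha hb hr hG hK hKσ, blockCount_join, blockCount_singleton,
      show N + 1 + 1 - 2 * (blockCount r + 1) = N - 2 * blockCount r by omega]

-- For `k = 0` all elements are in different blocks, so none has a partner. In terms of the fields:
-- with none left to act, only the vacuum component contributes.
omit [SigmaFinite σ] in
theorem mom_zero_left {G : (Fin (N + 1) → T) → ℂ} : mom Q lam 0 G = 0 := by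
  unfold mom
  refine Finset.sum_eq_zero fun r hr => ?_
  obtain ⟨y, hy, -⟩ := (mem_goodSetoids.1 hr).exists_lt 0
  omega

theorem mom_zero_zero (G : (Fin 0 → T) → ℂ) : mom Q lam 0 G = G ![] := by
  have h1 : goodSetoids 0 0 = {⊥} := by
    ext r
    rw [mem_goodSetoids, Finset.mem_singleton]
    refine ⟨fun _ => Setoid.ext fun x => x.elim0, fun _ => ⟨fun x => x.elim0, fun x => x.elim0⟩⟩
  have h2 : IsColoring (fun x : Fin 0 => x) (⊥ : Setoid (Fin 0)) :=
    ⟨Function.surjective_id, fun x => x.elim0⟩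
  rw [mom, h1, Finset.sum_singleton, h2.setoidMeasure_eq, colorMeasure]
  have h3 : (fun (s : Fin 0 → T) (i : Fin 0) => s i) = id := rfl
  rw [h3, Measure.map_id, Measure.pi_of_empty (fun _ : Fin 0 => σ) ![], integral_dirac]
  simp [setoidWeight]

end Moments

/-! ### Matching the field action with the partition recursion. -/

section Flat

theorem insertNth_of_lt {T : Type*} {N : ℕ} (a : Fin (N + 1)) (u : T) (x : Fin N → T)
    (j : Fin (N + 1)) (h : j.val < a.val) :
    (a.insertNth u x : Fin (N + 1) → T) j = x ⟨j.val, by omega⟩ := by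
  have : j = a.succAbove ⟨j.val, by omega⟩ := Fin.ext (by rw [val_succAbove, if_pos h])
  conv_lhs => rw [this]
  rw [Fin.insertNth_apply_succAbove]

theorem insertNth_of_gt {T : Type*} {N : ℕ} (a : Fin (N + 1)) (u : T) (x : Fin N → T)
    (j : Fin (N + 1)) (h : a.val < j.val) :
    (a.insertNth u x : Fin (N + 1) → T) j = x ⟨j.val - 1, by omega⟩ := by
  have : j = a.succAbove ⟨j.val - 1, by omega⟩ :=
    Fin.ext (by rw [val_succAbove, if_neg (by simp only; omega)]; simp only; omega)
  conv_lhs => rw [this]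
  rw [Fin.insertNth_apply_succAbove]

theorem insertNth_of_eq {T : Type*} {N : ℕ} (a : Fin (N + 1)) (u : T) (x : Fin N → T)
    (j : Fin (N + 1)) (h : j.val = a.val) :
    (a.insertNth u x : Fin (N + 1) → T) j = u := by
  rw [Fin.ext h, Fin.insertNth_apply_same]

theorem snoc_eq {T : Type*} {n : ℕ} {t : Fin n → T} {u : T} {y : Fin (n + 1) → T}
    (h1 : ∀ i : Fin n, y i.castSucc = t i) (h2 : y (Fin.last n) = u) :
    (Fin.snoc t u : Fin (n + 1) → T) = y := by
  funext i
  refine Fin.lastCases ?_ (fun i => ?_) i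
  · rw [Fin.snoc_last, h2]
  · rw [Fin.snoc_castSucc, h1]

variable {T : Type*}

/-- A family of graded functions as a function of all its variables. -/
def flat {N n m : ℕ} (h : N = n + m) (G : (Fin n → T) → Graded T) (x : Fin N → T) : ℂ :=
  G (fun i => x ⟨i, by omega⟩) m (fun j => x ⟨n + j, by omega⟩)

variable {N n m : ℕ}

/-- Creation only moves the border between field and Fock variables; as a function of all variables
nothing changes. -/
theorem flat_creationStep (h : N = n + (m + 1)) (G : (Fin (n + 1) → T) → Graded T) :
    flat h (fun t => creationStep fun u => G (Fin.snoc t u)) =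
      flat (n := n + 1) (m := m) (by omega) G := by
  funext x
  simp only [flat, creationStep]
  congr 1
  · exact snoc_eq (fun i => rfl) rfl
  · funext j
    congr 1
    refine Fin.ext ?_
    simp only [Fin.val_succ]
    omega

theorem flat_diag (h : N = n + m) (G : (Fin (n + 1) → T) → Graded T) (i : Fin m) :
    (fun x : Fin N → T => G (Fin.snoc (fun j : Fin n => x ⟨j, by omega⟩) (x ⟨n + i, by omega⟩)) m
      (fun j => x ⟨n + j, by omega⟩)) =
      diag ⟨n, by omega⟩ ⟨n + i, by omega⟩ (flat (N := N + 1) (n := n + 1) (m := m) (by omega) G) := by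
  funext x
  simp only [diag, flat]
  congr 1
  · refine snoc_eq (fun j => ?_) ?_
    · exact insertNth_of_lt _ _ _ _ j.2
    · exact insertNth_of_eq _ _ _ _ rfl
  · funext j
    rw [insertNth_of_gt _ _ _ _ (by simp only; omega)]
    congr 1
    refine Fin.ext ?_
    simp only
    omega

variable [MeasurableSpace T] {σ : Measure T}

theorem annWeight_eq_pairWeight (Q : Kernel σ) (h : N = n + m) (i : Fin (m + 1)) (u : T)
    (x : Fin N → T) : annWeight Q i u (fun j => x ⟨n + j, by omega⟩) =
      pairWeight Q n ⟨n + i, by omega⟩ u x := by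
  classical
  unfold annWeight pairWeight
  rw [← Finset.prod_filter]
  refine Finset.prod_bij (fun l _ => ⟨n + l, by omega⟩) ?_ ?_ ?_ ?_
  · intro l hl
    simp only [Finset.mem_filter, Finset.mem_univ, true_and, Fin.lt_def, Fin.val_castSucc] at hl ⊢
    omega
  · intro l _ l' _ hll
    rw [Fin.mk.injEq] at hll
    exact Fin.ext (by omega)
  · intro y hy
    simp only [Finset.mem_filter, Finset.mem_univ, true_and, Fin.lt_def, Fin.val_castSucc] at hy
    refine ⟨⟨y.val - n, by omega⟩, ?_, Fin.ext (by simp only; omega)⟩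
    simp only [Finset.mem_filter, Finset.mem_univ, true_and, Fin.lt_def, Fin.val_castSucc]
    omega
  · intro l _
    rfl

theorem flat_contract (Q : Kernel σ) (h : N = n + m) (G : (Fin (n + 1) → T) → Graded T)
    (i : Fin (m + 1)) :
    (fun x : Fin N → T => ∫ u, annWeight Q i u (fun j => x ⟨n + j, by omega⟩) *
      G (Fin.snoc (fun j : Fin n => x ⟨j, by omega⟩) u) (m + 1)
        (i.insertNth u fun j => x ⟨n + j, by omega⟩) ∂σ) =
      contract Q n ⟨n, by omega⟩ ⟨n + i, by omega⟩
        (flat (N := N + 1 + 1) (n := n + 1) (m := m + 1) (by omega) G) := by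
  funext x
  simp only [contract, flat]
  refine integral_congr_ae (ae_of_all _ fun u => ?_)
  simp only
  rw [annWeight_eq_pairWeight Q h]
  congr 2
  · refine snoc_eq (fun j => ?_) ?_
    · rw [insertNth_of_lt _ _ _ _ j.2,
        insertNth_of_lt _ _ _ _ (by simp only [Fin.val_castSucc]; omega)]
      rfl
    · exact insertNth_of_eq _ _ _ _ rfl
  · funext j
    rcases lt_trichotomy j.val i.val with hj | hj | hj
    · rw [insertNth_of_lt _ _ _ _ hj, insertNth_of_gt ⟨n, _⟩ _ _ _ (by simp only; omega),
        insertNth_of_lt _ _ _ _ (by simp only; omega)]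
      congr 1
      exact Fin.ext (by simp only; omega)
    · rw [insertNth_of_eq _ _ _ _ hj, insertNth_of_gt ⟨n, _⟩ _ _ _ (by simp only; omega),
        insertNth_of_eq _ _ _ _ (by simp only; omega)]
    · rw [insertNth_of_gt _ _ _ _ hj, insertNth_of_gt ⟨n, _⟩ _ _ _ (by simp only; omega),
        insertNth_of_gt _ _ _ _ (by simp only; omega)]
      congr 1
      exact Fin.ext (by simp only; omega)

theorem flat_step (Q : Kernel σ) (lam : ℝ) (h : N = n + m) (G : (Fin (n + 1) → T) → Graded T) :
    flat h (fun t => step Q lam fun u => G (Fin.snoc t u)) = fun x =>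
      flat h (fun t => creationStep fun u => G (Fin.snoc t u)) x +
        lam * ∑ i : Fin m, diag ⟨n, by omega⟩ ⟨n + i, by omega⟩
          (flat (N := N + 1) (n := n + 1) (m := m) (by omega) G) x +
        ∑ i : Fin (m + 1), contract Q n ⟨n, by omega⟩ ⟨n + i, by omega⟩
          (flat (N := N + 1 + 1) (n := n + 1) (m := m + 1) (by omega) G) x := by
  funext x
  simp only [← flat_contract Q h, ← flat_diag h]
  rfl

omit [MeasurableSpace T] in
theorem flat_creationStep_zero (h : N = n + 0) (G : (Fin (n + 1) → T) → Graded T) :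
    flat h (fun t => creationStep fun u => G (Fin.snoc t u)) = fun _ => 0 := rfl

/-- All components of the family `G` are bounded, measurable, and vanish outside a power of `K`. -/
def FlatBounded (K : Set T) (G : (Fin n → T) → Graded T) : Prop :=
  ∀ m, BoxBounded K (flat (N := n + m) (m := m) rfl G)

theorem FlatBounded.boxBounded {K : Set T} {G : (Fin n → T) → Graded T} (hG : FlatBounded K G)
    (h : N = n + m) : BoxBounded K (flat h G) := by
  subst h
  exact hG m

variable {K : Set T}

theorem FlatBounded.creationStep {G : (Fin (n + 1) → T) → Graded T} (hG : FlatBounded K G) :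
    FlatBounded K fun t => creationStep fun u => G (Fin.snoc t u) := by
  intro m
  cases m with
  | zero => exact BoxBounded.zero
  | succ m =>
    rw [flat_creationStep]
    exact hG.boxBounded _

theorem FlatBounded.step [SigmaFinite σ] (Q : Kernel σ) (lam : ℝ)
    {G : (Fin (n + 1) → T) → Graded T} (hG : FlatBounded K G) (hKσ : σ K < ∞) :
    FlatBounded K fun t => step Q lam fun u => G (Fin.snoc t u) := by
  intro m
  rw [flat_step]
  exact ((hG.creationStep m).add (BoxBounded.const_mul _ (BoxBounded.sum fun i =>
    (hG.boxBounded _).diag _ _))).add (BoxBounded.sum fun i =>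
      (hG.boxBounded _).contract Q n hKσ _ _)

variable [SigmaFinite σ] (Q : Kernel σ) (lam : ℝ)

omit [SigmaFinite σ] in
theorem mom_flat_eq {N' k : ℕ} (h : N = n + m) (h' : N' = n + m) (G : (Fin n → T) → Graded T) :
    mom Q lam k (flat h G) = mom Q lam k (flat h' G) := by
  subst h h'
  rfl

theorem mom_flat_step {G : (Fin (n + 1) → T) → Graded T} (hG : FlatBounded K G)
    (hK : MeasurableSet K) (hKσ : σ K < ∞) (m : ℕ) :
    mom Q lam n (flat (N := n + m) rfl fun t => step Q lam fun u => G (Fin.snoc t u)) =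
      mom Q lam n (flat (N := n + m) rfl fun t => creationStep fun u => G (Fin.snoc t u)) +
      lam * ∑ i : Fin m, mom Q lam n (diag ⟨n, by omega⟩ ⟨n + i, by omega⟩
          (flat (N := n + m + 1) (n := n + 1) (m := m) (by omega) G)) +
      ∑ i : Fin (m + 1), mom Q lam n (contract Q n ⟨n, by omega⟩ ⟨n + i, by omega⟩
          (flat (N := n + m + 1 + 1) (n := n + 1) (m := m + 1) (by omega) G)) := by
  have h1 := hG.creationStep m
  have h2 : ∀ i : Fin m, BoxBounded K (diag ⟨n, by omega⟩ ⟨n + i, by omega⟩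
      (flat (N := n + m + 1) (n := n + 1) (m := m) (by omega) G)) := fun i =>
    (hG.boxBounded _).diag _ _
  have h3 : ∀ i : Fin (m + 1), BoxBounded K (contract Q n ⟨n, by omega⟩ ⟨n + i, by omega⟩
      (flat (N := n + m + 1 + 1) (n := n + 1) (m := m + 1) (by omega) G)) := fun i =>
    (hG.boxBounded _).contract Q n hKσ _ _
  rw [flat_step, mom_add Q lam n hK hKσ (h1.add (BoxBounded.const_mul _ (BoxBounded.sum h2)))
    (BoxBounded.sum h3), mom_add Q lam n hK hKσ h1 (BoxBounded.const_mul _ (BoxBounded.sum h2)),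
    mom_const_mul, mom_sum Q lam n hK hKσ h2, mom_sum Q lam n hK hKσ h3]

/-- The moment recursion: the last field acts on the vacuum side. -/
theorem sum_mom_step {G : (Fin (n + 1) → T) → Graded T} (hG : FlatBounded K G)
    (hK : MeasurableSet K) (hKσ : σ K < ∞) {M : ℕ} (hM : ∀ m, M ≤ m → ∀ t s, G t m s = 0) :
    ∑ m ∈ Finset.range M, mom Q lam (n + 1) (flat (N := n + 1 + m) (m := m) rfl G) =
      ∑ m ∈ Finset.range (M + 1), mom Q lam n
        (flat (N := n + m) (m := m) rfl fun t => step Q lam fun u => G (Fin.snoc t u)) := by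
  have hz : ∀ {N m : ℕ} (h : N = n + 1 + m), M ≤ m → flat h G = fun _ => 0 := fun h hm => by
    funext x
    exact hM _ hm _ _
  -- `c`, `e` and `d` collect the creation, neutral and annihilation terms. A step has them at `m`,
  -- `m`, `m + 1`, and the partition recursion at `m + 1`, `m`, `m`, so the sums agree after shifts
  -- whose boundary terms vanish.
  set c : ℕ → ℂ := fun m =>
    mom Q lam n (flat (N := n + m) (m := m) rfl fun t => creationStep fun u => G (Fin.snoc t u))
    with hc
  set e : ℕ → ℂ := fun m => lam * ∑ i : Fin m, mom Q lam n (diag ⟨n, by omega⟩ ⟨n + i, by omega⟩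
          (flat (N := n + m + 1) (n := n + 1) (m := m) (by omega) G)) with he
  -- The truncation of `n + m - 1` at `n = m = 0` is harmless, as the sum over `Fin 0` is empty.
  set d : ℕ → ℂ := fun m => ∑ i : Fin m, mom Q lam n (contract Q n (N := n + m - 1)
    ⟨n, by omega⟩ ⟨n + i, by omega⟩
          (flat (N := n + m - 1 + 1 + 1) (n := n + 1) (m := m) (by have := i.2; omega) G)) with hd
  have h1 : ∀ m, mom Q lam n
      (flat (N := n + m) (m := m) rfl fun t => step Q lam fun u => G (Fin.snoc t u)) =
        c m + e m + d (m + 1) := fun m => mom_flat_step Q lam hG hK hKσ m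
  have h2 : ∀ m, mom Q lam (n + 1) (flat (N := n + 1 + m) (m := m) rfl G) =
      c (m + 1) + e m + d m := by
    intro m
    have hcm : c (m + 1) =
        mom Q lam n (flat (N := n + (m + 1)) (n := n + 1) (m := m) (by omega) G) := by
      rw [hc]
      simp only [flat_creationStep]
    rw [hcm]
    cases m with
    | zero =>
      have he0 : e 0 = 0 := by simp [he]
      have hd0 : d 0 = 0 := by simp [hd]
      rw [he0, hd0]
      simp only [add_zero]
      exact mom_succ_of_eq Q lam (a := Fin.last n) rfl rfl _
    | succ m =>
      rw [mom_flat_eq Q lam rfl (show n + m + 1 + 1 = n + 1 + (m + 1) by omega)]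
      exact mom_succ Q lam (N := n + m) (m := m + 1) (a := ⟨n, by omega⟩) rfl rfl
        (hG.boxBounded _) hK hKσ
  have hcz : c 0 = 0 := by
    simp only [hc, flat_creationStep_zero, mom_zero]
  have hez : e M = 0 := by
    have : ∀ i : Fin M, diag ⟨n, by omega⟩ ⟨n + i, by omega⟩
        (flat (N := n + M + 1) (n := n + 1) (m := M) (by omega) G) = fun _ => 0 := fun i => by
      rw [hz _ le_rfl]
      rfl
    simp [he, this, mom_zero]
  have hdz : ∀ m, M ≤ m → d m = 0 := by
    intro m hm
    refine Finset.sum_eq_zero fun i _ => ?_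
    have : contract Q n (N := n + m - 1) ⟨n, by omega⟩ ⟨n + i, by omega⟩
          (flat (N := n + m - 1 + 1 + 1) (n := n + 1) (m := m) (by have := i.2; omega) G) =
        fun _ => 0 := by
      rw [hz _ hm]
      funext x
      simp [contract]
    rw [this, mom_zero]
  have hd0 : d 0 = 0 := by simp [hd]
  simp only [h1, h2, Finset.sum_add_distrib]
  rw [Finset.sum_range_succ' c, Finset.sum_range_succ e, hcz, hez, add_zero, add_zero]
  congr 1
  -- Two ways of splitting the sum of `d` over `range (M + 2)`: its first and its last two terms are
  -- zero.
  have h3 := Finset.sum_range_succ' d (M + 1)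
  rw [Finset.sum_range_succ d (M + 1), Finset.sum_range_succ d M, hdz M le_rfl,
    hdz (M + 1) (Nat.le_succ M), hd0, add_zero, add_zero, add_zero] at h3
  exact h3

/-- Induction on the number of fields left to act. One step widens the range of degrees by one, in
agreement with `sum_mom_step`. -/
theorem iter_zero_eq_sum_mom (hK : MeasurableSet K) (hKσ : σ K < ∞) :
    ∀ (n : ℕ) {G : (Fin n → T) → Graded T} (_ : FlatBounded K G) {M : ℕ}
      (_ : ∀ m, M ≤ m → ∀ t s, G t m s = 0), iter Q lam n G 0 ![] =
        ∑ m ∈ Finset.range M, mom Q lam n (flat (N := n + m) (m := m) rfl G) := by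
  intro n
  induction n with
  | zero =>
    intro G _ M hM
    cases M with
    | zero => exact hM 0 le_rfl _ _
    | succ M =>
      -- With no field left, only the empty partition at `m = 0` survives.
      rw [Finset.sum_range_succ', Finset.sum_eq_zero, zero_add]
      · refine Eq.trans ?_ (mom_zero_zero Q lam _).symm
        simp only [iter, flat]
        congr 1
      · intro m _
        rw [mom_flat_eq Q lam _ (show m + 1 = 0 + (m + 1) by omega)]
        exact mom_zero_left Q lam
  | succ n ih =>
    intro G hG M hM
    rw [sum_mom_step Q lam hG hK hKσ hM, ← ih (hG.step Q lam hKσ)]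
    · rfl
    · intro m hm t s
      cases m with
      | zero => omega
      | succ m =>
        simp only [step, creationStep]
        rw [hM m (by omega)]
        simp [hM (m + 1) (by omega), hM (m + 1 + 1) (by omega)]

end Flat

/-! ### The vacuum state of a monomial. -/

section Vacuum

variable {T : Type*} [MeasurableSpace T] {σ : Measure T} [SigmaFinite σ] (Q : Kernel σ)

theorem vacuumState_eq_inner (p : Module.End ℂ (FockFin Q)) :
    vacuumState Q p = inner ℂ (vacuum Q 0) (p (vacuum Q) 0) := by
  unfold vacuumState fockInner
  rw [finsum_eq_single _ 0 fun n hn => ?_]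
  · simp
  · have : vacuum Q n = 0 := DirectSum.of_eq_of_ne _ _ _ hn
    rw [this, inner_zero_left, mul_zero]

theorem coe_vacuum_zero : ((vacuum Q 0 : Hsym Q 0) : L2n σ 0) =
    memLp_one_pt.toLp (fun _ : Fin 0 → T => (1 : ℂ)) := by
  unfold vacuum
  rw [DirectSum.of_eq_same]

theorem norm_vacuum_zero : ‖vacuum Q 0‖ = 1 := by
  change ‖((vacuum Q 0 : Hsym Q 0) : L2n σ 0)‖ = 1
  rw [coe_vacuum_zero, Lp.norm_toLp, Measure.pi_of_empty,
    eLpNorm_const _ (by norm_num) (NeZero.ne _)]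
  simp

theorem symmetrize_zero_eq_smul (φ : (Fin 0 → T) → ℂ) :
    symmetrize Q 0 φ = φ ![] • vacuum Q 0 := by
  have h1 : φ = fun s => φ ![] * (1 : ℂ) + 0 * 0 := by
    funext s
    rw [Subsingleton.elim s ![]]
    ring
  rw [h1, symmetrize_linear (φ := fun _ => (1 : ℂ)) (ψ := fun _ => 0) memLp_one_pt MemLp.zero,
    zero_smul, add_zero, symmetrize_of_memLp memLp_one_pt, ← coe_vacuum_zero, P_of_mem]
  simp

theorem inner_vacuum_symmetrize (φ : (Fin 0 → T) → ℂ) :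
    inner ℂ (vacuum Q 0) (symmetrize Q 0 φ) = φ ![] := by
  have h : ∀ v : L2n σ 0, ‖v‖ = 1 → ∀ c : ℂ, inner ℂ v (c • v) = c := fun v hv c => by
    rw [inner_smul_right, inner_self_eq_norm_sq_to_K, hv]
    simp
  rw [symmetrize_zero_eq_smul]
  exact h (vacuum Q 0 : Hsym Q 0) (norm_vacuum_zero Q) _

theorem toGraded_vacuum (m : ℕ) : toGraded (vacuum Q) m =ᵐ[Measure.pi fun _ => σ]
    fun _ => if m = 0 then 1 else 0 := by
  unfold toGraded
  cases m with
  | zero =>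
    rw [coe_vacuum_zero]
    exact memLp_one_pt.coeFn_toLp
  | succ m =>
    have : vacuum Q (m + 1) = 0 := DirectSum.of_eq_of_ne _ _ _ (Nat.succ_ne_zero m)
    rw [this]
    exact Lp.coeFn_zero _ _ _

variable [TopologicalSpace T] [T2Space T] [OpensMeasurableSpace T] [IsFiniteMeasureOnCompacts σ]
  (lam : ℝ) {n : ℕ}

omit [SigmaFinite σ] in
theorem exists_boxBounded (f : B0 ℂ (Fin n → T)) :
    ∃ K : Set T, MeasurableSet K ∧ σ K < ∞ ∧ BoxBounded K f.1 := by
  obtain ⟨C, hC⟩ := f.2.2.1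
  obtain ⟨K, hK, hK'⟩ := exists_isCompact_box f.2.2.2.isCompact
  refine ⟨K, hK.isClosed.measurableSet, hK.measure_lt_top, f.2.1, ⟨|C|, abs_nonneg C, fun t =>
    (hC t).trans (le_abs_self C)⟩, fun t i hi =>
      eq_zero_of_notMem_box hK' (subset_tsupport _) t ⟨i, hi⟩⟩

/-- The vacuum may be replaced by the constant 1 in degree zero, up to null sets. The family then
has a single component, so the partition sum reduces to its term `m = 0`. -/
theorem vacuumState_wick (f : B0 ℂ (Fin n → T)) :
    vacuumState Q (wick Q lam n f) = mom Q lam n f.1 := by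
  obtain ⟨K, hK, hKσ, hf⟩ := exists_boxBounded (σ := σ) f
  have h1 : iter Q lam n (fun t m s => f.1 t * toGraded (vacuum Q) m s) 0
      =ᵐ[Measure.pi fun _ => σ] iter Q lam n (fun t m _ => f.1 t * if m = 0 then 1 else 0) 0 := by
    refine iter_congr Q lam fun m _ => ?_
    filter_upwards [toGraded_vacuum Q m] with s hs t
    rw [hs]
  have h2 : FlatBounded K (fun (t : Fin n → T) m (_ : Fin m → T) =>
      f.1 t * if m = 0 then 1 else 0) := by
    intro m
    cases m with
    | zero =>
      have : (flat (N := n + 0) (m := 0) rfl fun (t : Fin n → T) m (_ : Fin m → T) =>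
          f.1 t * if m = 0 then 1 else 0) = f.1 := funext fun x => mul_one _
      rw [this]
      exact hf
    | succ m =>
      have : (flat (N := n + (m + 1)) (m := m + 1) rfl fun (t : Fin n → T) m (_ : Fin m → T) =>
          f.1 t * if m = 0 then 1 else 0) = fun _ => 0 := funext fun x => mul_zero _
      rw [this]
      exact BoxBounded.zero
  rw [vacuumState_eq_inner, wick_apply, wickComp, symmetrize_congr h1, inner_vacuum_symmetrize,
    iter_zero_eq_sum_mom Q lam hK hKσ n h2 (M := 1) fun m hm t s => by
      rw [if_neg (by omega), mul_zero], Finset.sum_range_one]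
  exact congrArg (mom Q lam n) (funext fun x => mul_one _)

end Vacuum

/-! ### From equivalence relations back to partitions into blocks. -/

section Partition

variable {n : ℕ} (V : Finpartition (Finset.univ : Finset (Fin n)))

theorem mem_blockOf_iff (x y : Fin n) : y ∈ (blockOf V x).1 ↔ blockOf V x = blockOf V y :=
  (V.mem_part_iff_part_eq_part (Finset.mem_univ _) (Finset.mem_univ _)).trans
    (eq_comm.trans (Subtype.ext_iff (a1 := blockOf V x) (a2 := blockOf V y)).symm)

/-- The equivalence relation whose classes are the blocks of `V`. -/
def blockSetoid : Setoid (Fin n) := Setoid.ker (blockOf V)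

theorem blockSetoid_apply (x y : Fin n) : blockSetoid V x y ↔ blockOf V x = blockOf V y := Iff.rfl

theorem blockOf_eq {B : V.parts} {x : Fin n} (h : x ∈ B.1) : blockOf V x = B :=
  Subtype.ext (V.part_eq_of_mem B.2 h)

theorem isColoring_blockOf : IsColoring (blockOf V) (blockSetoid V) :=
  ⟨fun B => (V.nonempty_of_mem_parts B.2).imp fun _ hx => blockOf_eq V hx, fun _ _ => Iff.rfl⟩

theorem mem_iff_blockOf_eq (B : V.parts) (x : Fin n) : x ∈ B.1 ↔ blockOf V x = B :=
  ⟨blockOf_eq V, fun h => h ▸ V.mem_part_self.2 (Finset.mem_univ x)⟩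

theorem mem_partitionsGeTwo_iff :
    V ∈ partitionsGeTwo n ↔ ∀ x, HasPartner (blockSetoid V) x := by
  simp only [partitionsGeTwo, Finset.mem_filter, Finset.mem_univ, true_and]
  constructor
  · intro h x
    obtain ⟨y, hy, hyx⟩ := Finset.exists_mem_ne (h _ (blockOf V x).2) x
    exact ⟨y, hyx, (mem_blockOf_iff V x y).1 hy⟩
  · intro h B hB
    obtain ⟨x, hx⟩ := V.nonempty_of_mem_parts hB
    obtain ⟨y, hyx, hxy⟩ := h x
    have hy : y ∈ B := (mem_iff_blockOf_eq V ⟨B, hB⟩ y).2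
      (hxy.symm.trans (blockOf_eq V (B := ⟨B, hB⟩) hx))
    exact Finset.one_lt_card.2 ⟨y, hy, x, hx, hyx⟩

theorem blockSetoid_injective : Function.Injective (blockSetoid (n := n)) := by
  intro V V' h
  have h1 : ∀ x, V.part x = V'.part x := by
    intro x
    ext y
    rw [show y ∈ V.part x ↔ blockSetoid V x y from mem_blockOf_iff V x y, h]
    exact (mem_blockOf_iff V' x y).symm
  refine Finpartition.ext (Finset.ext fun B => ⟨fun hB => ?_, fun hB => ?_⟩)
  · obtain ⟨x, hx⟩ := V.nonempty_of_mem_parts hB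
    rw [← V.part_eq_of_mem hB hx, h1]
    exact V'.part_mem.2 (Finset.mem_univ x)
  · obtain ⟨x, hx⟩ := V'.nonempty_of_mem_parts hB
    rw [← V'.part_eq_of_mem hB hx, ← h1]
    exact V.part_mem.2 (Finset.mem_univ x)

theorem blockSetoid_surjective : Function.Surjective (blockSetoid (n := n)) := by
  classical
  intro r
  refine ⟨Finpartition.ofSetoid r, Setoid.ext fun x y => ?_⟩
  rw [blockSetoid_apply, ← mem_blockOf_iff]
  exact Finpartition.mem_part_ofSetoid_iff_rel

/-- The exponents `|B| - 2` add up to `n` minus twice the number of blocks, since the block sizes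
add up to `n` and none is smaller than two. -/
theorem prod_pow_eq (hV : V ∈ partitionsGeTwo n) (z : ℂ) :
    ∏ B ∈ V.parts, z ^ (B.card - 2) = z ^ (n - 2 * blockCount (blockSetoid V)) := by
  have h1 := V.sum_card_parts
  rw [Finset.card_univ, Fintype.card_fin] at h1
  have h2 : ∑ B ∈ V.parts, (B.card - 2) + ∑ _B ∈ V.parts, 2 = ∑ B ∈ V.parts, B.card := by
    rw [← Finset.sum_add_distrib]
    exact Finset.sum_congr rfl fun B hB =>
      Nat.sub_add_cancel ((Finset.mem_filter.1 hV).2 B hB)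
  rw [Finset.sum_const, smul_eq_mul] at h2
  rw [Finset.prod_pow_eq_pow_sum, (isColoring_blockOf V).blockCount_eq,
    Nat.card_eq_fintype_card, Fintype.card_coe]
  congr 1
  omega

theorem blockSetoid_iff_mem (x y : Fin n) : blockSetoid V x y ↔ y ∈ (blockOf V x).1 :=
  (mem_blockOf_iff V x y).symm

theorem blockOf_blockMin (B : V.parts) : blockOf V (blockMin V B) = B :=
  blockOf_eq V (Finset.min'_mem _ _)

theorem blockOf_blockMax (B : V.parts) : blockOf V (blockMax V B) = B :=
  blockOf_eq V (Finset.max'_mem _ _)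

theorem isCrossing_blockMin_blockMax (B₁ B₂ : V.parts) :
    IsCrossing (blockSetoid V) (blockMin V B₂) (blockMax V B₁) ↔
      blockMin V B₁ < blockMin V B₂ ∧ blockMin V B₂ < blockMax V B₁ ∧
        blockMax V B₁ < blockMax V B₂ := by
  simp only [IsCrossing, blockSetoid_iff_mem, blockOf_blockMin, blockOf_blockMax]
  constructor
  · rintro ⟨-, -, h3, ⟨z, hz, hzx⟩, w, hw, hyw⟩
    exact ⟨(Finset.min'_le _ z hz).trans_lt hzx, h3, hyw.trans_le (Finset.le_max' _ w hw)⟩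
  · rintro ⟨h3, h4, h5⟩
    exact ⟨fun z hz => Finset.min'_le _ z hz, fun z hz => Finset.le_max' _ z hz, h4,
      ⟨_, Finset.min'_mem _ _, h3⟩, _, Finset.max'_mem _ _, h5⟩

theorem IsCrossing.eq_blockMin {x y : Fin n} (h : IsCrossing (blockSetoid V) x y) :
    x = blockMin V (blockOf V x) :=
  le_antisymm (h.1 _ ((blockSetoid_iff_mem V _ _).2 (Finset.min'_mem _ _)))
    (Finset.min'_le _ _ ((mem_iff_blockOf_eq V _ _).2 rfl))

theorem IsCrossing.eq_blockMax {x y : Fin n} (h : IsCrossing (blockSetoid V) x y) :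
    y = blockMax V (blockOf V y) :=
  le_antisymm (Finset.le_max' _ _ ((mem_iff_blockOf_eq V _ _).2 rfl))
    (h.2.1 _ ((blockSetoid_iff_mem V _ _).2 (Finset.max'_mem _ _)))

variable {T : Type*} [MeasurableSpace T] {σ : Measure T}

/-- A block is determined by its minimum, and also by its maximum. Crossing pairs of blocks thus
correspond to crossing pairs of points `(min B₂, max B₁)`. -/
theorem crossingWeight_eq (Q : Kernel σ) : crossingWeight Q V = setoidWeight Q (blockSetoid V) := by
  classical
  funext t
  unfold setoidWeight crossingWeight
  rw [← Finset.prod_product', ← Finset.prod_filter]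
  refine Finset.prod_bij (fun p _ => (blockMin V p.2, blockMax V p.1)) ?_ ?_ ?_ ?_
  · intro p hp
    exact Finset.mem_filter.2 ⟨Finset.mem_univ _,
      (isCrossing_blockMin_blockMax V p.1 p.2).2 (Finset.mem_filter.1 hp).2⟩
  · intro p _ q _ h
    rw [Prod.mk.injEq] at h
    exact Prod.ext (Function.LeftInverse.injective (blockOf_blockMax V) h.2)
      (Function.LeftInverse.injective (blockOf_blockMin V) h.1)
  · rintro ⟨x, y⟩ h
    have h1 : IsCrossing (blockSetoid V) x y := (Finset.mem_filter.1 h).2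
    refine ⟨(blockOf V y, blockOf V x), Finset.mem_filter.2 ⟨Finset.mem_univ _, ?_⟩,
      Prod.ext h1.eq_blockMin.symm h1.eq_blockMax.symm⟩
    rw [← isCrossing_blockMin_blockMax, ← h1.eq_blockMin, ← h1.eq_blockMax]
    exact h1
  · intro p _
    rfl

theorem blockDelta_eq [SigmaFinite σ] : blockDelta σ V = setoidMeasure σ (blockSetoid V) :=
  (isColoring_blockOf V).setoidMeasure_eq.symm

/-- At `k = n` no position is `≥ k`, so the separation condition is void and exactly the partitions
with blocks of size at least two remain. -/
theorem mom_eq_sum_partitions [SigmaFinite σ] (Q : Kernel σ) (lam : ℝ) (f : (Fin n → T) → ℂ) :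
    mom Q lam n f = ∑ V ∈ partitionsGeTwo n,
      (∏ B ∈ V.parts, (lam : ℂ) ^ (B.card - 2)) *
        ∫ t, f t * crossingWeight Q V t ∂(blockDelta σ V) := by
  symm
  refine Finset.sum_bij (fun V _ => blockSetoid V) ?_ ?_ ?_ ?_
  · intro V hV
    exact mem_goodSetoids.2 ⟨(mem_partitionsGeTwo_iff V).1 hV, fun x _ hx => by omega⟩
  · intro V _ V' _ h
    exact blockSetoid_injective h
  · intro r hr
    obtain ⟨V, rfl⟩ := blockSetoid_surjective r
    exact ⟨V, (mem_partitionsGeTwo_iff V).2 (mem_goodSetoids.1 hr).1, rfl⟩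
  · intro V hV
    rw [prod_pow_eq V hV, crossingWeight_eq, blockDelta_eq]

end Partition

end QField

/-! ### The moments formula. -/

theorem mainTheorem4 {T : Type*} [TopologicalSpace T] [PolishSpace T] [LocallyCompactSpace T]
    [MeasurableSpace T] [BorelSpace T] (σ : MeasureTheory.Measure T)
    [MeasureTheory.IsLocallyFiniteMeasure σ] [MeasureTheory.NullSingletonClass σ]
    (Q : QField.Kernel σ) (lam : ℝ) (n : ℕ) :
    ∃ W : QField.B0 ℂ (Fin n → T) →ₗ[ℂ] Module.End ℂ (QField.FockFin Q),
      QField.IsMonomialMap Q lam n W ∧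
      (∀ W', QField.IsMonomialMap Q lam n W' → W' = W) ∧
      ∀ f : QField.B0 ℂ (Fin n → T),
        (∀ V ∈ QField.partitionsGeTwo n,
          MeasureTheory.Integrable (fun t => f.1 t * QField.crossingWeight Q V t)
            (QField.blockDelta σ V)) ∧
        QField.vacuumState Q (W f) =
          ∑ V ∈ QField.partitionsGeTwo n,
            (∏ B ∈ V.parts, (lam : ℂ) ^ (B.card - 2)) *
              ∫ t, f.1 t * QField.crossingWeight Q V t ∂(QField.blockDelta σ V) := by
  refine ⟨QField.wick Q lam n, QField.isMonomialMap_wick lam,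
    fun W' hW' => hW'.unique (QField.isMonomialMap_wick lam), fun f => ⟨fun V _ => ?_, ?_⟩⟩
  · obtain ⟨K, hK, hKσ, hf⟩ := QField.exists_boxBounded (σ := σ) f
    rw [QField.crossingWeight_eq, QField.blockDelta_eq]
    exact hf.integrable_mul_setoidWeight Q hK hKσ _
  · rw [QField.vacuumState_wick, QField.mom_eq_sum_partitions]
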